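/- **Setting.** Let $M$ be a (Hausdorff) smooth manifold of dimension $n\ge 2$ with a smooth torsion-free affine connection $\nabla$, and let $\boldsymbol p=[\nabla]$ be its projective class, i.e. all torsion-free $\nabla'$ with $\nabla'_a v^b=\nabla_a v^b+\Upsilon_a v^b+\Upsilon_c v^c\delta_a^b$ for some one-form $\Upsilon$. Write $[\nabla_a,\nabla_b]v^c=R_{ab}{}^c{}_d v^d$, $R_{bd}=R_{cb}{}^c{}_d$, and let $\mathsf P_{ab}$ be defined by $(n-1)\mathsf P_{ab}=R_{ab}-2\mathsf P_{[ab]}$. Put $\mathcal E(w)=((\Lambda^nTM)^2)^{w/(2n+2)}$ and $\mathcal B(w)=\mathcal B\otimes\mathcal E(w)$. Let $\mathcal T^*=J^1\mathcal E(1)$. The connection $\nabla$ identifies $\mathcal T^*$ with $\mathcal E(1)\oplus T^*M(1)$; we write its elements as $\sigma Y_A+\mu_aZ_A{}^a$. If $\nabla$ is replaced by $\nabla'$ then $(\sigma,\mu_a)$ becomes $(\sigma,\mu_a+\Upsilon_a\sigma)$. The tractor connection on $\mathcal T^*$ is $\nabla_a(\sigma,\mu_b)=(\nabla_a\sigma-\mu_a,\nabla_a\mu_b+\mathsf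 P_{ab}\sigma)$; $\mathcal T$ carries the dual connection, with curvature $[\nabla_a,\nabla_b]V^C=\kappa_{ab}{}^C{}_DV^D$. On tractor tensors $V$ of weight $w$ put $\mathbb D_AV=wY_AV+Z_A{}^a\nabla_aV$ (of weight $w-1$), and let $W_{AB}{}^C{}_D=Z_A{}^aZ_B{}^b\kappa_{ab}{}^C{}_D$ (of weight $-2$). For $r\ge 1$ and $k\in\Gamma(S^rT^*M(2r))$ put $K_{C_1\cdots C_r}=Z_{C_1}{}^{c_1}\cdots Z_{C_r}{}^{c_r}k_{c_1\cdots c_r}\in\Gamma(S^r\mathcal T^*(r))$ and $$\mathcal L(k)=P_{(r,r)}\big(\mathbb D_{B_1}\cdots\mathbb D_{B_r}K_{C_1\cdots C_r}\big),\qquad P_{(r,r)}=S_{(1,\dots,r)}\circ S_{(r+1,\dots,2r)}\circ S_{[1,r+1]}\circ\cdots\circ S_{[r,2r]},$$ where $S_{(\cdots)}$ is symmetrisation (the average) over the listed index positions and $S_{[i,j]}$ is skew-symmetrisation (with factor $\tfrac12$) in positions $i,j$. **Proposition.** For every $r\ge1$ there is an operator $\mathbf{Kurv}$ from tractor fields $K_{C_1\cdots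 C_r}$ of weight $r$ to tractor fields with $2r$ lower indices and weight $0$, given by a universal formula that depends only on $r$, namely by a finite linear combination, with rational coefficients, of tensor fields obtained from $$(\mathbb D_{A_1}\cdots\mathbb D_{A_a}W_{AB}{}^C{}_D)\,(\mathbb D_{E_1}\cdots\mathbb D_{E_b}K_{C_1\cdots C_r}),\qquad a+b=r-2,$$ by contracting the upper index of $W$ with a lower index of the second factor and permuting the remaining $2r$ lower indices, such that for all $(M,\nabla)$ as above the following hold. 1. A section $k\in\Gamma(S^rT^*M(2r))$ is a Killing tensor, i.e. $\nabla_{(a_0}k_{a_1\cdots a_r)}=0$, if and only if $$\mathcal L(k)_{B_1\cdots B_rC_1\cdots C_r}=\frac{r+1}{2^r}\,\mathbb D_{B_1}\cdots\mathbb D_{B_r}K_{C_1\cdots C_r}+\mathbf{Kurv}(K)_{B_1\cdots B_rC_1\cdots C_r}.$$ 2. $\mathbf{Kurv}$ is projectively invariant: for every smooth weight-$r$ tractor field $K_{C_1\cdots C_r}$ (on a coordinate domain), the tractor field $\mathbf{Kurv}(K)$ is the same for all connections in $\boldsymbol p$. In particular $\mathbf{Kurv}$ is a linear differential operator of order at most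 $r-2$ in $K$ (it is $0$ if $r=1$), and the $W$-curvature or one of its $\mathbb D$-derivatives is a factor of every term. -/

import Mathlib

open scoped Manifold ContDiff

noncomputable section

namespace ProjTractor

/-! ## Tensor calculus in a coordinate domain of `ℝⁿ` -/

/-- The model space `ℝⁿ`. -/
abbrev Model (n : ℕ) := EuclideanSpace ℝ (Fin n)

/-- The partial derivative `∂_a f`. -/
def pd {n : ℕ} (a : Fin n) (f : Model n → ℝ) (y : Model n) : ℝ :=
  fderiv ℝ f y (EuclideanSpace.single a 1)

/-- Connection coefficients: `Γ c a b` is `Γ^c_{ab}`, with `∇_{∂_a} ∂_b = Γ^c_{ab} ∂_c`. -/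
abbrev Coeffs (n : ℕ) := Fin n → Fin n → Fin n → Model n → ℝ

/-- The components `R_{ab}{}^c{}_d` of the curvature, `[∇_a, ∇_b] v^c = R_{ab}{}^c{}_d v^d`
(for a torsion-free connection). -/
def curvature {n : ℕ} (Γ : Coeffs n) (a b c d : Fin n) (y : Model n) : ℝ :=
  pd a (Γ c b d) y - pd b (Γ c a d) y
    + ∑ e, (Γ c a e y * Γ e b d y - Γ c b e y * Γ e a d y)

/-- The Ricci curvature `R_{bd} = R_{cb}{}^c{}_d`. -/
def ricci {n : ℕ} (Γ : Coeffs n) (b d : Fin n) (y : Model n) : ℝ :=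
  ∑ c, curvature Γ c b c d y

/-- The projective Schouten tensor `P_{ab} = (n R_{ab} + R_{ba}) / (n² - 1)`; see
`schouten_spec` for the implicit description `(n - 1) P_{ab} = R_{ab} + β_{ab}`,
`β_{ab} = -2 P_{[ab]}`. -/
def schouten {n : ℕ} (Γ : Coeffs n) (a b : Fin n) (y : Model n) : ℝ :=
  ((n : ℝ) * ricci Γ a b y + ricci Γ b a y) / ((n : ℝ) ^ 2 - 1)

theorem schouten_spec {n : ℕ} (hn : 2 ≤ n) (Γ : Coeffs n) (a b : Fin n) (y : Model n) :
    ((n : ℝ) - 1) * schouten Γ a b y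
      = ricci Γ a b y - (schouten Γ a b y - schouten Γ b a y) := by
  have h2 : (2 : ℝ) ≤ n := by exact_mod_cast hn
  have h : ((n : ℝ) ^ 2 - 1) ≠ 0 := by nlinarith
  unfold schouten
  field_simp
  ring

/-- The contraction `Γ^c_{ac}`, i.e. the connection form on `Λⁿ TM`. -/
def traceForm {n : ℕ} (Γ : Coeffs n) (a : Fin n) (y : Model n) : ℝ := ∑ c, Γ c a c y

/-! ## Weighted tractor fields

The cotractor bundle `𝓣* = J¹𝓔(1)` is identified by the chosen torsion-free connection with
`𝓔(1) ⊕ T*M(1)`, a cotractor being written `U = σ Y + μ_b Z^b`, and dually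
`𝓣 = TM(-1) ⊕ 𝓔(-1)`, a tractor being written `V = ν^b W_b + ρ X`. A tractor index is
`some b` for the components `μ_b`, `ν^b` and `none` for the components `σ`, `ρ`. In a chart,
density bundles are trivialised by the coordinate volume form. -/

/-- Values of a tractor index. -/
abbrev TIdx (n : ℕ) := Option (Fin n)

/-- Component functions of a field with `p` upper and `q` lower tractor indices. -/
abbrev TField (n p q : ℕ) := Model n → (Fin p → TIdx n) → (Fin q → TIdx n) → ℝ

/-- The connection matrix `A_a{}^C{}_B` of the tractor connection, apart from the contribution of
the density weights of the components, in the form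
`∇_a (σ, μ_b) = (∇_a σ - μ_a, ∇_a μ_b + P_{ab} σ)` for `𝓣*`, and
`∇_a (ν^b, ρ) = (∇_a ν^b + ρ δ_a^b, ∇_a ρ - P_{ab} ν^b)` for `𝓣`. -/
def tractorForm {n : ℕ} (Γ : Coeffs n) (a : Fin n) : TIdx n → TIdx n → Model n → ℝ
  | some c, some b => fun y => Γ c a b y
  | some c, none => fun _ => if c = a then 1 else 0
  | none, some b => fun y => - schouten Γ a b y
  | none, none => fun _ => 0

/-- The connection `∇_a` on `(⊗^p 𝓣) ⊗ (⊗^q 𝓣*) ⊗ 𝓔(w)` induced by the tractor connection and the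
connection on densities. All components have density weight `w + q - p`, and
`∇_a τ = ∂_a τ + (u / (n + 1)) Γ^c_{ac} τ` for a density `τ` of weight `u`. -/
def tractorNabla {n p q : ℕ} (Γ : Coeffs n) (w : ℝ) (a : Fin n) (T : TField n p q) :
    TField n p q := fun y U L =>
  pd a (fun z => T z U L) y
    + ((w + q - p) / ((n : ℝ) + 1)) * traceForm Γ a y * T y U L
    + ∑ s, ∑ C, tractorForm Γ a (U s) C y * T y (Function.update U s C) L
    - ∑ s, ∑ C, tractorForm Γ a C (L s) y * T y U (Function.update L s C)

/-- The Thomas operator `𝔻_A T = w Y_A T + Z_A{}^a ∇_a T` on tractor fields of weight `w`. The new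
index is put first; the result has weight `w - 1`. -/
def thomasD {n p q : ℕ} (Γ : Coeffs n) (w : ℝ) (T : TField n p q) : TField n p (q + 1) :=
  fun y U L =>
    match L 0 with
    | none => w * T y U (Fin.tail L)
    | some a => tractorNabla Γ w a T y U (Fin.tail L)

/-- `𝔻_{A_1} ⋯ 𝔻_{A_m} T`, for `T` of weight `w`. The indices `A_1, …, A_m` come first. -/
def thomasDPow {n p q : ℕ} (Γ : Coeffs n) (w : ℝ) (T : TField n p q) :
    (m : ℕ) → TField n p (q + m)
  | 0 => T
  | m + 1 => thomasD Γ (w - m) (thomasDPow Γ w T m)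

/-- The connection matrix of the tractor connection on the (unweighted) bundle `𝓣`. -/
def tractorFormT {n : ℕ} (Γ : Coeffs n) (a : Fin n) (C D : TIdx n) (y : Model n) : ℝ :=
  tractorForm Γ a C D y - if C = D then traceForm Γ a y / ((n : ℝ) + 1) else 0

/-- The curvature `κ_{ab}{}^C{}_D` of the tractor connection,
`[∇_a, ∇_b] V^C = κ_{ab}{}^C{}_D V^D`. -/
def tractorCurvature {n : ℕ} (Γ : Coeffs n) (a b : Fin n) (C D : TIdx n) (y : Model n) : ℝ :=
  pd a (tractorFormT Γ b C D) y - pd b (tractorFormT Γ a C D) y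
    + ∑ E, (tractorFormT Γ a C E y * tractorFormT Γ b E D y
        - tractorFormT Γ b C E y * tractorFormT Γ a E D y)

/-- The `W`-curvature `W_{AB}{}^C{}_D = Z_A{}^a Z_B{}^b κ_{ab}{}^C{}_D`, a tractor field of weight
`-2`, with lower indices in the order `A, B, D`. -/
def wCurvature {n : ℕ} (Γ : Coeffs n) : TField n 1 3 := fun y U L =>
  match L 0, L 1 with
  | some a, some b => tractorCurvature Γ a b (U 0) (L 2) y
  | _, _ => 0

/-! ## Young projection, Killing equation and splitting operator -/

/-- Symmetrisation over all indices. -/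
def symAll {ι : Type*} {m : ℕ} (T : (Fin m → ι) → ℝ) : (Fin m → ι) → ℝ := fun L =>
  (m.factorial : ℝ)⁻¹ * ∑ σ : Equiv.Perm (Fin m), T (L ∘ σ)

/-- Symmetrisation over the first `r` of `2 r` indices. -/
def symFirst {ι : Type*} {r : ℕ} (T : (Fin (r + r) → ι) → ℝ) : (Fin (r + r) → ι) → ℝ := fun L =>
  (r.factorial : ℝ)⁻¹ * ∑ σ : Equiv.Perm (Fin r),
    T (Fin.append (fun i => L (Fin.castAdd r (σ i))) (fun i => L (Fin.natAdd r i)))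

/-- Symmetrisation over the last `r` of `2 r` indices. -/
def symLast {ι : Type*} {r : ℕ} (T : (Fin (r + r) → ι) → ℝ) : (Fin (r + r) → ι) → ℝ := fun L =>
  (r.factorial : ℝ)⁻¹ * ∑ σ : Equiv.Perm (Fin r),
    T (Fin.append (fun i => L (Fin.castAdd r i)) (fun i => L (Fin.natAdd r (σ i))))

/-- Skew-symmetrisation over the indices in the positions `i` and `r + i`. -/
def skewPair {ι : Type*} {r : ℕ} (i : Fin r) (T : (Fin (r + r) → ι) → ℝ) :
    (Fin (r + r) → ι) → ℝ := fun L =>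
  (T L - T (L ∘ Equiv.swap (Fin.castAdd r i) (Fin.natAdd r i))) / 2

/-- The Young map `P_{(r,r)} = S_{(1,…,r)} ∘ S_{(r+1,…,2r)} ∘ S_{[1,r+1]} ∘ ⋯ ∘ S_{[r,2r]}`. -/
def youngP {ι : Type*} {r : ℕ} (T : (Fin (r + r) → ι) → ℝ) : (Fin (r + r) → ι) → ℝ :=
  symFirst (symLast ((List.finRange r).foldr skewPair T))

/-- The components of `∇_{a_0} k_{a_1 ⋯ a_r}` for a covariant tensor field `k` of density weight
`w`; the new index is put first. -/
def nablaTensor {n r : ℕ} (Γ : Coeffs n) (w : ℝ) (k : Model n → (Fin r → Fin n) → ℝ) :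
    Model n → (Fin (r + 1) → Fin n) → ℝ := fun y i =>
  pd (i 0) (fun z => k z (Fin.tail i)) y
    + (w / ((n : ℝ) + 1)) * traceForm Γ (i 0) y * k y (Fin.tail i)
    - ∑ s, ∑ c, Γ c (i 0) (Fin.tail i s) y * k y (Function.update (Fin.tail i) s c)

/-- `K_{C_1 ⋯ C_r} = Z_{C_1}{}^{c_1} ⋯ Z_{C_r}{}^{c_r} k_{c_1 ⋯ c_r}`. -/
def tractorOf {n r : ℕ} (k : Model n → (Fin r → Fin n) → ℝ) : TField n 0 r := fun y _ L =>
  if h : ∀ s, (L s).isSome then k y (fun s => (L s).get (h s)) else 0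

/-- The splitting operator `𝓛(k) = P_{(r,r)}(𝔻_{B_1} ⋯ 𝔻_{B_r} K_{C_1 ⋯ C_r})`. -/
def splitting {n r : ℕ} (Γ : Coeffs n) (k : Model n → (Fin r → Fin n) → ℝ) : TField n 0 (r + r) :=
  fun y U => youngP (thomasDPow Γ r (tractorOf k) r y U)

/-! ## Formulas for curvature operators -/

/-- A term of a formula for a curvature operator: a rational multiple of a tensor field obtained
from `(𝔻^a W) ⊗ (𝔻^b K)`, where `a + b = r - 2`, by contracting the upper index of `W` with a lower
index of `𝔻^b K` and distributing the remaining `2 r` lower indices bijectively over the positions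
`1, …, 2 r`. The lower indices of `𝔻^a W` are `Fin (3 + a)`, those of `𝔻^b K` are `Fin (r + b)`;
`slot` gives the position of an uncontracted index and is `none` at the contracted one. -/
structure CurvTerm (r : ℕ) where
  a : ℕ
  b : ℕ
  order_eq : a + b + 2 = r
  coeff : ℚ
  slot : Fin (3 + a) ⊕ Fin (r + b) ≃ Option (Fin (r + r))
  contracted : ∃ s, slot (Sum.inr s) = none

/-- A formula for a curvature operator: a formal sum of terms. -/
abbrev CurvFormula (r : ℕ) := List (CurvTerm r)

/-- The tensor field given by a term. -/
def CurvTerm.eval {n r : ℕ} (t : CurvTerm r) (Γ : Coeffs n) (K : TField n 0 r) :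
    TField n 0 (r + r) := fun y U L =>
  (t.coeff : ℝ) * ∑ C : TIdx n,
    thomasDPow Γ (-2) (wCurvature Γ) t.a y (fun _ => C)
        (fun s => (t.slot (Sum.inl s)).elim C L)
      * thomasDPow Γ r K t.b y U (fun s => (t.slot (Sum.inr s)).elim C L)

/-- The operator given by a formula, on rank `r` cotractor fields of weight `r`. -/
def CurvFormula.eval {n r : ℕ} (F : CurvFormula r) (Γ : Coeffs n) (K : TField n 0 r) :
    TField n 0 (r + r) := fun y U L =>
  (F.map fun t => t.eval Γ K y U L).sum

/-- The change of the components of a covariant tractor field when the connection `∇`, which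
identifies `J¹𝓔(1)` with `𝓔(1) ⊕ T*M(1)`, is replaced by the projectively equivalent connection
determined by `Υ`: in each index, `(σ, μ_b)` becomes `(σ, μ_b + Υ_b σ)`. -/
def changeScale {n q : ℕ} (Υ : Fin n → Model n → ℝ) (T : TField n 0 q) : TField n 0 q :=
  fun y U L => ∑ L' : Fin q → TIdx n,
    (∏ s, match L s, L' s with
      | some b, none => Υ b y
      | B, C => if B = C then 1 else 0) * T y U L'

/-! ## Manifolds -/

section Manifold

variable {n : ℕ} {M : Type*} [TopologicalSpace M] [ChartedSpace (Model n) M]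

/-- The differential of a chart, with its value read as a vector of `ℝⁿ`. -/
def chartDeriv (φ : OpenPartialHomeomorph M (Model n)) (x : M) :
    TangentSpace (𝓡 n) x →L[ℝ] Model n :=
  mfderiv (𝓡 n) (𝓡 n) φ x

/-- The coordinate vector field `∂_b` of a chart (only meaningful on the source of the chart). -/
def coordField (φ : OpenPartialHomeomorph M (Model n)) (b : Fin n) (x : M) :
    TangentSpace (𝓡 n) x :=
  (chartDeriv φ x).inverse (EuclideanSpace.single b 1)

/-- The coordinate volume form `dx¹ ∧ ⋯ ∧ dxⁿ` of a chart at `x`. -/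
def coordVol (φ : OpenPartialHomeomorph M (Model n)) (x : M) :
    (TangentSpace (𝓡 n) x) [⋀^Fin n]→ₗ[ℝ] ℝ :=
  ((EuclideanSpace.basisFun (Fin n) ℝ).toBasis.det).compLinearMap
    (chartDeriv φ x : TangentSpace (𝓡 n) x →ₗ[ℝ] Model n)

/-- Affine connections, i.e. covariant derivatives on the tangent bundle. -/
abbrev AffineConn (n : ℕ) (M : Type*) [TopologicalSpace M] [ChartedSpace (Model n) M]
    [IsManifold (𝓡 n) ∞ M] :=
  CovariantDerivative (𝓡 n) (Model n) (TangentSpace (𝓡 n) : M → Type _)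

/-- The connection coefficients of an affine connection in a chart. -/
def christoffel [IsManifold (𝓡 n) ∞ M] (cov : AffineConn n M)
    (φ : OpenPartialHomeomorph M (Model n)) : Coeffs n := fun c a b y =>
  chartDeriv φ (φ.symm y) (cov (coordField φ b) (φ.symm y) (coordField φ a (φ.symm y))) c

/-- `cov' = cov + Υ` projectively: `∇'_a v^b = ∇_a v^b + Υ_a v^b + Υ_c v^c δ_a^b`. -/
def ProjRelated [IsManifold (𝓡 n) ∞ M] (cov cov' : AffineConn n M)
    (Υ : ∀ x : M, TangentSpace (𝓡 n) x →L[ℝ] ℝ) : Prop :=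
  ∀ (v : ∀ x : M, TangentSpace (𝓡 n) x) (x : M),
    MDifferentiableAt (𝓡 n) ((𝓡 n).prod 𝓘(ℝ, Model n))
      (fun z => (⟨z, v z⟩ : TangentBundle (𝓡 n) M)) x →
    ∀ u : TangentSpace (𝓡 n) x,
      cov' v x u = cov v x u + Υ x u • v x + Υ x (v x) • u

/-- The components `Υ_b` of a one-form in a chart. -/
def formComp (Υ : ∀ x : M, TangentSpace (𝓡 n) x →L[ℝ] ℝ)
    (φ : OpenPartialHomeomorph M (Model n)) (b : Fin n) (y : Model n) : ℝ :=
  Υ (φ.symm y) (coordField φ b (φ.symm y))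

/-- Smooth sections of `S^r T*M(w) = S^r T*M ⊗ 𝓔(w)`, with `𝓔(w) = ((Λⁿ TM)²)^{w/(2n+2)}`. An
element of the power `((Λⁿ T_xM)²)^{w/(2n+2)}` of the oriented line `(Λⁿ T_xM)²` is a function `f`
of the non-zero volume forms `ω ∈ Λⁿ T*_xM` such that `f (s ω) = |s| ^ (w / (n + 1)) f ω`. -/
structure SymTensorDensity (n : ℕ) (M : Type*) [TopologicalSpace M] [ChartedSpace (Model n) M]
    (r : ℕ) (w : ℝ) where
  toFun : ∀ x : M, (TangentSpace (𝓡 n) x) [⋀^Fin n]→ₗ[ℝ] ℝ →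
    MultilinearMap ℝ (fun _ : Fin r => TangentSpace (𝓡 n) x) ℝ
  homogeneous : ∀ (x : M) (vol : (TangentSpace (𝓡 n) x) [⋀^Fin n]→ₗ[ℝ] ℝ) (s : ℝ),
    vol ≠ 0 → s ≠ 0 → toFun x (s • vol) = (|s| ^ (w / ((n : ℝ) + 1))) • toFun x vol
  symmetric : ∀ (x : M) (vol : (TangentSpace (𝓡 n) x) [⋀^Fin n]→ₗ[ℝ] ℝ)
    (v : Fin r → TangentSpace (𝓡 n) x) (σ : Equiv.Perm (Fin r)),
    vol ≠ 0 → toFun x vol (v ∘ σ) = toFun x vol v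
  smooth : ∀ φ ∈ IsManifold.maximalAtlas (𝓡 n) ∞ M, ∀ i : Fin r → Fin n,
    ContDiffOn ℝ ∞ (fun y => toFun (φ.symm y) (coordVol φ (φ.symm y))
      (fun s => coordField φ (i s) (φ.symm y))) φ.target

/-- The components of a tensor density in a chart. -/
def SymTensorDensity.comp {r : ℕ} {w : ℝ} (k : SymTensorDensity n M r w)
    (φ : OpenPartialHomeomorph M (Model n)) : Model n → (Fin r → Fin n) → ℝ := fun y i =>
  k.toFun (φ.symm y) (coordVol φ (φ.symm y)) (fun s => coordField φ (i s) (φ.symm y))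

/-- The Killing equation `∇_{(a_0} k_{a_1 ⋯ a_r)} = 0`, in every chart. -/
def IsKilling [IsManifold (𝓡 n) ∞ M] (cov : AffineConn n M) {r : ℕ} {w : ℝ}
    (k : SymTensorDensity n M r w) : Prop :=
  ∀ φ ∈ IsManifold.maximalAtlas (𝓡 n) ∞ M, ∀ y ∈ φ.target, ∀ i : Fin (r + 1) → Fin n,
    symAll (nablaTensor (christoffel cov φ) w (k.comp φ) y) i = 0

/-- Smoothness, on an open set of a chart, of the components of a tractor field. -/
def SmoothOn {p q : ℕ} (T : TField n p q) (s : Set (Model n)) : Prop :=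
  ∀ U L, ContDiffOn ℝ ∞ (fun y => T y U L) s

end Manifold

end ProjTractor

end

open ProjTractor

/-!
In the Thomas operator formalism the weight is absorbed: `𝔻` satisfies the Leibniz rule for
contracted products (`thomasD_contr`), and on covariant tractor fields its commutator is the action
of the `W`-curvature alone (`IsTorsionFreeOn.thomasD_comm`). Hence, up to terms
`(𝔻^a W) (𝔻^b K)` with `a + b = r - 2`, the operators in `𝔻^r K` commute (`exists_terms_swap`), and
`𝔻^r K` is symmetric in its first `r` indices; it is symmetric in the last `r` because `K` is.

A Killing tensor `k` satisfies `𝔻_{(B} K_{C_1 ⋯ C_r)} = 0` (`thomasD_tractorOf_killing`), and so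
`𝔻^r K` is annihilated by symmetrisation over the last `r` indices together with one of the first.
A tensor with these symmetries lies in the Young component `(r, r)`, on which the Young map
`P_{(r,r)}` is multiplication by `(r + 1) / 2 ^ r` (`youngAct_eq_smul`). To obtain a formula that
does not depend on the manifold or on `k`, this fact from representation theory is applied to the
rational vector space of all families of tensors, modulo the subspace of the families given by
curvature formulas (`exists_formula_young`).

For the converse, contract `r - 1` of the indices with the canonical tractor `X`. Since `K` and `W`
are annihilated by `X`, every such contraction uses up one Thomas operator (`thomasDPow_eq_zero`);
the curvature terms have only `r - 2` of them and vanish, while `𝔻^r K` becomes a non-zero multiple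
of `𝔻 K`, whose components without `X` are `∇ k`. Symmetrisation over the last `r + 1` indices
annihilates the image of `P_{(r,r)}` and leaves the Killing equation (`killing_iff_splitting`).

Projective invariance holds for each term. The change of the tractor connection under a change of
scale is a gauge transformation up to `w Υ_a`, which the component `w Y_A` of `𝔻_A` compensates
(`IsProjectiveChangeOn.thomasD_changeAll`). The invariance of `W` follows from that of `𝔻`, because
`W` is the commutator of Thomas operators (`IsProjectiveChangeOn.wCurvature_eq`), and contractions
are invariant (`contr_changeAll`).

All this takes place in a chart, where the coefficients of a smooth torsion-free connection are
smooth and symmetric (`isTorsionFreeOn_christoffel`).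
-/

noncomputable section

namespace ProjTractor

/-! ### Partial derivatives of smooth component functions -/

section PartialDerivatives

variable {n : ℕ} {Ω : Set (Model n)} {f g : Model n → ℝ} {y : Model n} (a b : Fin n)

theorem differentiableAt_of_contDiffOn (hΩ : IsOpen Ω) (hf : ContDiffOn ℝ ∞ f Ω) (hy : y ∈ Ω) :
    DifferentiableAt ℝ f y :=
  (hf.differentiableOn (by simp)).differentiableAt (hΩ.mem_nhds hy)

theorem contDiffOn_pd (hΩ : IsOpen Ω) (hf : ContDiffOn ℝ ∞ f Ω) : ContDiffOn ℝ ∞ (pd a f) Ω :=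
  (hf.fderiv_of_isOpen hΩ (m := ∞) (by simp)).clm_apply contDiffOn_const

theorem pd_congr (hΩ : IsOpen Ω) (hy : y ∈ Ω) (h : ∀ z ∈ Ω, f z = g z) : pd a f y = pd a g y := by
  unfold pd
  rw [Filter.EventuallyEq.fderiv_eq (Filter.eventuallyEq_of_mem (hΩ.mem_nhds hy) h)]

theorem pd_const (c : ℝ) : pd a (fun _ => c) y = 0 := by simp [pd]

theorem pd_eq_zero (hΩ : IsOpen Ω) (hy : y ∈ Ω) (h : ∀ z ∈ Ω, f z = 0) : pd a f y = 0 := by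
  rw [pd_congr a hΩ hy h, pd_const]

theorem pd_add (hf : DifferentiableAt ℝ f y) (hg : DifferentiableAt ℝ g y) :
    pd a (fun z => f z + g z) y = pd a f y + pd a g y := by
  simp [pd, fderiv_fun_add hf hg]

theorem pd_sub (hf : DifferentiableAt ℝ f y) (hg : DifferentiableAt ℝ g y) :
    pd a (fun z => f z - g z) y = pd a f y - pd a g y := by
  simp [pd, fderiv_fun_sub hf hg]

theorem pd_neg : pd a (fun z => -f z) y = -pd a f y := by
  simp [pd, fderiv_fun_neg]

theorem pd_mul (hf : DifferentiableAt ℝ f y) (hg : DifferentiableAt ℝ g y) :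
    pd a (fun z => f z * g z) y = pd a f y * g y + f y * pd a g y := by
  simp [pd, fderiv_fun_mul hf hg]; ring

theorem pd_const_mul (c : ℝ) (hf : DifferentiableAt ℝ f y) :
    pd a (fun z => c * f z) y = c * pd a f y := by
  rw [pd_mul a (differentiableAt_const c) hf, pd_const]; ring

theorem pd_sum {ι : Type*} (s : Finset ι) {F : ι → Model n → ℝ}
    (hF : ∀ i ∈ s, DifferentiableAt ℝ (F i) y) :
    pd a (fun z => ∑ i ∈ s, F i z) y = ∑ i ∈ s, pd a (F i) y := by
  simp [pd, fderiv_fun_sum hF]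

theorem pd_comm (hΩ : IsOpen Ω) (hf : ContDiffOn ℝ ∞ f Ω) (hy : y ∈ Ω) :
    pd a (pd b f) y = pd b (pd a f) y := by
  have hd : DifferentiableAt ℝ (fderiv ℝ f) y :=
    ((hf.fderiv_of_isOpen hΩ (m := ∞) (by simp)).differentiableOn (by simp)).differentiableAt
      (hΩ.mem_nhds hy)
  have key : ∀ c d : Fin n, pd c (pd d f) y
      = fderiv ℝ (fderiv ℝ f) y (EuclideanSpace.single c 1) (EuclideanSpace.single d 1) := by
    intro c d
    unfold pd
    rw [fderiv_clm_apply hd (differentiableAt_const _)]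
    simp
  have hsymm : IsSymmSndFDerivAt ℝ f y :=
    (hf.contDiffAt (hΩ.mem_nhds hy)).isSymmSndFDerivAt
      (by rw [minSmoothness_of_isRCLikeNormedField]; exact WithTop.coe_le_coe.2 le_top)
  rw [key, key, hsymm]

end PartialDerivatives

/-! ### Smoothness of the geometric quantities -/

/-- Coefficients of a torsion-free connection, smooth on the open set `Ω`. -/
structure IsTorsionFreeOn {n : ℕ} (Γ : Coeffs n) (Ω : Set (Model n)) : Prop where
  isOpen : IsOpen Ω
  smooth : ∀ c a b, ContDiffOn ℝ ∞ (Γ c a b) Ω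
  symm : ∀ c a b, ∀ y ∈ Ω, Γ c a b y = Γ c b a y

section Smooth

variable {n : ℕ} {Γ : Coeffs n} {Ω : Set (Model n)}

theorem IsTorsionFreeOn.smooth_traceForm (h : IsTorsionFreeOn Γ Ω) (a : Fin n) :
    ContDiffOn ℝ ∞ (traceForm Γ a) Ω :=
  ContDiffOn.sum fun c _ => h.smooth c a c

theorem IsTorsionFreeOn.smooth_curvature (h : IsTorsionFreeOn Γ Ω) (a b c d : Fin n) :
    ContDiffOn ℝ ∞ (curvature Γ a b c d) Ω :=
  ((contDiffOn_pd a h.isOpen (h.smooth c b d)).sub (contDiffOn_pd b h.isOpen (h.smooth c a d))).add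
    (ContDiffOn.sum fun e _ => ((h.smooth c a e).mul (h.smooth e b d)).sub
      ((h.smooth c b e).mul (h.smooth e a d)))

theorem IsTorsionFreeOn.smooth_ricci (h : IsTorsionFreeOn Γ Ω) (b d : Fin n) :
    ContDiffOn ℝ ∞ (ricci Γ b d) Ω :=
  ContDiffOn.sum fun c _ => h.smooth_curvature c b c d

theorem IsTorsionFreeOn.smooth_schouten (h : IsTorsionFreeOn Γ Ω) (a b : Fin n) :
    ContDiffOn ℝ ∞ (schouten Γ a b) Ω :=
  ((contDiffOn_const.mul (h.smooth_ricci a b)).add (h.smooth_ricci b a)).div_const _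

theorem IsTorsionFreeOn.smooth_tractorForm (h : IsTorsionFreeOn Γ Ω) (a : Fin n) (C D : TIdx n) :
    ContDiffOn ℝ ∞ (tractorForm Γ a C D) Ω := by
  rcases C with _ | c <;> rcases D with _ | d
  · exact contDiffOn_const
  · exact (h.smooth_schouten a d).neg
  · exact contDiffOn_const
  · exact h.smooth c a d

theorem IsTorsionFreeOn.smooth_tractorFormT (h : IsTorsionFreeOn Γ Ω) (a : Fin n) (C D : TIdx n) :
    ContDiffOn ℝ ∞ (tractorFormT Γ a C D) Ω := by
  refine (h.smooth_tractorForm a C D).sub ?_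
  split_ifs
  · exact (h.smooth_traceForm a).div_const _
  · exact contDiffOn_const

theorem IsTorsionFreeOn.smooth_tractorCurvature (h : IsTorsionFreeOn Γ Ω) (a b : Fin n)
    (C D : TIdx n) : ContDiffOn ℝ ∞ (tractorCurvature Γ a b C D) Ω :=
  ((contDiffOn_pd a h.isOpen (h.smooth_tractorFormT b C D)).sub
    (contDiffOn_pd b h.isOpen (h.smooth_tractorFormT a C D))).add
    (ContDiffOn.sum fun E _ => ((h.smooth_tractorFormT a C E).mul (h.smooth_tractorFormT b E D)).sub
      ((h.smooth_tractorFormT b C E).mul (h.smooth_tractorFormT a E D)))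

theorem IsTorsionFreeOn.smooth_wCurvature (h : IsTorsionFreeOn Γ Ω) : SmoothOn (wCurvature Γ) Ω := by
  intro U L
  unfold wCurvature
  rcases L 0 with _ | a
  · exact contDiffOn_const
  · rcases L 1 with _ | b
    · exact contDiffOn_const
    · exact h.smooth_tractorCurvature a b _ _

variable {p q : ℕ} {T S : TField n p q}

theorem IsTorsionFreeOn.smooth_tractorNabla (h : IsTorsionFreeOn Γ Ω) (w : ℝ) (a : Fin n)
    (hT : SmoothOn T Ω) : SmoothOn (tractorNabla Γ w a T) Ω := by
  intro U L
  refine ContDiffOn.sub (ContDiffOn.add (ContDiffOn.add ?_ ?_) ?_) ?_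
  · exact contDiffOn_pd a h.isOpen (hT U L)
  · exact (contDiffOn_const.mul (h.smooth_traceForm a)).mul (hT U L)
  · exact ContDiffOn.sum fun s _ => ContDiffOn.sum fun C _ =>
      (h.smooth_tractorForm a _ _).mul (hT _ _)
  · exact ContDiffOn.sum fun s _ => ContDiffOn.sum fun C _ =>
      (h.smooth_tractorForm a _ _).mul (hT _ _)

theorem thomasD_none (w : ℝ) (y : Model n) (U : Fin p → TIdx n) {L : Fin (q + 1) → TIdx n}
    (hL : L 0 = none) : thomasD Γ w T y U L = w * T y U (Fin.tail L) := by
  simp [thomasD, hL]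

theorem thomasD_some (w : ℝ) (y : Model n) (U : Fin p → TIdx n) {L : Fin (q + 1) → TIdx n}
    {a : Fin n} (hL : L 0 = some a) :
    thomasD Γ w T y U L = tractorNabla Γ w a T y U (Fin.tail L) := by
  simp [thomasD, hL]

theorem IsTorsionFreeOn.smooth_thomasD (h : IsTorsionFreeOn Γ Ω) (w : ℝ)
    (hT : SmoothOn T Ω) : SmoothOn (thomasD Γ w T) Ω := by
  intro U L
  rcases hL : L 0 with _ | a
  · simp only [thomasD_none w _ U hL]
    exact contDiffOn_const.mul (hT _ _)
  · simp only [thomasD_some w _ U hL]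
    exact h.smooth_tractorNabla w a hT _ _

theorem IsTorsionFreeOn.smooth_thomasDPow (h : IsTorsionFreeOn Γ Ω) (w : ℝ)
    (hT : SmoothOn T Ω) (m : ℕ) : SmoothOn (thomasDPow Γ w T m) Ω := by
  induction m with
  | zero => exact hT
  | succ m ih => exact h.smooth_thomasD _ ih

end Smooth

/-! ### Formal properties of the Thomas operator -/

section ThomasD

variable {n p q : ℕ} {Γ : Coeffs n} {Ω : Set (Model n)} {T S : TField n p q} {y : Model n}

theorem tractorNabla_congr (hΩ : IsOpen Ω) (w : ℝ) (a : Fin n) (hy : y ∈ Ω)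
    (h : ∀ z ∈ Ω, T z = S z) : tractorNabla Γ w a T y = tractorNabla Γ w a S y := by
  funext U L
  simp only [tractorNabla, h y hy]
  rw [pd_congr a hΩ hy fun z hz => by rw [h z hz]]

/-- The Thomas operator is local. -/
theorem thomasD_congr (hΩ : IsOpen Ω) (w : ℝ) (hy : y ∈ Ω) (h : ∀ z ∈ Ω, T z = S z) :
    thomasD Γ w T y = thomasD Γ w S y := by
  funext U L
  rcases hL : L 0 with _ | a
  · rw [thomasD_none w _ U hL, thomasD_none w _ U hL, h y hy]
  · rw [thomasD_some w _ U hL, thomasD_some w _ U hL, tractorNabla_congr hΩ w a hy h]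

/-- The permutation of `Fin (q + 1)` fixing `0` and acting as `σ` on the successors. -/
def liftPerm {q : ℕ} (σ : Equiv.Perm (Fin q)) : Equiv.Perm (Fin (q + 1)) :=
  Equiv.Perm.decomposeFin.symm (0, σ)

@[simp] theorem liftPerm_zero {q : ℕ} (σ : Equiv.Perm (Fin q)) : liftPerm σ 0 = 0 := by
  simp [liftPerm]

@[simp] theorem liftPerm_succ {q : ℕ} (σ : Equiv.Perm (Fin q)) (i : Fin q) :
    liftPerm σ i.succ = (σ i).succ := by
  simp [liftPerm]

theorem liftPerm_swap {q : ℕ} (i j : Fin q) :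
    liftPerm (Equiv.swap i j) = Equiv.swap i.succ j.succ := by
  ext k : 1
  refine Fin.cases ?_ (fun k => ?_) k
  · rw [liftPerm_zero, Equiv.swap_apply_of_ne_of_ne (Fin.succ_ne_zero _).symm
      (Fin.succ_ne_zero _).symm]
  · rw [liftPerm_succ]
    simp only [Equiv.swap_apply_def, Fin.succ_inj]
    split_ifs <;> rfl

theorem tail_comp_liftPerm {q : ℕ} {α : Type*} (L : Fin (q + 1) → α) (σ : Equiv.Perm (Fin q)) :
    Fin.tail (L ∘ liftPerm σ) = Fin.tail L ∘ σ := by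
  funext i; simp [Fin.tail]

theorem update_comp_perm {q : ℕ} {α : Type*} (L : Fin q → α) (σ : Equiv.Perm (Fin q)) (s : Fin q)
    (C : α) : Function.update (L ∘ σ) s C = Function.update L (σ s) C ∘ σ := by
  funext i
  by_cases h : i = s <;> simp [h]

/-- A covariant derivative of a linear combination of index permutations of a field. -/
theorem tractorNabla_sum_perm (hΩ : IsOpen Ω) (w : ℝ) (a : Fin n) {ι : Type*} (s : Finset ι)
    (c : ι → ℝ) (F : ι → TField n p q) (σ : ι → Equiv.Perm (Fin q)) (hF : ∀ i ∈ s, SmoothOn (F i) Ω)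
    (hy : y ∈ Ω) (U : Fin p → TIdx n) (L : Fin q → TIdx n) :
    tractorNabla Γ w a (fun z U L => ∑ i ∈ s, c i * F i z U (L ∘ σ i)) y U L
      = ∑ i ∈ s, c i * tractorNabla Γ w a (F i) y U (L ∘ σ i) := by
  have hd : ∀ i ∈ s, ∀ U L, DifferentiableAt ℝ (fun z => F i z U L) y := fun i hi U L =>
    differentiableAt_of_contDiffOn hΩ (hF i hi U L) hy
  simp only [tractorNabla]
  rw [pd_sum a s fun i hi => (hd i hi _ _).const_mul _]
  rw [Finset.sum_congr rfl fun i hi => pd_const_mul a (c i) (hd i hi U (L ∘ σ i))]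
  simp only [Finset.mul_sum, mul_add, mul_sub, Finset.sum_add_distrib, Finset.sum_sub_distrib]
  congr 1
  · congr 1
    · congr 1
      exact Finset.sum_congr rfl fun i _ => by ring
    · symm
      rw [Finset.sum_comm]
      refine Finset.sum_congr rfl fun t _ => ?_
      rw [Finset.sum_comm]
      exact Finset.sum_congr rfl fun i _ => Finset.sum_congr rfl fun C _ => by ring
  · have : ∀ i ∈ s, (∑ t, ∑ C, c i * (tractorForm Γ a C ((L ∘ σ i) t) y
        * F i y U (Function.update (L ∘ σ i) t C)))
        = ∑ t, ∑ C, c i * (tractorForm Γ a C (L t) y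
          * F i y U (Function.update L t C ∘ σ i)) := by
      intro i _
      simp only [update_comp_perm, Function.comp_apply]
      exact Equiv.sum_comp (σ i) fun t => ∑ C, c i * (tractorForm Γ a C (L t) y
        * F i y U (Function.update L t C ∘ σ i))
    rw [Finset.sum_congr rfl this]
    symm
    rw [Finset.sum_comm]
    refine Finset.sum_congr rfl fun t _ => ?_
    rw [Finset.sum_comm]
    exact Finset.sum_congr rfl fun i _ => Finset.sum_congr rfl fun C _ => by ring

/-- The Thomas operator is linear and commutes with permutations of the lower indices. -/
theorem thomasD_sum_perm (hΩ : IsOpen Ω) (w : ℝ) {ι : Type*} (s : Finset ι)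
    (c : ι → ℝ) (F : ι → TField n p q) (σ : ι → Equiv.Perm (Fin q)) (hF : ∀ i ∈ s, SmoothOn (F i) Ω)
    (hy : y ∈ Ω) (U : Fin p → TIdx n) (L : Fin (q + 1) → TIdx n) :
    thomasD Γ w (fun z U L => ∑ i ∈ s, c i * F i z U (L ∘ σ i)) y U L
      = ∑ i ∈ s, c i * thomasD Γ w (F i) y U (L ∘ liftPerm (σ i)) := by
  have h0 : ∀ i, (L ∘ liftPerm (σ i)) 0 = L 0 := fun i => by simp
  rcases hL : L 0 with _ | a
  · rw [thomasD_none w _ U hL, Finset.mul_sum]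
    refine Finset.sum_congr rfl fun i _ => ?_
    rw [thomasD_none w _ U ((h0 i).trans hL), tail_comp_liftPerm]; ring
  · rw [thomasD_some w _ U hL, tractorNabla_sum_perm hΩ w a s c F σ hF hy]
    refine Finset.sum_congr rfl fun i _ => ?_
    rw [thomasD_some w _ U ((h0 i).trans hL), tail_comp_liftPerm]

theorem thomasD_sum (hΩ : IsOpen Ω) (w : ℝ) {ι : Type*} (s : Finset ι)
    (c : ι → ℝ) (F : ι → TField n p q) (hF : ∀ i ∈ s, SmoothOn (F i) Ω)
    (hy : y ∈ Ω) (U : Fin p → TIdx n) (L : Fin (q + 1) → TIdx n) :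
    thomasD Γ w (fun z U L => ∑ i ∈ s, c i * F i z U L) y U L
      = ∑ i ∈ s, c i * thomasD Γ w (F i) y U L := by
  have h := thomasD_sum_perm (Γ := Γ) hΩ w s c F (fun _ => 1) hF hy U L
  have h1 : (L ∘ liftPerm (1 : Equiv.Perm (Fin q))) = L := by
    funext i; refine Fin.cases ?_ (fun k => ?_) i <;> simp
  simpa [h1] using h

end ThomasD

/-! ### Curvature identities -/

section Curvature

variable {n : ℕ} {Γ : Coeffs n} {Ω : Set (Model n)} {y : Model n}

theorem IsTorsionFreeOn.pd_symm (h : IsTorsionFreeOn Γ Ω) (hy : y ∈ Ω) (e c a b : Fin n) :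
    pd e (Γ c a b) y = pd e (Γ c b a) y :=
  pd_congr e h.isOpen hy fun z hz => h.symm c a b z hz

theorem curvature_antisymm (Γ : Coeffs n) (a b c d : Fin n) (y : Model n) :
    curvature Γ a b c d y = -curvature Γ b a c d y := by
  simp only [curvature, Finset.sum_sub_distrib]; ring

/-- The first Bianchi identity. -/
theorem IsTorsionFreeOn.bianchi (h : IsTorsionFreeOn Γ Ω) (hy : y ∈ Ω) (a b c d : Fin n) :
    curvature Γ a b c d y + curvature Γ b d c a y + curvature Γ d a c b y = 0 := by
  simp only [curvature, Finset.sum_sub_distrib]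
  rw [h.pd_symm hy a c b d, h.pd_symm hy b c d a, h.pd_symm hy d c a b]
  have e : ∀ u v w : Fin n, ∑ e, Γ c u e y * Γ e v w y = ∑ e, Γ c u e y * Γ e w v y := fun u v w =>
    Finset.sum_congr rfl fun e _ => by rw [h.symm e v w y hy]
  rw [e a b d, e b d a, e d a b]
  ring

theorem IsTorsionFreeOn.sum_curvature (h : IsTorsionFreeOn Γ Ω) (hy : y ∈ Ω) (a b : Fin n) :
    ∑ c, curvature Γ a b c c y = pd a (traceForm Γ b) y - pd b (traceForm Γ a) y := by
  have hd : ∀ c a b, DifferentiableAt ℝ (Γ c a b) y := fun c a b =>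
    differentiableAt_of_contDiffOn h.isOpen (h.smooth c a b) hy
  have ht : ∀ a b, pd a (traceForm Γ b) y = ∑ c, pd a (Γ c b c) y := fun a b => by
    rw [← pd_sum a Finset.univ fun c _ => hd c b c]; rfl
  simp only [curvature, Finset.sum_add_distrib, Finset.sum_sub_distrib, ht]
  rw [Finset.sum_comm (f := fun c e => Γ c b e y * Γ e a c y)]
  simp only [mul_comm, sub_self, add_zero]

/-- The curvature of the connection on densities is the skew part of the Schouten tensor. -/
theorem IsTorsionFreeOn.schouten_skew (h : IsTorsionFreeOn Γ Ω) (hn : 2 ≤ n) (hy : y ∈ Ω)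
    (a b : Fin n) :
    (pd a (traceForm Γ b) y - pd b (traceForm Γ a) y) / ((n : ℝ) + 1)
      + schouten Γ a b y - schouten Γ b a y = 0 := by
  have hb : ricci Γ b a y - ricci Γ a b y
      = pd a (traceForm Γ b) y - pd b (traceForm Γ a) y := by
    rw [← h.sum_curvature hy, ricci, ricci, ← Finset.sum_sub_distrib]
    refine Finset.sum_congr rfl fun c _ => ?_
    have := h.bianchi hy a b c c
    rw [curvature_antisymm Γ b c] at this
    linarith
  rw [← hb]
  have h2 : (2 : ℝ) ≤ n := by exact_mod_cast hn
  have h3 : ((n : ℝ) ^ 2 - 1) ≠ 0 := by nlinarith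
  have h4 : ((n : ℝ) + 1) ≠ 0 := by positivity
  have h5 : ((n : ℝ) - 1) ≠ 0 := by nlinarith
  unfold schouten
  have h6 : ((n : ℝ) ^ 2 - 1) = (n - 1) * (n + 1) := by ring
  rw [h6]
  field_simp
  ring

/-- The curvature of the connection form `tractorForm`, which does not include the contribution
of the density weights. -/
def formCurvature (Γ : Coeffs n) (a b : Fin n) (C D : TIdx n) (y : Model n) : ℝ :=
  pd a (tractorForm Γ b C D) y - pd b (tractorForm Γ a C D) y
    + ∑ E, (tractorForm Γ a C E y * tractorForm Γ b E D y
        - tractorForm Γ b C E y * tractorForm Γ a E D y)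

theorem IsTorsionFreeOn.tractorCurvature_eq (h : IsTorsionFreeOn Γ Ω) (hy : y ∈ Ω) (a b : Fin n)
    (C D : TIdx n) : tractorCurvature Γ a b C D y = formCurvature Γ a b C D y
      - if C = D then (pd a (traceForm Γ b) y - pd b (traceForm Γ a) y) / ((n : ℝ) + 1) else 0 := by
  have hA : ∀ a C D, DifferentiableAt ℝ (tractorForm Γ a C D) y := fun a C D =>
    differentiableAt_of_contDiffOn h.isOpen (h.smooth_tractorForm a C D) hy
  have ht : ∀ a, DifferentiableAt ℝ (traceForm Γ a) y := fun a =>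
    differentiableAt_of_contDiffOn h.isOpen (h.smooth_traceForm a) hy
  have hp : ∀ a b, pd a (tractorFormT Γ b C D) y = pd a (tractorForm Γ b C D) y
      - if C = D then pd a (traceForm Γ b) y / ((n : ℝ) + 1) else 0 := by
    intro a b
    by_cases hCD : C = D
    · have : tractorFormT Γ b C D
          = fun z => tractorForm Γ b C D z - ((n : ℝ) + 1)⁻¹ * traceForm Γ b z := by
        funext z; simp [tractorFormT, hCD]; ring
      rw [this, pd_sub a (hA b C D) ((ht b).const_mul _), pd_const_mul a _ (ht b)]
      simp [hCD]; ring
    · have : tractorFormT Γ b C D = tractorForm Γ b C D := by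
        funext z; simp [tractorFormT, hCD]
      simp [this, hCD]
  have hq : ∀ a b, ∑ E, tractorFormT Γ a C E y * tractorFormT Γ b E D y
      = ∑ E, tractorForm Γ a C E y * tractorForm Γ b E D y
        - tractorForm Γ a C D y * (traceForm Γ b y / ((n : ℝ) + 1))
        - tractorForm Γ b C D y * (traceForm Γ a y / ((n : ℝ) + 1))
        + if C = D then (traceForm Γ a y / ((n : ℝ) + 1)) * (traceForm Γ b y / ((n : ℝ) + 1))
          else 0 := by
    intro a b
    simp only [tractorFormT, sub_mul, mul_sub, Finset.sum_sub_distrib, mul_ite, ite_mul, mul_zero,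
      zero_mul, Finset.sum_ite_eq, Finset.sum_ite_eq', Finset.mem_univ, if_true]
    split_ifs <;> ring
  simp only [tractorCurvature, formCurvature, Finset.sum_sub_distrib, hp, hq]
  split_ifs <;> ring

/-- `κ_{ab}{}^C{}_D X^D = 0`: this is torsion-freeness in the upper components and
`schouten_skew` in the lower one. -/
theorem IsTorsionFreeOn.tractorCurvature_none (h : IsTorsionFreeOn Γ Ω) (hn : 2 ≤ n) (hy : y ∈ Ω)
    (a b : Fin n) (C : TIdx n) : tractorCurvature Γ a b C none y = 0 := by
  rw [h.tractorCurvature_eq hy]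
  have hs := h.schouten_skew hn hy a b
  rcases C with _ | c
  · simp [formCurvature, tractorForm, Fintype.sum_option, pd_const]
    linarith
  · simp [formCurvature, tractorForm, Fintype.sum_option, pd_const]
    rw [h.symm c a b y hy]; ring

/-- The `W`-curvature is annihilated by `X` in each lower index. -/
theorem IsTorsionFreeOn.wCurvature_none (h : IsTorsionFreeOn Γ Ω) (hn : 2 ≤ n) (hy : y ∈ Ω)
    (U : Fin 1 → TIdx n) (L : Fin 3 → TIdx n) (hL : ∃ s, L s = none) :
    wCurvature Γ y U L = 0 := by
  obtain ⟨s, hs⟩ := hL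
  unfold wCurvature
  rcases h0 : L 0 with _ | a
  · rfl
  rcases h1 : L 1 with _ | b
  · rfl
  have h2 : L 2 = none := by
    fin_cases s
    · simp [h0] at hs
    · simp [h1] at hs
    · exact hs
  simp only [h2]
  exact h.tractorCurvature_none hn hy a b _

end Curvature

/-! ### The commutator of Thomas operators -/

section SlotAction

variable {ι : Type*} [Fintype ι] {q : ℕ}

/-- The derivation action of a matrix on covariant tensors: `f` is applied in one index at a time
and the results are summed. -/
def slotAct (f : ι → ι → ℝ) (S : (Fin q → ι) → ℝ) (L : Fin q → ι) : ℝ :=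
  ∑ s, ∑ C, f C (L s) * S (Function.update L s C)

/-- Only the terms in which both matrices act in the same index fail to commute. -/
theorem slotAct_comm (f g : ι → ι → ℝ) (S : (Fin q → ι) → ℝ) (L : Fin q → ι) :
    slotAct f (slotAct g S) L - slotAct g (slotAct f S) L
      = slotAct (fun E D => ∑ C, (g E C * f C D - f E C * g C D)) S L := by
  classical
  let H : (ι → ι → ℝ) → (ι → ι → ℝ) → Fin q → Fin q → ℝ := fun f g s t =>
    ∑ C, ∑ E, f C (L s) * g E (Function.update L s C t)
      * S (Function.update (Function.update L s C) t E)
  have hH : ∀ f g : ι → ι → ℝ, slotAct f (slotAct g S) L = ∑ s, ∑ t, H f g s t := by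
    intro f g
    simp only [slotAct, H, Finset.mul_sum]
    refine Finset.sum_congr rfl fun s _ => ?_
    rw [Finset.sum_comm]
    exact Finset.sum_congr rfl fun t _ => Finset.sum_congr rfl fun C _ =>
      Finset.sum_congr rfl fun E _ => by ring
  have hne : ∀ s t, s ≠ t → H f g s t = H g f t s := by
    intro s t hst
    simp only [H]
    rw [Finset.sum_comm]
    refine Finset.sum_congr rfl fun E _ => Finset.sum_congr rfl fun C _ => ?_
    rw [Function.update_of_ne hst.symm, Function.update_of_ne hst, Function.update_comm hst]
    ring
  have hd : ∀ f g : ι → ι → ℝ, ∀ s, H f g s s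
      = ∑ E, (∑ C, g E C * f C (L s)) * S (Function.update L s E) := by
    intro f g s
    simp only [H, Function.update_self, Function.update_idem, Finset.sum_mul]
    rw [Finset.sum_comm]
    exact Finset.sum_congr rfl fun t _ => Finset.sum_congr rfl fun C _ => by ring
  rw [hH, hH, Finset.sum_comm (f := H g f), ← Finset.sum_sub_distrib]
  simp only [slotAct]
  refine Finset.sum_congr rfl fun s _ => ?_
  rw [← Finset.sum_sub_distrib, Finset.sum_eq_single s
    (fun t _ hts => by rw [hne s t hts.symm, sub_self]) (by simp), hd, hd, ← Finset.sum_sub_distrib]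
  refine Finset.sum_congr rfl fun E _ => ?_
  rw [Finset.sum_sub_distrib]; ring

theorem slotAct_one [DecidableEq ι] (c : ℝ) (S : (Fin q → ι) → ℝ) (L : Fin q → ι) :
    slotAct (fun E D => if E = D then c else 0) S L = q * c * S L := by
  simp [slotAct, ite_mul, mul_assoc]

end SlotAction

section Commutator

variable {n q : ℕ} {Γ : Coeffs n} {Ω : Set (Model n)} {y : Model n} {S : TField n 0 q}

theorem tractorNabla_eq (w : ℝ) (a : Fin n) (S : TField n 0 q) (y : Model n) (U : Fin 0 → TIdx n)
    (L : Fin q → TIdx n) :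
    tractorNabla Γ w a S y U L = pd a (fun z => S z U L) y
      + ((w + q) / ((n : ℝ) + 1)) * traceForm Γ a y * S y U L
      - slotAct (fun C D => tractorForm Γ a C D y) (S y U) L := by
  simp [tractorNabla, slotAct]

/-- The curvature of the coupled connection, without the torsion term and the term from the
additional index created by the first derivative. -/
theorem IsTorsionFreeOn.tractorNabla_comm (h : IsTorsionFreeOn Γ Ω) (hy : y ∈ Ω)
    (hS : SmoothOn S Ω) (w : ℝ) (a b : Fin n) (U : Fin 0 → TIdx n) (L : Fin q → TIdx n) :
    tractorNabla Γ w a (tractorNabla Γ w b S) y U L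
        - tractorNabla Γ w b (tractorNabla Γ w a S) y U L
      = w / ((n : ℝ) + 1) * (pd a (traceForm Γ b) y - pd b (traceForm Γ a) y) * S y U L
        - slotAct (fun C D => tractorCurvature Γ a b C D y) (S y U) L := by
  have hA : ∀ a C D, DifferentiableAt ℝ (tractorForm Γ a C D) y := fun a C D =>
    differentiableAt_of_contDiffOn h.isOpen (h.smooth_tractorForm a C D) hy
  have ht : ∀ a, DifferentiableAt ℝ (traceForm Γ a) y := fun a =>
    differentiableAt_of_contDiffOn h.isOpen (h.smooth_traceForm a) hy
  have hSd : ∀ L, DifferentiableAt ℝ (fun z => S z U L) y := fun L =>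
    differentiableAt_of_contDiffOn h.isOpen (hS U L) hy
  have hSp : ∀ a L, DifferentiableAt ℝ (pd a fun z => S z U L) y := fun a L =>
    differentiableAt_of_contDiffOn h.isOpen (contDiffOn_pd a h.isOpen (hS U L)) hy
  set u : ℝ := (w + q) / ((n : ℝ) + 1) with hu
  -- the derivative of `∇_b S`
  have hexp : ∀ a b, pd a (fun z => tractorNabla Γ w b S z U L) y
      = pd a (pd b fun z => S z U L) y
        + u * (pd a (traceForm Γ b) y * S y U L + traceForm Γ b y * pd a (fun z => S z U L) y)
        - slotAct (fun C D => pd a (tractorForm Γ b C D) y) (S y U) L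
        - slotAct (fun C D => tractorForm Γ b C D y) (fun L => pd a (fun z => S z U L) y) L := by
    intro a b
    have e1 : (fun z => tractorNabla Γ w b S z U L) = fun z => (pd b (fun z => S z U L) z
        + u * (traceForm Γ b z * S z U L))
        - ∑ s, ∑ C, tractorForm Γ b C (L s) z * S z U (Function.update L s C) := by
      funext z; rw [tractorNabla_eq, ← mul_assoc]; rfl
    have d1 : ∀ s, DifferentiableAt ℝ (fun z => ∑ C, tractorForm Γ b C (L s) z
        * S z U (Function.update L s C)) y := fun s =>
      DifferentiableAt.fun_sum fun C _ => (hA b C (L s)).mul (hSd _)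
    rw [e1, pd_sub a, pd_add a (hSp b L), pd_const_mul a (f := fun z => traceForm Γ b z * S z U L) u
      ((ht b).mul (hSd L)), pd_mul a (ht b) (hSd L), pd_sum a Finset.univ fun s _ => d1 s]
    · rw [sub_sub]
      congr 1
      simp only [slotAct, ← Finset.sum_add_distrib]
      refine Finset.sum_congr rfl fun s _ => ?_
      rw [pd_sum a (F := fun C z => tractorForm Γ b C (L s) z * S z U (Function.update L s C))
        Finset.univ fun C _ => (hA b C (L s)).mul (hSd _)]
      exact Finset.sum_congr rfl fun C _ => pd_mul a (hA b C (L s)) (hSd _)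
    · exact ((ht b).mul (hSd L)).const_mul _
    · exact (hSp b L).add (((ht b).mul (hSd L)).const_mul _)
    · exact DifferentiableAt.fun_sum fun s _ => d1 s
  have hact : ∀ a b, slotAct (fun C D => tractorForm Γ a C D y) (tractorNabla Γ w b S y U) L
      = slotAct (fun C D => tractorForm Γ a C D y) (fun L => pd b (fun z => S z U L) y) L
        + u * traceForm Γ b y * slotAct (fun C D => tractorForm Γ a C D y) (S y U) L
        - slotAct (fun C D => tractorForm Γ a C D y)
            (slotAct (fun C D => tractorForm Γ b C D y) (S y U)) L := by
    intro a b
    simp only [slotAct, Finset.mul_sum, ← Finset.sum_add_distrib, ← Finset.sum_sub_distrib]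
    refine Finset.sum_congr rfl fun s _ => Finset.sum_congr rfl fun C _ => ?_
    rw [tractorNabla_eq, mul_sub, mul_add]
    simp only [slotAct, ← hu, Finset.mul_sum]
    ring
  have hk : slotAct (fun C D => tractorCurvature Γ a b C D y) (S y U) L
      = slotAct (fun C D => pd a (tractorForm Γ b C D) y) (S y U) L
        - slotAct (fun C D => pd b (tractorForm Γ a C D) y) (S y U) L
        - (slotAct (fun C D => tractorForm Γ a C D y)
            (slotAct (fun C D => tractorForm Γ b C D y) (S y U)) L
          - slotAct (fun C D => tractorForm Γ b C D y)
            (slotAct (fun C D => tractorForm Γ a C D y) (S y U)) L)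
        - q * ((pd a (traceForm Γ b) y - pd b (traceForm Γ a) y) / ((n : ℝ) + 1)) * S y U L := by
    rw [slotAct_comm, ← slotAct_one]
    simp only [slotAct, ← Finset.sum_sub_distrib]
    refine Finset.sum_congr rfl fun s _ => Finset.sum_congr rfl fun C _ => ?_
    rw [h.tractorCurvature_eq hy, formCurvature, Finset.sum_sub_distrib, Finset.sum_sub_distrib]
    ring
  have hcomm := pd_comm a b h.isOpen (hS U L) hy
  have hn : ((n : ℝ) + 1) ≠ 0 := by positivity
  have huw : u = w / ((n : ℝ) + 1) + q / ((n : ℝ) + 1) := by rw [hu]; ring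
  rw [tractorNabla_eq w a (tractorNabla Γ w b S), tractorNabla_eq w b (tractorNabla Γ w a S),
    hexp, hexp, hact, hact, tractorNabla_eq w a S, tractorNabla_eq w b S, hk, hcomm, ← hu, huw]
  ring

/-- The derivative of `𝔻 S` in terms of the coupled derivative of `∇ S`. -/
theorem thomasD_thomasD_some (w : ℝ) (S : TField n 0 q) (y : Model n) (U : Fin 0 → TIdx n)
    (L : Fin (q + 1 + 1) → TIdx n) {a b : Fin n} (h0 : L 0 = some a) (h1 : L 1 = some b) :
    thomasD Γ (w - 1) (thomasD Γ w S) y U L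
      = tractorNabla Γ w a (tractorNabla Γ w b S) y U (Fin.tail (Fin.tail L))
        - ∑ c, Γ c a b y * tractorNabla Γ w c S y U (Fin.tail (Fin.tail L))
        + schouten Γ a b y * (w * S y U (Fin.tail (Fin.tail L))) := by
  have h1' : Fin.tail L 0 = some b := h1
  rw [thomasD_some _ _ U h0, tractorNabla_eq, tractorNabla_eq]
  have e1 : (fun z => thomasD Γ w S z U (Fin.tail L))
      = fun z => tractorNabla Γ w b S z U (Fin.tail (Fin.tail L)) := by
    funext z; exact thomasD_some w z U h1'
  have e2 : slotAct (fun C D => tractorForm Γ a C D y) (thomasD Γ w S y U) (Fin.tail L)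
      = ∑ c, Γ c a b y * tractorNabla Γ w c S y U (Fin.tail (Fin.tail L))
        - schouten Γ a b y * (w * S y U (Fin.tail (Fin.tail L)))
        + slotAct (fun C D => tractorForm Γ a C D y) (tractorNabla Γ w b S y U)
            (Fin.tail (Fin.tail L)) := by
    simp only [slotAct, Fin.sum_univ_succ (n := q)]
    congr 1
    · rw [h1', Fintype.sum_option,
        thomasD_none w y U (L := Function.update (Fin.tail L) 0 none) (by simp),
        Fin.tail_update_zero, sub_eq_add_neg]
      refine (add_comm _ _).trans (congrArg₂ (· + ·) ?_ ?_)
      · refine Finset.sum_congr rfl fun c _ => ?_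
        rw [thomasD_some (a := c) w y U (L := Function.update (Fin.tail L) 0 (some c)) (by simp),
          Fin.tail_update_zero]
        rfl
      · simp [tractorForm]
    · refine Finset.sum_congr rfl fun s _ => Finset.sum_congr rfl fun C _ => ?_
      rw [thomasD_some (a := b) w y U (L := Function.update (Fin.tail L) s.succ C)
        (by rw [Function.update_of_ne (Fin.succ_ne_zero s).symm, h1']), Fin.tail_update_succ]
      rfl
  rw [e1, e2, thomasD_some w y U h1']
  push_cast
  ring

/-- The components `(a, none)` of `𝔻 𝔻 S`. The components `(none, a)` have the same value, so that the
mixed components of the commutator vanish. -/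
theorem thomasD_thomasD_mixed (w : ℝ) (S : TField n 0 q) (y : Model n) (U : Fin 0 → TIdx n)
    (L : Fin (q + 1 + 1) → TIdx n) {a : Fin n}
    (hd : DifferentiableAt ℝ (fun z => S z U (Fin.tail (Fin.tail L))) y)
    (h0 : L 0 = some a) (h1 : L 1 = none) :
    thomasD Γ (w - 1) (thomasD Γ w S) y U L
      = (w - 1) * tractorNabla Γ w a S y U (Fin.tail (Fin.tail L)) := by
  have h1' : Fin.tail L 0 = none := h1
  rw [thomasD_some _ _ U h0, tractorNabla_eq]
  have e1 : (fun z => thomasD Γ w S z U (Fin.tail L))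
      = fun z => w * S z U (Fin.tail (Fin.tail L)) := by
    funext z; exact thomasD_none w z U h1'
  have e2 : slotAct (fun C D => tractorForm Γ a C D y) (thomasD Γ w S y U) (Fin.tail L)
      = tractorNabla Γ w a S y U (Fin.tail (Fin.tail L))
        + w * slotAct (fun C D => tractorForm Γ a C D y) (S y U) (Fin.tail (Fin.tail L)) := by
    simp only [slotAct, Fin.sum_univ_succ (n := q), h1']
    congr 1
    · rw [Fintype.sum_eq_single (some a)]
      · rw [thomasD_some (a := a) w y U (by simp), Fin.tail_update_zero]
        simp [tractorForm]
      · rintro (_ | c) hc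
        · simp [tractorForm]
        · have : c ≠ a := fun h => hc (by rw [h])
          simp [tractorForm, this]
    · rw [Finset.mul_sum]
      refine Finset.sum_congr rfl fun s _ => ?_
      rw [Finset.mul_sum]
      refine Finset.sum_congr rfl fun C _ => ?_
      rw [thomasD_none w y U (L := Function.update (Fin.tail L) s.succ C)
        (by rw [Function.update_of_ne (Fin.succ_ne_zero s).symm, h1']), Fin.tail_update_succ]
      simp only [Fin.tail]
      ring
  rw [e1, e2, pd_const_mul a w hd, thomasD_none w y U h1', tractorNabla_eq]
  push_cast
  ring

/-- The commutator of two Thomas operators on covariant tractor fields is the action of the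
`W`-curvature; there is no contribution of the weight. -/
theorem IsTorsionFreeOn.thomasD_comm (h : IsTorsionFreeOn Γ Ω) (hn : 2 ≤ n) (hy : y ∈ Ω)
    (hS : SmoothOn S Ω) (w : ℝ) (U : Fin 0 → TIdx n) (L : Fin (q + 1 + 1) → TIdx n) :
    thomasD Γ (w - 1) (thomasD Γ w S) y U L
        - thomasD Γ (w - 1) (thomasD Γ w S) y U (L ∘ Equiv.swap 0 1)
      = -∑ s, ∑ C, wCurvature Γ y (fun _ => C) ![L 0, L 1, L s.succ.succ]
          * S y U (Function.update (Fin.tail (Fin.tail L)) s C) := by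
  have s0 : (L ∘ Equiv.swap 0 1) 0 = L 1 := by simp
  have s1 : (L ∘ Equiv.swap 0 1) 1 = L 0 := by simp
  have st : Fin.tail (Fin.tail (L ∘ Equiv.swap 0 1)) = Fin.tail (Fin.tail L) := by
    funext i
    simp only [Fin.tail, Function.comp_apply]
    rw [Equiv.swap_apply_of_ne_of_ne (Fin.succ_ne_zero _)]
    intro hi
    exact Fin.succ_ne_zero i (Fin.succ_injective _ (hi.trans Fin.succ_zero_eq_one.symm))
  have hd : DifferentiableAt ℝ (fun z => S z U (Fin.tail (Fin.tail L))) y :=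
    differentiableAt_of_contDiffOn h.isOpen (hS U _) hy
  have hzero : ∀ (T : TField n 0 (q + 1)) (L : Fin (q + 1 + 1) → TIdx n), L 0 = none →
      thomasD Γ (w - 1) T y U L = (w - 1) * T y U (Fin.tail L) := fun T L hL =>
    thomasD_none (w - 1) y U hL
  rcases h0 : L 0 with _ | a <;> rcases h1 : L 1 with _ | b
  · rw [hzero _ _ h0, hzero _ _ (s0.trans h1), thomasD_none w y U (L := Fin.tail L) h1,
      thomasD_none w y U (L := Fin.tail (L ∘ Equiv.swap 0 1)) (s1.trans h0), st]
    simp [wCurvature]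
  · rw [hzero _ _ h0, thomasD_some w y U (L := Fin.tail L) h1,
      thomasD_thomasD_mixed w S y U _ (by rw [st]; exact hd) (s0.trans h1) (s1.trans h0), st]
    simp [wCurvature]
  · rw [thomasD_thomasD_mixed w S y U _ hd h0 h1, hzero _ _ (s0.trans h1),
      thomasD_some w y U (L := Fin.tail (L ∘ Equiv.swap 0 1)) (s1.trans h0), st]
    simp [wCurvature]
  · rw [thomasD_thomasD_some w S y U _ h0 h1, thomasD_thomasD_some w S y U _ (s0.trans h1)
      (s1.trans h0), st]
    have hc := h.tractorNabla_comm hy hS w a b U (Fin.tail (Fin.tail L))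
    have hg : ∑ c, Γ c b a y * tractorNabla Γ w c S y U (Fin.tail (Fin.tail L))
        = ∑ c, Γ c a b y * tractorNabla Γ w c S y U (Fin.tail (Fin.tail L)) :=
      Finset.sum_congr rfl fun c _ => by rw [h.symm c a b y hy]
    have hs := h.schouten_skew hn hy a b
    have hw : ∑ s, ∑ C, wCurvature Γ y (fun _ => C) ![some a, some b, L (Fin.succ (Fin.succ s))]
          * S y U (Function.update (Fin.tail (Fin.tail L)) s C)
        = slotAct (fun C D => tractorCurvature Γ a b C D y) (S y U) (Fin.tail (Fin.tail L)) := rfl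
    rw [hw, hg]
    linear_combination hc + w * S y U (Fin.tail (Fin.tail L)) * hs

end Commutator

/-! ### The Young map on an abstract representation -/

section Young

open Equiv

variable {r : ℕ}

/-- The transposition of the `i`-th index of the first group with that of the second. -/
def pairSwap (i : Fin r) : Perm (Fin r ⊕ Fin r) := swap (Sum.inl i) (Sum.inr i)

/-- The product of the transpositions `pairSwap i`, for `i` in a list. -/
def pairProd (l : List (Fin r)) : Perm (Fin r ⊕ Fin r) := (l.map pairSwap).prod

theorem pairProd_inl {l : List (Fin r)} (hl : l.Nodup) (j : Fin r) :
    pairProd l (Sum.inl j) = if j ∈ l then Sum.inr j else Sum.inl j := by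
  induction l with
  | nil => simp [pairProd]
  | cons i l ih =>
    have hi := (List.nodup_cons.1 hl).1
    have h1 : pairProd (i :: l) (Sum.inl j) = pairSwap i (pairProd l (Sum.inl j)) := by
      simp [pairProd]
    rw [h1, ih (List.nodup_cons.1 hl).2]
    by_cases hj : j ∈ l
    · have hij : j ≠ i := fun h => hi (h ▸ hj)
      simp [hj, pairSwap, swap_apply_def, hij]
    · by_cases hij : j = i
      · simp [hij, hi, pairSwap]
      · simp [hj, hij, pairSwap, swap_apply_def]

theorem pairProd_inr {l : List (Fin r)} (hl : l.Nodup) (j : Fin r) :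
    pairProd l (Sum.inr j) = if j ∈ l then Sum.inl j else Sum.inr j := by
  induction l with
  | nil => simp [pairProd]
  | cons i l ih =>
    have hi := (List.nodup_cons.1 hl).1
    have h1 : pairProd (i :: l) (Sum.inr j) = pairSwap i (pairProd l (Sum.inr j)) := by
      simp [pairProd]
    rw [h1, ih (List.nodup_cons.1 hl).2]
    by_cases hj : j ∈ l
    · have hij : j ≠ i := fun h => hi (h ▸ hj)
      simp [hj, pairSwap, swap_apply_def, hij]
    · by_cases hij : j = i
      · simp [hij, hi, pairSwap]
      · simp [hj, hij, pairSwap, swap_apply_def]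

variable {V V' : Type*} [AddCommGroup V] [Module ℚ V] [AddCommGroup V'] [Module ℚ V']
  (ρ : Representation ℚ (Perm (Fin r ⊕ Fin r)) V) (ρ' : Representation ℚ (Perm (Fin r ⊕ Fin r)) V')

/-- Symmetrisation over the first group of indices. -/
def symInl : V →ₗ[ℚ] V := (r.factorial : ℚ)⁻¹ • ∑ σ : Perm (Fin r), ρ (Perm.sumCongr σ 1)

/-- Symmetrisation over the second group of indices. -/
def symInr : V →ₗ[ℚ] V := (r.factorial : ℚ)⁻¹ • ∑ σ : Perm (Fin r), ρ (Perm.sumCongr 1 σ)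

/-- Skew-symmetrisation in a pair of corresponding indices. -/
def skewAct (i : Fin r) (v : V) : V := (2⁻¹ : ℚ) • (v - ρ (pairSwap i) v)

/-- The Young map `P_{(r,r)}` on a representation of the symmetric group of `Fin r ⊕ Fin r`. -/
def youngAct (v : V) : V := symInl ρ (symInr ρ ((List.finRange r).foldr (skewAct ρ) v))

theorem symInl_apply (v : V) :
    symInl ρ v = (r.factorial : ℚ)⁻¹ • ∑ σ : Perm (Fin r), ρ (Perm.sumCongr σ 1) v := by
  simp [symInl]

theorem symInr_apply (v : V) :
    symInr ρ v = (r.factorial : ℚ)⁻¹ • ∑ σ : Perm (Fin r), ρ (Perm.sumCongr 1 σ) v := by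
  simp [symInr]

variable {ρ ρ'} in
theorem map_youngAct (f : V →ₗ[ℚ] V') (hf : ∀ g v, f (ρ g v) = ρ' g (f v)) (v : V) :
    f (youngAct ρ v) = youngAct ρ' (f v) := by
  have hs : ∀ l : List (Fin r), f (l.foldr (skewAct ρ) v) = l.foldr (skewAct ρ') (f v) := by
    intro l
    induction l with
    | nil => rfl
    | cons i l ih => simp only [List.foldr_cons, skewAct, map_smul, map_sub, hf, ih]
  simp only [youngAct, symInl_apply, symInr_apply, map_smul, map_sum, hf, hs]

theorem rho_mul (g h : Perm (Fin r ⊕ Fin r)) (v : V) : ρ (g * h) v = ρ g (ρ h v) := by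
  rw [map_mul]; rfl

theorem symInl_symInr_rho (α β : Perm (Fin r)) (v : V) :
    symInl ρ (symInr ρ (ρ (Perm.sumCongr α β) v)) = symInl ρ (symInr ρ v) := by
  have h1 : symInr ρ (ρ (Perm.sumCongr α β) v) = ρ (Perm.sumCongr α 1) (symInr ρ v) := by
    simp only [symInr_apply, map_smul, map_sum, ← rho_mul, Perm.sumCongr_mul, one_mul, mul_one]
    congr 1
    exact Fintype.sum_equiv (Equiv.mulRight β) _ _ fun σ => rfl
  rw [h1]
  simp only [symInl_apply ρ (ρ _ _), symInl_apply ρ (symInr ρ v), ← rho_mul, Perm.sumCongr_mul,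
    mul_one]
  congr 1
  exact Fintype.sum_equiv (Equiv.mulRight α) _ _ fun σ => rfl

theorem symInl_symInr_of_fixed {x : V} (hx : ∀ σ τ, ρ (Perm.sumCongr σ τ) x = x) :
    symInl ρ (symInr ρ x) = x := by
  have h0 : (r.factorial : ℚ) ≠ 0 := by exact_mod_cast r.factorial_ne_zero
  have h1 : symInr ρ x = x := by
    rw [symInr_apply]
    simp only [hx, Finset.sum_const, Finset.card_univ, Fintype.card_perm, Fintype.card_fin]
    rw [← Nat.cast_smul_eq_nsmul ℚ, smul_smul, inv_mul_cancel₀ h0, one_smul]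
  rw [h1, symInl_apply]
  simp only [hx, Finset.sum_const, Finset.card_univ, Fintype.card_perm, Fintype.card_fin]
  rw [← Nat.cast_smul_eq_nsmul ℚ, smul_smul, inv_mul_cancel₀ h0, one_smul]

/-- If `x` is symmetric in each group of indices and its symmetrisation over all of one group
together with any index of the other vanishes, then exchanging `k` pairs of indices and
symmetrising multiplies `x` by `(-1)^k / (r choose k)`. -/
theorem symInl_symInr_pairProd {x : V} (hx : ∀ σ τ, ρ (Perm.sumCongr σ τ) x = x)
    (hK : ∀ i, x + ∑ j, ρ (swap (Sum.inl i) (Sum.inr j)) x = 0) (l : List (Fin r)) (hl : l.Nodup) :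
    symInl ρ (symInr ρ (ρ (pairProd l) x))
      = ((-1) ^ l.length / (r.choose l.length : ℚ)) • x := by
  induction l with
  | nil => simp [pairProd, symInl_symInr_of_fixed ρ hx]
  | cons k l ih =>
    have hk := (List.nodup_cons.1 hl).1
    have hl' := (List.nodup_cons.1 hl).2
    have ih := ih hl'
    have hlen : l.length + 1 ≤ r := by simpa using hl.length_le_card
    set E : V →ₗ[ℚ] V := symInl ρ ∘ₗ symInr ρ with hE
    set g := pairProd l with hg
    have hEabs : ∀ α β v, E (ρ (Perm.sumCongr α β) v) = E v := symInl_symInr_rho ρ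
    have hgk : g (Sum.inl k) = Sum.inl k := by simp [hg, pairProd_inl hl', hk]
    have hgk' : g (Sum.inr k) = Sum.inr k := by simp [hg, pairProd_inr hl', hk]
    have hcons : pairProd (k :: l) = pairSwap k * g := by simp [pairProd, hg]
    have hconj : ∀ a b, g * swap a b = swap (g a) (g b) * g := fun a b => by
      rw [swap_apply_apply]; simp
    have hterm : ∀ j, E (ρ g (ρ (swap (Sum.inl k) (Sum.inr j)) x))
        = if j ∈ l then E (ρ g x) else E (ρ (pairSwap k * g) x) := by
      intro j
      rw [← rho_mul, hconj, hgk]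
      split_ifs with hj
      · have : g (Sum.inr j) = Sum.inl j := by simp [hg, pairProd_inr hl', hj]
        rw [this, rho_mul, ← Perm.sumCongr_swap_one, hEabs]
      · have hgj : g (Sum.inr j) = Sum.inr j := by simp [hg, pairProd_inr hl', hj]
        -- conjugating by the transposition `c` replaces `swap (inl k) (inr j)` by `pairSwap k`
        set c : Perm (Fin r ⊕ Fin r) := swap (Sum.inr k) (Sum.inr j) with hc
        have hcl : c (Sum.inl k) = Sum.inl k := by
          rw [hc, swap_apply_of_ne_of_ne] <;> simp
        have hcr : c (Sum.inr k) = Sum.inr j := by rw [hc, swap_apply_left]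
        have hcc : c⁻¹ = c := by rw [hc, swap_inv]
        have hcg : c * g = g * c := by rw [hc, hconj, hgk', hgj]
        have h1 : swap (Sum.inl k) (Sum.inr j) = c * pairSwap k * c := by
          have := swap_apply_apply c (Sum.inl k) (Sum.inr k)
          rw [hcl, hcr, hcc] at this
          exact this
        have hcs : c = Perm.sumCongr 1 (swap k j) := by rw [hc, Perm.sumCongr_one_swap]
        rw [hgj, h1, mul_assoc, hcg, mul_assoc, rho_mul, hcs, hEabs, ← mul_assoc, rho_mul, hx]
    have hrel : E (ρ g x) + ∑ j, E (ρ g (ρ (swap (Sum.inl k) (Sum.inr j)) x)) = 0 := by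
      have := congrArg (fun v => E (ρ g v)) (hK k)
      simpa only [map_add, map_sum, map_zero] using this
    have hcard : (Finset.univ.filter fun j => j ∈ l).card = l.length := by
      rw [← List.toFinset_card_of_nodup hl']; congr 1; ext j; simp
    have hcard' : (Finset.univ.filter fun j => j ∉ l).card = r - l.length := by
      have := Finset.card_filter_add_card_filter_not (s := (Finset.univ : Finset (Fin r)))
        (fun j => j ∈ l)
      simp only [Finset.card_univ, Fintype.card_fin] at this
      omega
    rw [Finset.sum_congr rfl fun j _ => hterm j, Finset.sum_ite, Finset.sum_const, Finset.sum_const,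
      hcard, hcard', ← Nat.cast_smul_eq_nsmul ℚ, ← Nat.cast_smul_eq_nsmul ℚ,
      Nat.cast_sub (by omega)] at hrel
    have ih' : E (ρ g x) = ((-1) ^ l.length / (r.choose l.length : ℚ)) • x := ih
    rw [ih'] at hrel
    change E (ρ (pairProd (k :: l)) x) = _
    rw [hcons, List.length_cons]
    set m := l.length
    have hrm : (r : ℚ) - m ≠ 0 := by
      have : (m : ℚ) + 1 ≤ r := by exact_mod_cast hlen
      intro h; linarith
    have hc0 : (r.choose m : ℚ) ≠ 0 := by exact_mod_cast (Nat.choose_pos (by omega)).ne'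
    have hc1 : (r.choose (m + 1) : ℚ) = r.choose m * (r - m) / (m + 1) := by
      have h := congrArg (Nat.cast : ℕ → ℚ) (Nat.choose_succ_right_eq r m)
      rw [Nat.cast_mul, Nat.cast_mul, Nat.cast_sub (by omega)] at h
      have hm : (m : ℚ) + 1 ≠ 0 := by positivity
      rw [eq_div_iff hm, ← h]; push_cast; ring
    have hm : (m : ℚ) + 1 ≠ 0 := by positivity
    have h2 : ((r : ℚ) - m) • E (ρ (pairSwap k * g) x)
        = ((r : ℚ) - m) • (((-1) ^ (m + 1) / (r.choose (m + 1) : ℚ)) • x) := by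
      have h3 : ((r : ℚ) - m) • E (ρ (pairSwap k * g) x)
          = -(((1 : ℚ) + m) • (((-1) ^ m / (r.choose m : ℚ)) • x)) := by
        rw [eq_neg_iff_add_eq_zero, ← hrel]; module
      rw [h3, smul_smul, smul_smul, ← neg_smul]
      congr 1
      rw [hc1]
      field_simp
      ring
    exact (smul_right_injective V hrm) h2

/-- The identity `B(j, s) = B(j, s + 1) + B(j + 1, s + 1)` for the inverses `B(j, s)` of
`(s + 1) (s choose j)`, which are values of the beta function. -/
theorem beta_recursion (s j : ℕ) (hj : j ≤ s) :
    (1 : ℚ) / ((s + 1) * s.choose j)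
      = 1 / ((s + 1 + 1) * (s + 1).choose j) + 1 / ((s + 1 + 1) * (s + 1).choose (j + 1)) := by
  have e1 := congrArg (Nat.cast : ℕ → ℚ) (Nat.choose_succ_right_eq (s + 1) j)
  have e2 := congrArg (Nat.cast : ℕ → ℚ) (Nat.add_one_mul_choose_eq s j)
  rw [Nat.cast_mul, Nat.cast_mul, Nat.cast_sub (by omega)] at e1
  push_cast at e1 e2
  have ha : ((s + 1).choose (j + 1) : ℚ) ≠ 0 := by
    exact_mod_cast (Nat.choose_pos (by omega)).ne'
  have hjs : (s : ℚ) + 1 - j ≠ 0 := by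
    have : (j : ℚ) ≤ s := by exact_mod_cast hj
    intro h; linarith
  have e1' : ((s + 1).choose j : ℚ) = (s + 1).choose (j + 1) * (j + 1) / (s + 1 - j) := by
    rw [eq_div_iff hjs, e1]
  have hs : (s : ℚ) + 1 ≠ 0 := by positivity
  have hs2 : (s : ℚ) + 1 + 1 ≠ 0 := by positivity
  have hj1 : (j : ℚ) + 1 ≠ 0 := by positivity
  rw [e2, e1']
  field_simp
  ring

/-- The effect of the skew-symmetrisations in the pairs of `l`, after which the pairs of `l'` are
exchanged. Each skew-symmetrisation splits into two terms, with `l'` and with `i :: l'` exchanged,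
which are recombined by `beta_recursion`. -/
theorem symInl_symInr_foldr {x : V} (hx : ∀ σ τ, ρ (Perm.sumCongr σ τ) x = x)
    (hK : ∀ i, x + ∑ j, ρ (swap (Sum.inl i) (Sum.inr j)) x = 0) (l : List (Fin r)) :
    ∀ l' : List (Fin r), (l' ++ l).Nodup →
    symInl ρ (symInr ρ (ρ (pairProd l') (l.foldr (skewAct ρ) x)))
      = ((2⁻¹ : ℚ) ^ l.length * ((-1) ^ l'.length * (r + 1)
          * (1 / (((r - l.length : ℕ) + 1) * (r - l.length).choose l'.length)))) • x := by
  induction l with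
  | nil =>
    intro l' hl
    have hr : (r : ℚ) + 1 ≠ 0 := by positivity
    rw [List.append_nil] at hl
    rw [List.foldr_nil, symInl_symInr_pairProd ρ hx hK l' hl]
    congr 1
    simp only [List.length_nil, pow_zero, one_mul, Nat.sub_zero]
    field_simp
  | cons i l ih =>
    intro l' hl
    have hl1 : (l' ++ l).Nodup :=
      hl.sublist (List.Sublist.append_left (List.sublist_cons_self i l) l')
    have hl2 : ((l' ++ [i]) ++ l).Nodup := by simpa using hl
    have hlen : l'.length + (l.length + 1) ≤ r := by simpa using hl.length_le_card
    have hp : ∀ v, ρ (pairProd l') (ρ (pairSwap i) v) = ρ (pairProd (l' ++ [i])) v := by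
      intro v; rw [← rho_mul]; simp [pairProd]
    rw [List.foldr_cons, skewAct]
    simp only [map_smul, map_sub, hp]
    rw [ih l' hl1, ih _ hl2, ← sub_smul, smul_smul]
    congr 1
    obtain ⟨s, hs⟩ : ∃ s, r - l.length = s + 1 := ⟨r - l.length - 1, by omega⟩
    have hs' : r - (i :: l).length = s := by simp; omega
    have hb := beta_recursion s l'.length (by omega)
    rw [hs, hs', hb]
    simp only [List.length_cons, List.length_append, List.length_nil]
    push_cast
    ring

/-- The Young map multiplies elements with the symmetries of the Young diagram `(r, r)` by
`(r + 1) / 2 ^ r`. -/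
theorem youngAct_eq_smul {x : V} (hx : ∀ σ τ, ρ (Perm.sumCongr σ τ) x = x)
    (hK : ∀ i, x + ∑ j, ρ (swap (Sum.inl i) (Sum.inr j)) x = 0) :
    youngAct ρ x = ((r + 1 : ℚ) / 2 ^ r) • x := by
  have h := symInl_symInr_foldr ρ hx hK (List.finRange r) [] (by simpa using List.nodup_finRange r)
  simp only [pairProd, List.map_nil, List.prod_nil, map_one, Module.End.one_apply] at h
  rw [youngAct, h]
  congr 1
  simp
  ring

theorem perm_induction_adjacent {r : ℕ} {P : Perm (Fin r) → Prop} (one : P 1)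
    (mul : ∀ σ τ, P σ → P τ → P (σ * τ))
    (adj : ∀ i j : Fin r, (j : ℕ) = i + 1 → P (swap i j)) (σ : Perm (Fin r)) : P σ := by
  cases r with
  | zero => rwa [Subsingleton.elim σ 1]
  | succ k =>
    have hσ : σ ∈ Submonoid.closure (Set.range fun i : Fin k => swap i.castSucc i.succ) := by
      rw [Perm.mclosure_swap_castSucc_succ]; trivial
    induction hσ using Submonoid.closure_induction with
    | mem x h => obtain ⟨i, rfl⟩ := h; exact adj _ _ (by simp)
    | one => exact one
    | mul x y _ _ hx hy => exact mul x y hx hy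

/-- It is enough to know the symmetries for adjacent transpositions, and the vanishing of the
symmetrisation over one group and a single index of the other. -/
theorem youngAct_eq_smul_of_adjacent {x : V}
    (hB : ∀ i j : Fin r, (j : ℕ) = i + 1 → ρ (swap (Sum.inl i) (Sum.inl j)) x = x)
    (hC : ∀ i j : Fin r, (j : ℕ) = i + 1 → ρ (swap (Sum.inr i) (Sum.inr j)) x = x)
    (i₀ : Fin r) (hK : x + ∑ j, ρ (swap (Sum.inl i₀) (Sum.inr j)) x = 0) :
    youngAct ρ x = ((r + 1 : ℚ) / 2 ^ r) • x := by
  have hB' : ∀ σ, ρ (Perm.sumCongr σ 1) x = x := by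
    refine perm_induction_adjacent (by simp [Perm.sumCongr_one]) (fun σ τ hσ hτ => ?_)
      fun i j hij => ?_
    · rw [← one_mul (1 : Perm (Fin r)), ← Perm.sumCongr_mul, rho_mul, hτ, hσ]
    · rw [Perm.sumCongr_swap_one, hB i j hij]
  have hC' : ∀ σ, ρ (Perm.sumCongr 1 σ) x = x := by
    refine perm_induction_adjacent (by simp [Perm.sumCongr_one]) (fun σ τ hσ hτ => ?_)
      fun i j hij => ?_
    · rw [← one_mul (1 : Perm (Fin r)), ← Perm.sumCongr_mul, rho_mul, hτ, hσ]
    · rw [Perm.sumCongr_one_swap, hC i j hij]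
  have hx : ∀ σ τ, ρ (Perm.sumCongr σ τ) x = x := by
    intro σ τ
    rw [← mul_one σ, ← one_mul τ, ← Perm.sumCongr_mul, rho_mul, hC', hB']
  refine youngAct_eq_smul ρ hx fun i => ?_
  set c : Perm (Fin r ⊕ Fin r) := swap (Sum.inl i₀) (Sum.inl i) with hc
  have hcx : ρ c x = x := by rw [hc, ← Perm.sumCongr_swap_one, hB']
  have h1 : ∀ j, ρ c (ρ (swap (Sum.inl i₀) (Sum.inr j)) x)
      = ρ (swap (Sum.inl i) (Sum.inr j)) x := by
    intro j
    have h2 : c * swap (Sum.inl i₀) (Sum.inr j) = swap (Sum.inl i) (Sum.inr j) * c := by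
      have := swap_apply_apply c (Sum.inl i₀) (Sum.inr j)
      rw [show c (Sum.inl i₀) = Sum.inl i by rw [hc, swap_apply_left],
        show c (Sum.inr j) = Sum.inr j by rw [hc, swap_apply_of_ne_of_ne] <;> simp] at this
      rw [this]; simp
    rw [← rho_mul, h2, rho_mul, hcx]
  have := congrArg (ρ c) hK
  simpa only [map_add, map_sum, map_zero, hcx, h1] using this

/-- `youngAct_eq_smul_of_adjacent` modulo an invariant subspace. -/
theorem youngAct_sub_smul_mem (N : Submodule ℚ V) (hN : ∀ g, N ≤ N.comap (ρ g)) {x : V}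
    (hB : ∀ i j : Fin r, (j : ℕ) = i + 1 → x - ρ (swap (Sum.inl i) (Sum.inl j)) x ∈ N)
    (hC : ∀ i j : Fin r, (j : ℕ) = i + 1 → x - ρ (swap (Sum.inr i) (Sum.inr j)) x ∈ N)
    (i₀ : Fin r) (hK : x + ∑ j, ρ (swap (Sum.inl i₀) (Sum.inr j)) x ∈ N) :
    youngAct ρ x - ((r + 1 : ℚ) / 2 ^ r) • x ∈ N := by
  have hf : ∀ g v, N.mkQ (ρ g v) = ρ.quotient N hN g (N.mkQ v) := fun g v => rfl
  have hz : ∀ v, N.mkQ v = 0 ↔ v ∈ N := fun v => by simp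
  rw [← hz, map_sub, map_smul, sub_eq_zero, map_youngAct N.mkQ hf]
  refine youngAct_eq_smul_of_adjacent _ (fun i j hij => ?_) (fun i j hij => ?_) i₀ ?_
  · have := (hz _).2 (hB i j hij)
    rw [map_sub, sub_eq_zero, hf] at this
    exact this.symm
  · have := (hz _).2 (hC i j hij)
    rw [map_sub, sub_eq_zero, hf] at this
    exact this.symm
  · have := (hz _).2 hK
    simpa only [map_add, map_sum, hf] using this

end Young

/-! ### The Leibniz rule for contracted products -/

section Leibniz

/-- Add a new first index to the left factor; it becomes the first index of the product. -/
def consLeft {A B Q : ℕ} (e : Fin A ⊕ Fin B ≃ Option (Fin Q)) :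
    Fin (A + 1) ⊕ Fin B ≃ Option (Fin (Q + 1)) where
  toFun := Sum.elim (Fin.cases (some 0) fun s => (e (Sum.inl s)).map Fin.succ)
    fun s => (e (Sum.inr s)).map Fin.succ
  invFun o := o.elim (Sum.map Fin.succ id (e.symm none))
    (Fin.cases (Sum.inl 0) fun k => Sum.map Fin.succ id (e.symm (some k)))
  left_inv := by
    rintro (s | s)
    · refine Fin.cases rfl (fun s => ?_) s
      rcases h : e (Sum.inl s) with _ | k <;> simp [h, e.symm_apply_eq.2 h.symm]
    · rcases h : e (Sum.inr s) with _ | k <;> simp [h, e.symm_apply_eq.2 h.symm]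
  right_inv := by
    rintro (_ | k)
    · rcases h : e.symm none with s | s <;> simp [← e.symm_apply_eq.1 h]
    · refine Fin.cases rfl (fun k => ?_) k
      rcases h : e.symm (some k) with s | s <;> simp [h, ← e.symm_apply_eq.1 h]

/-- Add a new first index to the right factor; it becomes the first index of the product. -/
def consRight {A B Q : ℕ} (e : Fin A ⊕ Fin B ≃ Option (Fin Q)) :
    Fin A ⊕ Fin (B + 1) ≃ Option (Fin (Q + 1)) :=
  (Equiv.sumComm _ _).trans (consLeft ((Equiv.sumComm _ _).trans e))

section

variable {A B Q : ℕ} (e : Fin A ⊕ Fin B ≃ Option (Fin Q))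

@[simp] theorem consLeft_inl_zero : consLeft e (Sum.inl 0) = some 0 := rfl
@[simp] theorem consLeft_inl_succ (s : Fin A) :
    consLeft e (Sum.inl s.succ) = (e (Sum.inl s)).map Fin.succ := rfl
@[simp] theorem consLeft_inr (s : Fin B) :
    consLeft e (Sum.inr s) = (e (Sum.inr s)).map Fin.succ := rfl
@[simp] theorem consRight_inr_zero : consRight e (Sum.inr 0) = some 0 := rfl
@[simp] theorem consRight_inr_succ (s : Fin B) :
    consRight e (Sum.inr s.succ) = (e (Sum.inr s)).map Fin.succ := rfl
@[simp] theorem consRight_inl (s : Fin A) :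
    consRight e (Sum.inl s) = (e (Sum.inl s)).map Fin.succ := rfl

end

variable {n A B Q : ℕ} {Γ : Coeffs n} {Ω : Set (Model n)} {y : Model n}

/-- The contraction of the upper index of `T₁` with the lower index of `T₁ ⊗ T₂` mapped to `none`,
the other lower indices being distributed over the positions of the result by `e`. -/
def contr (e : Fin A ⊕ Fin B ≃ Option (Fin Q)) (T₁ : TField n 1 A) (T₂ : TField n 0 B) :
    TField n 0 Q := fun y U L =>
  ∑ C : TIdx n, T₁ y (fun _ => C) (fun s => (e (Sum.inl s)).elim C L)
    * T₂ y U (fun s => (e (Sum.inr s)).elim C L)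

theorem smoothOn_contr (e : Fin A ⊕ Fin B ≃ Option (Fin Q)) {T₁ : TField n 1 A} {T₂ : TField n 0 B}
    (h₁ : SmoothOn T₁ Ω) (h₂ : SmoothOn T₂ Ω) : SmoothOn (contr e T₁ T₂) Ω := fun _ _ =>
  ContDiffOn.sum fun _ _ => (h₁ _ _).mul (h₂ _ _)

/-- A derivation acting in all slots of a tensor product, sorted into the two contracted slots and
the slots that remain. -/
theorem sum_slots (e : Fin A ⊕ Fin B ≃ Option (Fin Q)) (C : TIdx n) (M : Fin Q → TIdx n)
    (f : TIdx n → TIdx n → ℝ) (F : (Fin A ⊕ Fin B → TIdx n) → ℝ) :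
    ∑ x, ∑ D, f D ((e x).elim C M) * F (Function.update (fun x => (e x).elim C M) x D)
      = ∑ D, f D C * F (fun x => (e x).elim D M)
        + ∑ s, ∑ D, f D (M s) * F (fun x => (e x).elim C (Function.update M s D)) := by
  classical
  rw [← Equiv.sum_comp e.symm, Fintype.sum_option]
  congr 1
  · refine Finset.sum_congr rfl fun D _ => ?_
    simp only [Equiv.apply_symm_apply, Option.elim_none]
    congr 2
    funext x
    by_cases hx : x = e.symm none
    · subst hx; simp
    · rw [Function.update_of_ne hx]
      rcases h : e x with _ | k
      · exact absurd (e.eq_symm_apply.2 h) hx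
      · rfl
  · refine Finset.sum_congr rfl fun s _ => Finset.sum_congr rfl fun D _ => ?_
    simp only [Equiv.apply_symm_apply, Option.elim_some]
    congr 2
    funext x
    by_cases hx : x = e.symm (some s)
    · subst hx; simp
    · rw [Function.update_of_ne hx]
      rcases h : e x with _ | k
      · rfl
      · have : k ≠ s := by rintro rfl; exact hx (e.eq_symm_apply.2 h)
        simp [this]

/-- The Leibniz rule for the coupled connection; the connection matrix cancels in the contracted
pair because it acts on upper and lower indices with opposite signs. -/
theorem tractorNabla_contr (hΩ : IsOpen Ω) (hy : y ∈ Ω) (e : Fin A ⊕ Fin B ≃ Option (Fin Q))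
    {T₁ : TField n 1 A} {T₂ : TField n 0 B}
    (h₁ : SmoothOn T₁ Ω) (h₂ : SmoothOn T₂ Ω) (w₁ w₂ : ℝ) (a : Fin n) (U : Fin 0 → TIdx n) :
    tractorNabla Γ (w₁ + w₂) a (contr e T₁ T₂) y U
      = fun L => contr e (tractorNabla Γ w₁ a T₁) T₂ y U L
        + contr e T₁ (tractorNabla Γ w₂ a T₂) y U L := by
  funext M
  have hd₁ : ∀ U L, DifferentiableAt ℝ (fun z => T₁ z U L) y := fun U L =>
    differentiableAt_of_contDiffOn hΩ (h₁ U L) hy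
  have hd₂ : ∀ L, DifferentiableAt ℝ (fun z => T₂ z U L) y := fun L =>
    differentiableAt_of_contDiffOn hΩ (h₂ U L) hy
  have hcard : (A : ℝ) + B = Q + 1 := by
    have := Fintype.card_congr e
    simp only [Fintype.card_sum, Fintype.card_fin, Fintype.card_option] at this
    exact_mod_cast this
  have hpd : pd a (fun z => contr e T₁ T₂ z U M) y
      = ∑ C, (pd a (fun z => T₁ z (fun _ => C) (fun s => (e (Sum.inl s)).elim C M)) y
          * T₂ y U (fun s => (e (Sum.inr s)).elim C M)
        + T₁ y (fun _ => C) (fun s => (e (Sum.inl s)).elim C M)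
          * pd a (fun z => T₂ z U (fun s => (e (Sum.inr s)).elim C M)) y) := by
    unfold contr
    rw [pd_sum a (F := fun C z => T₁ z (fun _ => C) (fun s => (e (Sum.inl s)).elim C M)
      * T₂ z U (fun s => (e (Sum.inr s)).elim C M)) Finset.univ fun C _ => (hd₁ _ _).mul (hd₂ _)]
    exact Finset.sum_congr rfl fun C _ => pd_mul a (hd₁ _ _) (hd₂ _)
  -- the terms of the connection matrix, slot by slot, over both factors
  have hslots : ∀ C : TIdx n,
      (∑ s, ∑ D, tractorForm Γ a D ((e (Sum.inl s)).elim C M) y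
          * T₁ y (fun _ => C) (Function.update (fun s => (e (Sum.inl s)).elim C M) s D))
          * T₂ y U (fun s => (e (Sum.inr s)).elim C M)
        + T₁ y (fun _ => C) (fun s => (e (Sum.inl s)).elim C M)
          * (∑ s, ∑ D, tractorForm Γ a D ((e (Sum.inr s)).elim C M) y
            * T₂ y U (Function.update (fun s => (e (Sum.inr s)).elim C M) s D))
      = ∑ D, tractorForm Γ a D C y * (T₁ y (fun _ => C) (fun s => (e (Sum.inl s)).elim D M)
          * T₂ y U (fun s => (e (Sum.inr s)).elim D M))
        + ∑ s, ∑ D, tractorForm Γ a D (M s) y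
          * (T₁ y (fun _ => C) (fun t => (e (Sum.inl t)).elim C (Function.update M s D))
            * T₂ y U (fun t => (e (Sum.inr t)).elim C (Function.update M s D))) := by
    intro C
    refine Eq.trans ?_ (sum_slots e C M (fun D E => tractorForm Γ a D E y)
      (fun X => T₁ y (fun _ => C) (X ∘ Sum.inl) * T₂ y U (X ∘ Sum.inr)))
    rw [Fintype.sum_sum_type]
    simp only [Sum.update_inl_comp_inl, Sum.update_inl_comp_inr, Sum.update_inr_comp_inl,
      Sum.update_inr_comp_inr, Finset.sum_mul, Finset.mul_sum]
    congr 1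
    · exact Finset.sum_congr rfl fun s _ => Finset.sum_congr rfl fun D _ => mul_assoc _ _ _
    · exact Finset.sum_congr rfl fun s _ => Finset.sum_congr rfl fun D _ => mul_left_comm _ _ _
  -- the contracted pair does not contribute
  have hcancel : ∑ C, (∑ D, tractorForm Γ a C D y
        * T₁ y (fun _ => D) (fun s => (e (Sum.inl s)).elim C M))
        * T₂ y U (fun s => (e (Sum.inr s)).elim C M)
      = ∑ C, ∑ D, tractorForm Γ a D C y * (T₁ y (fun _ => C) (fun s => (e (Sum.inl s)).elim D M)
          * T₂ y U (fun s => (e (Sum.inr s)).elim D M)) := by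
    rw [Finset.sum_comm]
    refine Finset.sum_congr rfl fun C _ => ?_
    rw [Finset.sum_mul]
    exact Finset.sum_congr rfl fun D _ => mul_assoc _ _ _
  have hout : ∑ s, ∑ D, tractorForm Γ a D (M s) y * contr e T₁ T₂ y U (Function.update M s D)
      = ∑ C, ∑ s, ∑ D, tractorForm Γ a D (M s) y
          * (T₁ y (fun _ => C) (fun t => (e (Sum.inl t)).elim C (Function.update M s D))
            * T₂ y U (fun t => (e (Sum.inr t)).elim C (Function.update M s D))) := by
    symm
    rw [Finset.sum_comm]
    refine Finset.sum_congr rfl fun s _ => ?_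
    rw [Finset.sum_comm]
    refine Finset.sum_congr rfl fun D _ => ?_
    rw [contr, Finset.mul_sum]
  have hup : ∀ (C : TIdx n) (L : Fin A → TIdx n),
      (∑ s : Fin 1, ∑ D, tractorForm Γ a C D y
        * T₁ y (Function.update (fun _ => C) s D) L) = ∑ D, tractorForm Γ a C D y
        * T₁ y (fun _ => D) L := by
    intro C L
    rw [Fin.sum_univ_one]
    refine Finset.sum_congr rfl fun D _ => ?_
    congr 2
    funext i
    rw [Subsingleton.elim i 0, Function.update_self]
  have htrace : ((w₁ + w₂ + Q) / ((n : ℝ) + 1))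
      = ((w₁ + A - 1) / ((n : ℝ) + 1)) + ((w₂ + B) / ((n : ℝ) + 1)) := by
    rw [← add_div]; congr 1; linarith
  have hR : contr e (tractorNabla Γ w₁ a T₁) T₂ y U M + contr e T₁ (tractorNabla Γ w₂ a T₂) y U M
      = ∑ C, (pd a (fun z => T₁ z (fun _ => C) (fun s => (e (Sum.inl s)).elim C M)) y
          * T₂ y U (fun s => (e (Sum.inr s)).elim C M)
        + T₁ y (fun _ => C) (fun s => (e (Sum.inl s)).elim C M)
          * pd a (fun z => T₂ z U (fun s => (e (Sum.inr s)).elim C M)) y)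
        + ((w₁ + w₂ + Q) / ((n : ℝ) + 1)) * traceForm Γ a y * contr e T₁ T₂ y U M
        + ∑ C, (∑ D, tractorForm Γ a C D y
        * T₁ y (fun _ => D) (fun s => (e (Sum.inl s)).elim C M))
        * T₂ y U (fun s => (e (Sum.inr s)).elim C M)
        - ∑ C, ((∑ s, ∑ D, tractorForm Γ a D ((e (Sum.inl s)).elim C M) y
          * T₁ y (fun _ => C) (Function.update (fun s => (e (Sum.inl s)).elim C M) s D))
          * T₂ y U (fun s => (e (Sum.inr s)).elim C M)
        + T₁ y (fun _ => C) (fun s => (e (Sum.inl s)).elim C M)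
          * (∑ s, ∑ D, tractorForm Γ a D ((e (Sum.inr s)).elim C M) y
            * T₂ y U (Function.update (fun s => (e (Sum.inr s)).elim C M) s D))) := by
    simp only [contr]
    rw [← Finset.sum_add_distrib, Finset.mul_sum, ← Finset.sum_add_distrib,
      ← Finset.sum_add_distrib, ← Finset.sum_sub_distrib]
    refine Finset.sum_congr rfl fun C _ => ?_
    simp only [tractorNabla, hup, htrace]
    simp only [Finset.univ_eq_empty, Finset.sum_empty, Nat.cast_one, Nat.cast_zero]
    ring
  rw [hR, (Finset.sum_congr rfl fun C _ => hslots C).trans Finset.sum_add_distrib, hcancel, ← hout,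
    ← hpd]
  simp only [tractorNabla, Finset.univ_eq_empty, Finset.sum_empty, Nat.cast_zero]
  ring

/-- The Leibniz rule for the Thomas operator and contracted products. -/
theorem thomasD_contr (hΩ : IsOpen Ω) (hy : y ∈ Ω) (e : Fin A ⊕ Fin B ≃ Option (Fin Q))
    {T₁ : TField n 1 A} {T₂ : TField n 0 B}
    (h₁ : SmoothOn T₁ Ω) (h₂ : SmoothOn T₂ Ω) (w₁ w₂ : ℝ) (U : Fin 0 → TIdx n)
    (L : Fin (Q + 1) → TIdx n) :
    thomasD Γ (w₁ + w₂) (contr e T₁ T₂) y U L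
      = contr (consLeft e) (thomasD Γ w₁ T₁) T₂ y U L
        + contr (consRight e) T₁ (thomasD Γ w₂ T₂) y U L := by
  have hmap : ∀ (o : Option (Fin Q)) (C : TIdx n),
      (o.map Fin.succ).elim C L = o.elim C (Fin.tail L) := by
    rintro (_ | k) C <;> rfl
  have htl : ∀ C : TIdx n, Fin.tail (fun s => ((consLeft e) (Sum.inl s)).elim C L)
      = fun s => (e (Sum.inl s)).elim C (Fin.tail L) := fun C => by
    funext s; simp [Fin.tail, hmap]
  have htr : ∀ C : TIdx n, Fin.tail (fun s => ((consRight e) (Sum.inr s)).elim C L)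
      = fun s => (e (Sum.inr s)).elim C (Fin.tail L) := fun C => by
    funext s; simp [Fin.tail, hmap]
  rcases hL : L 0 with _ | a
  · rw [thomasD_none _ _ U hL]
    simp only [contr, consLeft_inr, consRight_inl, hmap]
    rw [← Finset.sum_add_distrib, Finset.mul_sum]
    refine Finset.sum_congr rfl fun C _ => ?_
    rw [thomasD_none w₁ y _ (L := fun s => ((consLeft e) (Sum.inl s)).elim C L) (by simpa using hL),
      thomasD_none w₂ y U (L := fun s => ((consRight e) (Sum.inr s)).elim C L) (by simpa using hL),
      htl, htr]
    ring
  · rw [thomasD_some _ _ U hL, tractorNabla_contr hΩ hy e h₁ h₂]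
    simp only [contr, consLeft_inr, consRight_inl, hmap]
    congr 1
    · refine Finset.sum_congr rfl fun C _ => ?_
      rw [thomasD_some (a := a) w₁ y _ (L := fun s => ((consLeft e) (Sum.inl s)).elim C L)
        (by simpa using hL), htl]
    · refine Finset.sum_congr rfl fun C _ => ?_
      rw [thomasD_some (a := a) w₂ y _ (L := fun s => ((consRight e) (Sum.inr s)).elim C L)
        (by simpa using hL), htr]

end Leibniz

/-! ### Universal curvature formulas -/

section Formulas

/-- A term of a curvature formula with `r + q` output indices: the analogue of `CurvTerm` where
only `q` Thomas operators, two of them used up by `W`, have been applied to `K`. -/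
structure PartialTerm (r q : ℕ) where
  a : ℕ
  b : ℕ
  order_eq : a + b + 2 = q
  coeff : ℚ
  slot : Fin (3 + a) ⊕ Fin (r + b) ≃ Option (Fin (r + q))
  contracted : ∃ s, slot (Sum.inr s) = none

variable {r q : ℕ}

/-- The tensor field given by a term. -/
def PartialTerm.eval {n : ℕ} (t : PartialTerm r q) (Γ : Coeffs n) (K : TField n 0 r) :
    TField n 0 (r + q) := fun y U L =>
  (t.coeff : ℝ) * contr t.slot (thomasDPow Γ (-2) (wCurvature Γ) t.a) (thomasDPow Γ r K t.b) y U L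

/-- The tensor field given by a formal sum of terms. -/
def evalTerms {n : ℕ} (F : List (PartialTerm r q)) (Γ : Coeffs n) (K : TField n 0 r) :
    TField n 0 (r + q) := fun y U L => (F.map fun t => t.eval Γ K y U L).sum

/-- The term of `𝔻 t` in which `𝔻` falls on the curvature. -/
def PartialTerm.derivLeft (t : PartialTerm r q) : PartialTerm r (q + 1) where
  a := t.a + 1
  b := t.b
  order_eq := by have := t.order_eq; omega
  coeff := t.coeff
  slot := consLeft t.slot
  contracted := t.contracted.imp fun s hs => by
    rw [consLeft_inr, hs]; rfl

/-- The term of `𝔻 t` in which `𝔻` falls on the second factor. -/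
def PartialTerm.derivRight (t : PartialTerm r q) : PartialTerm r (q + 1) where
  a := t.a
  b := t.b + 1
  order_eq := by have := t.order_eq; omega
  coeff := t.coeff
  slot := consRight t.slot
  contracted := by
    obtain ⟨s, hs⟩ := t.contracted
    exact ⟨s.succ, by rw [consRight_inr_succ, hs]; rfl⟩

/-- The formal derivative of a formula. -/
def derivTerms (F : List (PartialTerm r q)) : List (PartialTerm r (q + 1)) :=
  F.flatMap fun t => [t.derivLeft, t.derivRight]

variable {n : ℕ} {Γ : Coeffs n} {Ω : Set (Model n)} {K : TField n 0 r} {y : Model n}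

theorem PartialTerm.smooth_eval (t : PartialTerm r q) (h : IsTorsionFreeOn Γ Ω)
    (hK : SmoothOn K Ω) : SmoothOn (t.eval Γ K) Ω := fun U L =>
  contDiffOn_const.mul (smoothOn_contr _ (h.smooth_thomasDPow _ h.smooth_wCurvature _)
    (h.smooth_thomasDPow _ hK _) U L)

theorem smooth_evalTerms (F : List (PartialTerm r q)) (h : IsTorsionFreeOn Γ Ω)
    (hK : SmoothOn K Ω) : SmoothOn (evalTerms F Γ K) Ω := by
  intro U L
  induction F with
  | nil => simpa [evalTerms] using contDiffOn_const
  | cons t F ih => simpa [evalTerms] using (t.smooth_eval h hK U L).add ih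

theorem thomasD_add {p q : ℕ} (hΩ : IsOpen Ω) (hy : y ∈ Ω) (w : ℝ) {T S : TField n p q}
    (hT : SmoothOn T Ω) (hS : SmoothOn S Ω) (U : Fin p → TIdx n) (L : Fin (q + 1) → TIdx n) :
    thomasD Γ w (fun z U L => T z U L + S z U L) y U L
      = thomasD Γ w T y U L + thomasD Γ w S y U L := by
  have h := thomasD_sum (Γ := Γ) hΩ w (Finset.univ : Finset Bool) (fun _ => 1)
    (fun b => cond b T S) (by rintro (_ | _) _ <;> assumption) hy U L
  simpa using h

theorem thomasD_smul {p q : ℕ} (hΩ : IsOpen Ω) (hy : y ∈ Ω) (w c : ℝ) {T : TField n p q}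
    (hT : SmoothOn T Ω) (U : Fin p → TIdx n) (L : Fin (q + 1) → TIdx n) :
    thomasD Γ w (fun z U L => c * T z U L) y U L = c * thomasD Γ w T y U L := by
  have h := thomasD_sum (Γ := Γ) hΩ w (Finset.univ : Finset Unit) (fun _ => c)
    (fun _ => T) (fun _ _ => hT) hy U L
  simpa using h

theorem thomasD_zero {p q : ℕ} (w : ℝ) (U : Fin p → TIdx n) (L : Fin (q + 1) → TIdx n) :
    thomasD Γ w (fun _ _ _ => 0) y U L = 0 := by
  rcases hL : L 0 with _ | a
  · rw [thomasD_none w _ U hL, mul_zero]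
  · rw [thomasD_some w _ U hL]; simp [tractorNabla, pd_const]

theorem PartialTerm.thomasD_eval (t : PartialTerm r q) (h : IsTorsionFreeOn Γ Ω) (hy : y ∈ Ω)
    (hK : SmoothOn K Ω) (U : Fin 0 → TIdx n) (L : Fin (r + q + 1) → TIdx n) :
    thomasD Γ (r - q) (t.eval Γ K) y U L
      = t.derivLeft.eval Γ K y U L + t.derivRight.eval Γ K y U L := by
  have hW := h.smooth_thomasDPow (-2) h.smooth_wCurvature t.a
  have hKb := h.smooth_thomasDPow r hK t.b
  have hw : (r : ℝ) - q = (-2 - t.a) + (r - t.b) := by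
    have := congrArg (Nat.cast : ℕ → ℝ) t.order_eq
    push_cast at this
    linarith
  have hL := thomasD_contr (Γ := Γ) h.isOpen hy t.slot hW hKb (-2 - t.a) (r - t.b) U L
  have e : thomasD Γ (r - q) (t.eval Γ K) y U L
      = t.coeff * thomasD Γ (r - q) (contr t.slot (thomasDPow Γ (-2) (wCurvature Γ) t.a)
          (thomasDPow Γ r K t.b)) y U L :=
    thomasD_smul h.isOpen hy _ _ (smoothOn_contr _ hW hKb) U L
  rw [e, hw, hL, mul_add]
  rfl

theorem thomasD_evalTerms (F : List (PartialTerm r q)) (h : IsTorsionFreeOn Γ Ω) (hy : y ∈ Ω)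
    (hK : SmoothOn K Ω) (U : Fin 0 → TIdx n) (L : Fin (r + q + 1) → TIdx n) :
    thomasD Γ (r - q) (evalTerms F Γ K) y U L = evalTerms (derivTerms F) Γ K y U L := by
  induction F with
  | nil => exact thomasD_zero _ U L
  | cons t F ih =>
    have e : evalTerms (t :: F) Γ K = fun z U L => t.eval Γ K z U L + evalTerms F Γ K z U L := by
      funext z U L; simp [evalTerms]
    rw [e, thomasD_add h.isOpen hy _ (t.smooth_eval h hK) (smooth_evalTerms F h hK), ih,
      t.thomasD_eval h hy hK]
    simp [evalTerms, derivTerms, add_assoc]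

/-- The slots of the curvature action in the `s`-th index of a field with `N` lower indices. -/
def actSlot {N : ℕ} (s : Fin N) : Fin 3 ⊕ Fin N ≃ Option (Fin (N + 1 + 1)) :=
  consLeft (consLeft ((((Equiv.sumComm (Fin 1) (Fin N)).trans
    (Equiv.sumCongr (Equiv.refl _) (Equiv.ofUnique (Fin 1) PUnit.{1}))).trans
      (Equiv.optionEquivSumPUnit (Fin N)).symm).trans (Equiv.swap none (some s))))

theorem actSlot_inl_two {N : ℕ} (s : Fin N) : actSlot s (Sum.inl 2) = some s.succ.succ := by
  have : actSlot s (Sum.inl 2)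
      = ((Equiv.swap none (some s) none).map Fin.succ).map Fin.succ := rfl
  rw [this, Equiv.swap_apply_left]; rfl

theorem actSlot_inr {N : ℕ} (s t : Fin N) :
    actSlot s (Sum.inr t) = if t = s then none else some t.succ.succ := by
  have : actSlot s (Sum.inr t)
      = ((Equiv.swap none (some s) (some t)).map Fin.succ).map Fin.succ := rfl
  rw [this]
  split_ifs with h
  · subst h; rw [Equiv.swap_apply_right]; rfl
  · rw [Equiv.swap_apply_of_ne_of_ne (by simp) (by simpa using h)]; rfl

/-- The commutator of the two outermost Thomas operators in `𝔻^{m+2} K`, as a formula. -/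
def commTerms (r m : ℕ) : List (PartialTerm r (m + 2)) :=
  (List.finRange (r + m)).map fun s =>
    { a := 0, b := m, order_eq := by omega, coeff := -1, slot := actSlot s
      contracted := ⟨s, by rw [actSlot_inr]; simp⟩ }

theorem eval_commTerms (m : ℕ) (hn : 2 ≤ n) (h : IsTorsionFreeOn Γ Ω) (hy : y ∈ Ω)
    (hK : SmoothOn K Ω) (U : Fin 0 → TIdx n) (L : Fin (r + (m + 2)) → TIdx n) :
    thomasDPow Γ r K (m + 2) y U L
        - thomasDPow Γ r K (m + 2) y U (L ∘ Equiv.swap (0 : Fin (r + m + 1 + 1)) 1)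
      = evalTerms (commTerms r m) Γ K y U L := by
  have hc := h.thomasD_comm hn hy (h.smooth_thomasDPow r hK m) ((r : ℝ) - m) U L
  have hw : (r : ℝ) - (m + 1 : ℕ) = r - m - 1 := by push_cast; ring
  have hD : thomasDPow Γ r K (m + 2)
      = thomasD Γ (r - m - 1) (thomasD Γ (r - m) (thomasDPow Γ r K m)) := by
    rw [← hw]; rfl
  rw [hD, hc, evalTerms, commTerms, List.map_map, ← Finset.sum_neg_distrib, ← List.ofFn_eq_map,
    List.sum_ofFn]
  refine Finset.sum_congr rfl fun s _ => ?_
  simp only [Function.comp_apply, PartialTerm.eval, contr, Rat.cast_neg, Rat.cast_one, neg_one_mul]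
  congr 1
  refine Finset.sum_congr rfl fun C _ => congrArg₂ (· * ·) ?_ ?_
  · have : ![L 0, L 1, L s.succ.succ]
        = fun t : Fin 3 => (actSlot s (Sum.inl t)).elim C L := by
      funext t
      fin_cases t
      · rfl
      · rfl
      · change L s.succ.succ = (actSlot s (Sum.inl 2)).elim C L
        rw [actSlot_inl_two]; rfl
    rw [this]; rfl
  · congr 1
    funext t
    rw [actSlot_inr]
    by_cases hts : t = s
    · subst hts; simp
    · simp [hts, Fin.tail]

/-- Adjacent Thomas operators in `𝔻^m K` commute up to a universal curvature formula. -/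
theorem exists_terms_swap (r m : ℕ) (i j : Fin (r + m)) (hij : (j : ℕ) = i + 1) (hj : (j : ℕ) < m) :
    ∃ F : List (PartialTerm r m), ∀ (n : ℕ), 2 ≤ n → ∀ (Γ : Coeffs n) (Ω : Set (Model n))
      (K : TField n 0 r), IsTorsionFreeOn Γ Ω → SmoothOn K Ω → ∀ y ∈ Ω,
      ∀ (U : Fin 0 → TIdx n) (L : Fin (r + m) → TIdx n),
      thomasDPow Γ r K m y U L - thomasDPow Γ r K m y U (L ∘ Equiv.swap i j)
        = evalTerms F Γ K y U L := by
  induction m with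
  | zero => exact absurd hj (by omega)
  | succ m ih =>
    obtain ⟨i, hi⟩ := i
    obtain ⟨j, hj'⟩ := j
    simp only at hij hj
    subst hij
    rcases i with _ | i
    · obtain ⟨m, rfl⟩ : ∃ k, m = k + 1 := ⟨m - 1, by omega⟩
      exact ⟨commTerms r m, fun n hn Γ Ω K h hK y hy U L => eval_commTerms m hn h hy hK U L⟩
    · obtain ⟨F, hF⟩ := ih ⟨i, by omega⟩ ⟨i + 1, by omega⟩ rfl (by simp; omega)
      refine ⟨derivTerms F, fun n hn Γ Ω K h hK y hy U L => ?_⟩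
      rw [← thomasD_evalTerms F h hy hK]
      have hT := h.smooth_thomasDPow r hK m
      have h1 := thomasD_sum_perm (Γ := Γ) h.isOpen ((r : ℝ) - m) (Finset.univ : Finset Bool)
        (fun b => cond b 1 (-1)) (fun _ => thomasDPow Γ r K m)
        (fun b => cond b 1 (Equiv.swap (⟨i, by omega⟩ : Fin (r + m)) ⟨i + 1, by omega⟩))
        (fun _ _ => hT) hy U L
      have h2 : ∀ z ∈ Ω, (fun U L => ∑ b : Bool, (cond b 1 (-1) : ℝ) * thomasDPow Γ r K m z U
          (L ∘ (cond b 1 (Equiv.swap (⟨i, by omega⟩ : Fin (r + m)) ⟨i + 1, by omega⟩)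
            : Equiv.Perm (Fin (r + m)))))
          = evalTerms F Γ K z := by
        intro z hz
        funext U L
        rw [← hF n hn Γ Ω K h hK z hz U L]
        simp; ring
      rw [thomasD_congr h.isOpen _ hy h2] at h1
      have hl : (L ∘ liftPerm (1 : Equiv.Perm (Fin (r + m)))) = L := by
        funext i; refine Fin.cases ?_ (fun k => ?_) i <;> simp
      rw [h1, Fintype.sum_bool]
      simp only [cond_true, cond_false, hl, liftPerm_swap]
      simp only [one_mul, neg_mul, sub_eq_add_neg]
      rfl

/-- Linear relations between index permutations persist under the Thomas operator. -/
theorem thomasD_relation {p q : ℕ} (hΩ : IsOpen Ω) (w : ℝ) {ι : Type*} (s : Finset ι) (c : ι → ℝ)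
    (σ : ι → Equiv.Perm (Fin q)) {T : TField n p q} (hT : SmoothOn T Ω)
    (hrel : ∀ y ∈ Ω, ∀ U L, ∑ i ∈ s, c i * T y U (L ∘ σ i) = 0) :
    ∀ y ∈ Ω, ∀ U L, ∑ i ∈ s, c i * thomasD Γ w T y U (L ∘ liftPerm (σ i)) = 0 := by
  intro y hy U L
  have h2 : ∀ z ∈ Ω, (fun U L => ∑ i ∈ s, c i * T z U (L ∘ σ i)) = fun _ _ => 0 := fun z hz => by
    funext U L; exact hrel z hz U L
  rw [← thomasD_sum_perm hΩ w s c (fun _ => T) σ (fun _ _ => hT) hy,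
    thomasD_congr (S := fun _ _ _ => 0) hΩ w hy h2, thomasD_zero]

/-- The symmetry of `K` is inherited by `𝔻^m K`, whose last `r` indices are those of `K`. -/
theorem thomasDPow_swap (h : IsTorsionFreeOn Γ Ω) (hK : SmoothOn K Ω)
    (hsymm : ∀ y ∈ Ω, ∀ U L (i j : Fin r), K y U (L ∘ Equiv.swap i j) = K y U L) (m : ℕ)
    (i j : Fin (r + m)) (hi : m ≤ i) (hj : m ≤ j) :
    ∀ y ∈ Ω, ∀ U L, thomasDPow Γ r K m y U (L ∘ Equiv.swap i j) = thomasDPow Γ r K m y U L := by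
  induction m with
  | zero => exact fun y hy U L => hsymm y hy U L i j
  | succ m ih =>
    intro y hy U L
    obtain ⟨i', rfl⟩ : ∃ i' : Fin (r + m), i = i'.succ :=
      ⟨⟨i - 1, by omega⟩, by ext; simp; omega⟩
    obtain ⟨j', rfl⟩ : ∃ j' : Fin (r + m), j = j'.succ :=
      ⟨⟨j - 1, by omega⟩, by ext; simp; omega⟩
    have ih' := ih i' j' (by simpa using hi) (by simpa using hj)
    have h3 := thomasD_relation (Γ := Γ) h.isOpen ((r : ℝ) - m) (Finset.univ : Finset Bool)
      (fun b => cond b (-1) 1) (fun b => cond b 1 (Equiv.swap i' j'))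
      (h.smooth_thomasDPow r hK m) (fun y hy U L => by simp [ih' y hy U L]) y hy U L
    have hl : (L ∘ liftPerm (1 : Equiv.Perm (Fin (r + m)))) = L := by
      funext i; refine Fin.cases ?_ (fun k => ?_) i <;> simp
    rw [Fintype.sum_bool] at h3
    simp only [cond_true, cond_false, hl, liftPerm_swap] at h3
    have h4 : thomasDPow Γ r K (m + 1) = thomasD Γ (r - m) (thomasDPow Γ r K m) := rfl
    rw [h4]
    linarith

/-- The equation `𝔻_{(B} K_{C_1 ⋯ C_r)} = 0` is inherited by `𝔻^m 𝔻 K`; the innermost Thomas operator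
has index `m`. -/
theorem thomasDPow_killing (h : IsTorsionFreeOn Γ Ω) (hK : SmoothOn K Ω)
    (hkill : ∀ y ∈ Ω, ∀ U (L : Fin (r + 1) → TIdx n), thomasD Γ r K y U L
      + ∑ j : Fin r, thomasD Γ r K y U (L ∘ Equiv.swap 0 j.succ) = 0) (m : ℕ) :
    ∀ y ∈ Ω, ∀ U (L : Fin (r + (m + 1)) → TIdx n), thomasDPow Γ r K (m + 1) y U L
      + ∑ j : Fin r, thomasDPow Γ r K (m + 1) y U
          (L ∘ Equiv.swap (⟨m, by omega⟩ : Fin (r + (m + 1))) ⟨m + 1 + j, by omega⟩) = 0 := by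
  induction m with
  | zero =>
    intro y hy U L
    have h1 : thomasDPow Γ r K 1 = thomasD Γ r K := by
      simp [thomasDPow]
    have h2 : ∀ j : Fin r, (⟨0 + 1 + j, by omega⟩ : Fin (r + 1)) = j.succ := fun j => by
      ext; simp [add_comm]
    simp only [Nat.zero_add] at *
    rw [h1]
    simp only [h2]
    exact hkill y hy U L
  | succ m ih =>
    intro y hy U L
    have h3 := thomasD_relation (Γ := Γ) h.isOpen ((r : ℝ) - (m + 1 : ℕ))
      (Finset.univ : Finset (Option (Fin r))) (fun _ => 1)
      (fun o => o.elim 1 fun j =>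
        Equiv.swap (⟨m, by omega⟩ : Fin (r + (m + 1))) ⟨m + 1 + j, by omega⟩)
      (h.smooth_thomasDPow r hK (m + 1)) (fun y hy U L => by
        rw [Fintype.sum_option]; simpa using ih y hy U L) y hy U L
    have hl : (L ∘ liftPerm (1 : Equiv.Perm (Fin (r + (m + 1))))) = L := by
      funext i; refine Fin.cases ?_ (fun k => ?_) i <;> simp
    rw [Fintype.sum_option] at h3
    simp only [Option.elim_none, Option.elim_some, one_mul, hl, liftPerm_swap] at h3
    have h5 : ∀ j : Fin r, (⟨m + 1 + 1 + j, by omega⟩ : Fin (r + (m + 1 + 1)))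
        = (⟨m + 1 + j, by omega⟩ : Fin (r + (m + 1))).succ := fun j => by
      ext; simp; omega
    simp only [h5]
    exact h3

end Formulas

/-! ### The universal formula -/

section Universal

open Equiv

/-- The data to which a curvature formula is applied, for a tractor field satisfying the tractor
form `𝔻_{(B} K_{C_1 ⋯ C_r)} = 0` of the Killing equation near the point `y`. -/
structure KillingDatum (r : ℕ) where
  n : ℕ
  two_le : 2 ≤ n
  Γ : Coeffs n
  Ω : Set (Model n)
  torsionFree : IsTorsionFreeOn Γ Ω
  K : TField n 0 r
  smooth : SmoothOn K Ω
  symm : ∀ y ∈ Ω, ∀ U L (i j : Fin r), K y U (L ∘ swap i j) = K y U L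
  killing : ∀ y ∈ Ω, ∀ U (L : Fin (r + 1) → TIdx n), thomasD Γ r K y U L
      + ∑ j : Fin r, thomasD Γ r K y U (L ∘ swap 0 j.succ) = 0
  y : Model n
  mem : y ∈ Ω
  U : Fin 0 → TIdx n

/-- Families of tensors with `2 r` indices, one for each datum. A formula that is valid for all
connections and tractor fields is an identity in this rational vector space. -/
abbrev TensorFamily (r : ℕ) := (e : KillingDatum r) → (Fin (r + r) → TIdx e.n) → ℝ

variable {r : ℕ}

/-- Permutation of the indices of a family, split into the first and the last `r` positions. -/
def permFamily (r : ℕ) : Representation ℚ (Perm (Fin r ⊕ Fin r)) (TensorFamily r) where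
  toFun σ :=
    { toFun := fun Φ e L => Φ e (L ∘ finSumFinEquiv.permCongr σ)
      map_add' := fun _ _ => rfl
      map_smul' := fun _ _ => rfl }
  map_one' := by
    ext Φ e L
    change Φ e (L ∘ _) = Φ e L
    congr 1
    funext i; simp
  map_mul' σ τ := by
    ext Φ e L
    change Φ e (L ∘ _) = Φ e ((L ∘ _) ∘ _)
    congr 1
    funext i; simp

theorem permFamily_apply (σ : Perm (Fin r ⊕ Fin r)) (Φ : TensorFamily r) (e : KillingDatum r)
    (L : Fin (r + r) → TIdx e.n) :
    permFamily r σ Φ e L = Φ e (L ∘ finSumFinEquiv.permCongr σ) := rfl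

theorem permCongr_swap_sum (a b : Fin r ⊕ Fin r) :
    finSumFinEquiv.permCongr (swap a b) = swap (finSumFinEquiv a) (finSumFinEquiv b) := by
  rw [Equiv.permCongr_def, Equiv.symm_trans_swap_trans]

theorem youngAct_permFamily (Φ : TensorFamily r) (e : KillingDatum r)
    (L : Fin (r + r) → TIdx e.n) : youngAct (permFamily r) Φ e L = youngP (Φ e) L := by
  have h1 : ∀ (Φ : TensorFamily r) L, symInl (permFamily r) Φ e L = symFirst (Φ e) L := by
    intro Φ L
    rw [symInl_apply, symFirst, Pi.smul_apply, Pi.smul_apply, Finset.sum_apply, Finset.sum_apply,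
      Rat.smul_def]
    push_cast
    congr 1
    refine Finset.sum_congr rfl fun σ _ => ?_
    rw [permFamily_apply]
    congr 1
    funext i
    refine Fin.addCases (fun i => ?_) (fun i => ?_) i <;> simp [-Fin.natAdd_eq_addNat]
  have h2 : ∀ (Φ : TensorFamily r) L, symInr (permFamily r) Φ e L = symLast (Φ e) L := by
    intro Φ L
    rw [symInr_apply, symLast, Pi.smul_apply, Pi.smul_apply, Finset.sum_apply, Finset.sum_apply,
      Rat.smul_def]
    push_cast
    congr 1
    refine Finset.sum_congr rfl fun σ _ => ?_
    rw [permFamily_apply]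
    congr 1
    funext i
    refine Fin.addCases (fun i => ?_) (fun i => ?_) i <;> simp [-Fin.natAdd_eq_addNat]
  have h3 : ∀ l : List (Fin r), l.foldr (skewAct (permFamily r)) Φ e = l.foldr skewPair (Φ e) := by
    intro l
    induction l with
    | nil => rfl
    | cons i l ih =>
      funext L
      rw [List.foldr_cons, List.foldr_cons, ← ih, skewAct, skewPair, Pi.smul_apply, Pi.smul_apply,
        Pi.sub_apply, Pi.sub_apply, permFamily_apply, pairSwap, permCongr_swap_sum, Rat.smul_def,
        finSumFinEquiv_apply_left, finSumFinEquiv_apply_right]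
      push_cast
      ring
  rw [youngAct, h1, youngP]
  congr 1
  funext L
  rw [h2, h3]

/-- The families given by a curvature formula. -/
def formulaFamilies (r : ℕ) : Submodule ℚ (TensorFamily r) where
  carrier := {Φ | ∃ F : CurvFormula r, ∀ e L, Φ e L = F.eval e.Γ e.K e.y e.U L}
  zero_mem' := ⟨[], fun _ _ => rfl⟩
  add_mem' := by
    rintro Φ Ψ ⟨F, hF⟩ ⟨G, hG⟩
    refine ⟨F ++ G, fun e L => ?_⟩
    rw [Pi.add_apply, Pi.add_apply, hF, hG]
    simp [CurvFormula.eval]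
  smul_mem' := by
    rintro c Φ ⟨F, hF⟩
    refine ⟨F.map fun t => { t with coeff := c * t.coeff }, fun e L => ?_⟩
    rw [Pi.smul_apply, Pi.smul_apply, hF, Rat.smul_def]
    simp only [CurvFormula.eval, List.map_map]
    rw [← List.sum_map_mul_left]
    congr 1
    refine List.map_congr_left fun t _ => ?_
    simp only [CurvTerm.eval, Function.comp_apply]
    push_cast
    ring

theorem formulaFamilies_invariant (g : Perm (Fin r ⊕ Fin r)) :
    formulaFamilies r ≤ (formulaFamilies r).comap (permFamily r g) := by
  rintro Φ ⟨F, hF⟩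
  refine ⟨F.map fun t =>
    { t with
      slot := t.slot.trans (Equiv.optionCongr (finSumFinEquiv.permCongr g))
      contracted := t.contracted.imp fun s hs => by simp [hs] }, fun e L => ?_⟩
  rw [permFamily_apply, hF]
  simp only [CurvFormula.eval, List.map_map]
  congr 1
  refine List.map_congr_left fun t _ => ?_
  have he : ∀ (o : Option (Fin (r + r))) (C : TIdx e.n),
      (o.map (finSumFinEquiv.permCongr g)).elim C L
        = o.elim C (L ∘ finSumFinEquiv.permCongr g) := by
    rintro (_ | k) C <;> rfl
  simp only [CurvTerm.eval, Function.comp_apply, Equiv.trans_apply, Equiv.optionCongr_apply, he]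

/-- A formula with `r` Thomas operators, as a curvature formula. -/
def toCurvFormula (F : List (PartialTerm r r)) : CurvFormula r :=
  F.map fun t => ⟨t.a, t.b, t.order_eq, t.coeff, t.slot, t.contracted⟩

theorem eval_toCurvFormula (F : List (PartialTerm r r)) {n : ℕ} (Γ : Coeffs n) (K : TField n 0 r) :
    (toCurvFormula F).eval Γ K = evalTerms F Γ K := by
  funext y U L
  simp only [toCurvFormula, CurvFormula.eval, evalTerms, List.map_map]
  rfl

/-- The family `𝔻^r K`. -/
def derivFamily (r : ℕ) : TensorFamily r := fun e => thomasDPow e.Γ r e.K r e.y e.U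

/-- For `K` satisfying the Killing equation, `𝔻^r K` is an eigenvector of the Young map up to a
universal curvature formula. -/
theorem exists_formula_young (hr : 1 ≤ r) : ∃ F : CurvFormula r, ∀ (e : KillingDatum r) L,
    youngP (thomasDPow e.Γ r e.K r e.y e.U) L
      = (((r : ℝ) + 1) / 2 ^ r) * thomasDPow e.Γ r e.K r e.y e.U L
        + F.eval e.Γ e.K e.y e.U L := by
  obtain ⟨m, rfl⟩ : ∃ m, r = m + 1 := ⟨r - 1, by omega⟩
  have hmem := youngAct_sub_smul_mem (permFamily (m + 1)) (formulaFamilies (m + 1))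
    formulaFamilies_invariant (x := derivFamily (m + 1))
    (fun i j hij => by
      obtain ⟨F, hF⟩ := exists_terms_swap (m + 1) (m + 1) (Fin.castAdd (m + 1) i)
        (Fin.castAdd (m + 1) j) hij j.2
      refine ⟨toCurvFormula F, fun e L => ?_⟩
      rw [eval_toCurvFormula, ← hF e.n e.two_le e.Γ e.Ω e.K e.torsionFree e.smooth e.y e.mem e.U L,
        Pi.sub_apply, Pi.sub_apply, permFamily_apply, permCongr_swap_sum,
        finSumFinEquiv_apply_left, finSumFinEquiv_apply_left]
      rfl)
    (fun i j _ => by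
      refine ⟨[], fun e L => ?_⟩
      have h := thomasDPow_swap e.torsionFree e.smooth e.symm (m + 1) (Fin.natAdd (m + 1) i)
        (Fin.natAdd (m + 1) j) (by simp) (by simp) e.y e.mem e.U L
      rw [Pi.sub_apply, Pi.sub_apply, permFamily_apply, permCongr_swap_sum,
        finSumFinEquiv_apply_right, finSumFinEquiv_apply_right]
      exact sub_eq_zero.2 h.symm)
    (Fin.last m) (by
      refine ⟨[], fun e L => ?_⟩
      have h := thomasDPow_killing e.torsionFree e.smooth e.killing m e.y e.mem e.U L
      rw [Pi.add_apply, Pi.add_apply, Finset.sum_apply, Finset.sum_apply]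
      simp only [permFamily_apply, permCongr_swap_sum, finSumFinEquiv_apply_left,
        finSumFinEquiv_apply_right]
      exact h)
  obtain ⟨F, hF⟩ := hmem
  refine ⟨F, fun e L => ?_⟩
  have h := hF e L
  rw [Pi.sub_apply, Pi.sub_apply, Pi.smul_apply, Pi.smul_apply, youngAct_permFamily,
    Rat.smul_def, sub_eq_iff_eq_add'] at h
  have hc : ((((m + 1 : ℕ) + 1) / 2 ^ (m + 1) : ℚ) : ℝ) = ((m + 1 : ℕ) + 1) / 2 ^ (m + 1) := by
    push_cast; rfl
  rw [hc] at h
  exact h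

end Universal

/-! ### Contraction with the canonical tractor -/

section NoneCount

/-- The number of indices with value `none`, i.e. the number of contractions with the canonical
tractor `X`. -/
def noneCount {n : ℕ} {κ : Type*} [Fintype κ] (L : κ → TIdx n) : ℕ :=
  (Finset.univ.filter fun s => L s = none).card

variable {n p q : ℕ} {Γ : Coeffs n} {Ω : Set (Model n)} {T : TField n p q}

theorem noneCount_eq_sum {κ : Type*} [Fintype κ] (L : κ → TIdx n) :
    noneCount L = ∑ s, if L s = none then 1 else 0 := Finset.card_filter _ _

theorem noneCount_succ (L : Fin (q + 1) → TIdx n) :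
    noneCount L = (if L 0 = none then 1 else 0) + noneCount (Fin.tail L) := by
  rw [noneCount_eq_sum, noneCount_eq_sum, Fin.sum_univ_succ]; rfl

theorem noneCount_le_update (L : Fin q → TIdx n) (s : Fin q) (C : TIdx n) :
    noneCount L ≤ noneCount (Function.update L s C) + 1 := by
  refine le_trans (Finset.card_le_card fun t ht => ?_) (Finset.card_insert_le s _)
  by_cases hts : t = s
  · simp [hts]
  · simpa [hts] using ht

/-- Each contraction with `X` uses up one Thomas operator: if `X` annihilates every lower index
of `T`, then more than `m` contractions of `𝔻^m T` with `X` give zero. -/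
theorem thomasDPow_eq_zero (hΩ : IsOpen Ω) (w : ℝ)
    (hT : ∀ y ∈ Ω, ∀ U L, (∃ s, L s = none) → T y U L = 0) (m : ℕ) :
    ∀ y ∈ Ω, ∀ U L, m < noneCount L → thomasDPow Γ w T m y U L = 0 := by
  induction m with
  | zero =>
    intro y hy U L hL
    obtain ⟨s, hs⟩ := Finset.card_pos.1 hL
    exact hT y hy U L ⟨s, (Finset.mem_filter.1 hs).2⟩
  | succ m ih =>
    intro y hy U L hL
    rw [noneCount_succ] at hL
    rcases h0 : L 0 with _ | a
    · rw [h0, if_pos rfl] at hL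
      have hD : thomasDPow Γ w T (m + 1) y U L = (w - m) * thomasDPow Γ w T m y U (Fin.tail L) :=
        thomasD_none _ y U h0
      rw [hD, ih y hy U _ (by omega), mul_zero]
    · rw [h0, if_neg (by simp)] at hL
      have hD : thomasDPow Γ w T (m + 1) y U L
          = tractorNabla Γ (w - m) a (thomasDPow Γ w T m) y U (Fin.tail L) :=
        thomasD_some _ y U h0
      rw [hD, tractorNabla, pd_eq_zero a hΩ hy fun z hz => ih z hz U _ (by omega),
        ih y hy U _ (by omega)]
      have h1 : ∀ s C, thomasDPow Γ w T m y (Function.update U s C) (Fin.tail L) = 0 :=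
        fun s C => ih y hy _ _ (by omega)
      have h2 : ∀ s C, thomasDPow Γ w T m y U (Function.update (Fin.tail L) s C) = 0 :=
        fun s C => ih y hy _ _ (by have := noneCount_le_update (Fin.tail L) s C; omega)
      simp [h1, h2]

end NoneCount

/-! ### The tractor form of the Killing equation -/

section Killing

open Equiv

variable {n r : ℕ} {Γ : Coeffs n} {Ω : Set (Model n)} {k : Model n → (Fin r → Fin n) → ℝ}
  {y : Model n}

theorem tractorOf_some (y : Model n) (U : Fin 0 → TIdx n) (i : Fin r → Fin n) :
    tractorOf k y U (fun s => some (i s)) = k y i := by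
  simp [tractorOf]

theorem tractorOf_none (y : Model n) (U : Fin 0 → TIdx n) {L : Fin r → TIdx n}
    (hL : ∃ s, L s = none) : tractorOf k y U L = 0 := by
  obtain ⟨s, hs⟩ := hL
  rw [tractorOf, dif_neg]
  intro h
  have := h s
  simp [hs] at this

theorem exists_none_or_eq_some {κ : Type*} (L : κ → TIdx n) :
    (∃ s, L s = none) ∨ ∃ i : κ → Fin n, L = fun s => some (i s) := by
  by_cases h : ∃ s, L s = none
  · exact Or.inl h
  · right
    push Not at h
    choose i hi using fun s => Option.ne_none_iff_exists'.1 (h s)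
    exact ⟨i, funext hi⟩

theorem smooth_tractorOf (hk : ∀ i, ContDiffOn ℝ ∞ (fun y => k y i) Ω) :
    SmoothOn (tractorOf k) Ω := by
  intro U L
  rcases exists_none_or_eq_some L with h | ⟨i, rfl⟩
  · simp only [tractorOf_none _ U h]; exact contDiffOn_const
  · simp only [tractorOf_some]; exact hk i

theorem tractorOf_perm (hk : ∀ y ∈ Ω, ∀ i (σ : Perm (Fin r)), k y (i ∘ σ) = k y i) (hy : y ∈ Ω)
    (U : Fin 0 → TIdx n) (L : Fin r → TIdx n) (σ : Perm (Fin r)) :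
    tractorOf k y U (L ∘ σ) = tractorOf k y U L := by
  rcases exists_none_or_eq_some L with ⟨s, hs⟩ | ⟨i, rfl⟩
  · rw [tractorOf_none y U ⟨s, hs⟩, tractorOf_none y U ⟨σ.symm s, by simpa using hs⟩]
  · rw [tractorOf_some]
    exact (tractorOf_some y U (i ∘ σ)).trans (hk y hy i σ)

theorem thomasD_tractorOf_some (U : Fin 0 → TIdx n) (i : Fin (r + 1) → Fin n) :
    thomasD Γ r (tractorOf k) y U (fun s => some (i s)) = nablaTensor Γ (2 * r) k y i := by
  rw [thomasD_some (a := i 0) _ y U rfl, tractorNabla, nablaTensor]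
  have ht : Fin.tail (fun s => some (i s)) = fun s => some (Fin.tail i s) := rfl
  have hu : ∀ s c, Function.update (fun s => some (Fin.tail i s)) s (some c)
      = fun t => some (Function.update (Fin.tail i) s c t) := by
    intro s c; funext t
    by_cases hts : t = s
    · subst hts; simp
    · simp [hts]
  have hn : ∀ s, tractorOf k y U (Function.update (fun s => some (Fin.tail i s)) s none) = 0 :=
    fun s => tractorOf_none y U ⟨s, by simp⟩
  simp only [ht, tractorOf_some, Fintype.sum_option, hn, hu, mul_zero, zero_add,
    Finset.univ_eq_empty, Finset.sum_empty, add_zero, Nat.cast_zero, sub_zero]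
  rw [← two_mul]
  rfl

theorem thomasD_tractorOf_none (hΩ : IsOpen Ω) (hy : y ∈ Ω) (U : Fin 0 → TIdx n)
    (i : Fin r → Fin n) (j : Fin r) {L : Fin (r + 1) → TIdx n} (h0 : L 0 = some (i j))
    (hL : Fin.tail L = Function.update (fun s => some (i s)) j none) :
    thomasD Γ r (tractorOf k) y U L = -k y i := by
  rw [thomasD_some (a := i j) _ y U h0, tractorNabla, hL]
  have hz : ∀ z, tractorOf k z U (Function.update (fun s => some (i s)) j none) = 0 :=
    fun z => tractorOf_none z U ⟨j, by simp⟩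
  rw [pd_eq_zero _ hΩ hy fun z _ => hz z, hz y, Finset.sum_eq_single (s := Finset.univ) j]
  · rw [Function.update_self, Fintype.sum_eq_single (some (i j))]
    · have : Function.update (Function.update (fun s => some (i s)) j none) j (some (i j))
          = fun s => some (i s) := by
        rw [Function.update_idem]
        exact Function.update_eq_self j fun s => some (i s)
      rw [this, tractorOf_some]
      simp [tractorForm]
    · rintro (_ | c) hc
      · simp [tractorForm]
      · have : c ≠ i j := fun h => hc (by rw [h])
        simp [tractorForm, this]
  · intro s _ hs
    refine Finset.sum_eq_zero fun C _ => ?_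
    rw [tractorOf_none y U ⟨j, by simp [hs.symm]⟩, mul_zero]
  · simp

theorem decomposeFin_symm_eq (p : Fin (r + 1)) (σ : Perm (Fin r)) :
    Perm.decomposeFin.symm (p, σ) = swap 0 p * liftPerm σ := by
  ext i : 1
  refine Fin.cases ?_ (fun i => ?_) i <;> simp

/-- For a tensor symmetric in all indices but the first, symmetrisation reduces to the sum over
the transpositions with the first index. -/
theorem sum_perm_eq {ι : Type*} (f : (Fin (r + 1) → ι) → ℝ)
    (hf : ∀ L (σ : Perm (Fin r)), f (L ∘ liftPerm σ) = f L) (L : Fin (r + 1) → ι) :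
    ∑ σ : Perm (Fin (r + 1)), f (L ∘ σ)
      = r.factorial * (f L + ∑ j : Fin r, f (L ∘ swap 0 j.succ)) := by
  rw [← Equiv.sum_comp Perm.decomposeFin.symm, Fintype.sum_prod_type, Fin.sum_univ_succ]
  have h : ∀ (p : Fin (r + 1)) (σ : Perm (Fin r)),
      f (L ∘ (Perm.decomposeFin.symm (p, σ) : Perm (Fin (r + 1)))) = f (L ∘ swap 0 p) := by
    intro p σ
    rw [decomposeFin_symm_eq, Perm.coe_mul, ← Function.comp_assoc, hf]
  simp only [h, Finset.sum_const, Finset.card_univ, Fintype.card_perm, Fintype.card_fin,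
    nsmul_eq_mul, swap_self, Equiv.coe_refl, Function.comp_id]
  rw [mul_add, Finset.mul_sum]

theorem thomasD_tractorOf_perm (h : IsTorsionFreeOn Γ Ω)
    (hks : ∀ i, ContDiffOn ℝ ∞ (fun y => k y i) Ω)
    (hk : ∀ y ∈ Ω, ∀ i (σ : Perm (Fin r)), k y (i ∘ σ) = k y i) (hy : y ∈ Ω)
    (U : Fin 0 → TIdx n) (L : Fin (r + 1) → TIdx n) (σ : Perm (Fin r)) :
    thomasD Γ r (tractorOf k) y U (L ∘ liftPerm σ) = thomasD Γ r (tractorOf k) y U L := by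
  have h1 := thomasD_sum_perm (Γ := Γ) h.isOpen (r : ℝ) (Finset.univ : Finset Unit) (fun _ => 1)
    (fun _ => tractorOf k) (fun _ => σ) (fun _ _ => smooth_tractorOf hks) hy U L
  simp only [Finset.univ_unique, Finset.sum_singleton, one_mul] at h1
  rw [← h1]
  exact congrFun (congrFun (thomasD_congr h.isOpen _ hy fun z hz => by
    funext U L; exact tractorOf_perm hk hz U L σ) U) L

/-- The Killing equation implies `𝔻_{(B} K_{C_1 ⋯ C_r)} = 0`. -/
theorem thomasD_tractorOf_killing (h : IsTorsionFreeOn Γ Ω)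
    (hks : ∀ i, ContDiffOn ℝ ∞ (fun y => k y i) Ω)
    (hk : ∀ y ∈ Ω, ∀ i (σ : Perm (Fin r)), k y (i ∘ σ) = k y i) (hy : y ∈ Ω)
    (hkill : ∀ i, symAll (nablaTensor Γ (2 * r) k y) i = 0)
    (U : Fin 0 → TIdx n) (L : Fin (r + 1) → TIdx n) :
    thomasD Γ r (tractorOf k) y U L
      + ∑ j : Fin r, thomasD Γ r (tractorOf k) y U (L ∘ swap 0 j.succ) = 0 := by
  have hr0 : (r.factorial : ℝ) ≠ 0 := by exact_mod_cast r.factorial_ne_zero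
  have hs := sum_perm_eq _ (fun L σ => thomasD_tractorOf_perm h hks hk hy U L σ)
  rcases exists_none_or_eq_some L with ⟨s, hs'⟩ | ⟨i, rfl⟩
  · -- by symmetry the index `none` may be assumed to be the first one
    obtain ⟨M, hM0, hM⟩ : ∃ M : Fin (r + 1) → TIdx n, M 0 = none ∧
        ∑ σ : Perm (Fin (r + 1)), thomasD Γ r (tractorOf k) y U (L ∘ σ)
          = ∑ σ : Perm (Fin (r + 1)), thomasD Γ r (tractorOf k) y U (M ∘ σ) := by
      refine ⟨L ∘ swap 0 s, by simpa using hs', ?_⟩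
      exact (Fintype.sum_equiv (Equiv.mulLeft (swap 0 s)) _ _ fun σ => rfl).symm
    have key : thomasD Γ r (tractorOf k) y U M
        + ∑ j : Fin r, thomasD Γ r (tractorOf k) y U (M ∘ swap 0 j.succ) = 0 := by
      have hzero : ∀ N : Fin (r + 1) → TIdx n, 1 < noneCount N →
          thomasD Γ r (tractorOf k) y U N = 0 := by
        intro N hN
        have := thomasDPow_eq_zero (Γ := Γ) h.isOpen (r : ℝ)
          (fun y _ U L hL => tractorOf_none (k := k) y U hL) 1 y hy U N hN
        simpa [thomasDPow] using this
      rcases exists_none_or_eq_some (Fin.tail M) with ⟨t, ht⟩ | ⟨i, hi⟩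
      · have hcount : ∀ σ : Perm (Fin (r + 1)), 1 < noneCount (M ∘ σ) := by
          intro σ
          rw [noneCount, Finset.one_lt_card]
          refine ⟨σ.symm 0, ?_, σ.symm t.succ, ?_, ?_⟩
          · simpa using hM0
          · simpa [Fin.tail] using ht
          · exact fun h => (Fin.succ_ne_zero t).symm (σ.symm.injective h)
        rw [hzero M (by simpa using hcount 1)]
        simp [fun j : Fin r => hzero _ (hcount (swap 0 j.succ))]
      · have hj : ∀ j : Fin r, thomasD Γ r (tractorOf k) y U (M ∘ swap 0 j.succ) = -k y i := by
          intro j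
          refine thomasD_tractorOf_none h.isOpen hy U i j ?_ ?_
          · have := congrFun hi j
            simpa [Fin.tail] using this
          · funext t
            by_cases htj : t = j
            · subst htj; simp [Fin.tail, hM0]
            · have := congrFun hi t
              have hne : t.succ ≠ j.succ := fun h => htj (Fin.succ_injective _ h)
              simp only [Fin.tail, Function.comp_apply] at this ⊢
              rw [swap_apply_of_ne_of_ne (Fin.succ_ne_zero t) hne, this]
              simp [htj]
        rw [thomasD_none _ y U hM0, hi, tractorOf_some, Finset.sum_congr rfl fun j _ => hj j]
        simp
    have hL := hs L
    rw [hM, hs M, key, mul_zero] at hL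
    exact (mul_eq_zero.1 hL.symm).resolve_left hr0
  · have hL := hs fun s => some (i s)
    have h1 := hkill i
    rw [symAll] at h1
    have h2 := (mul_eq_zero.1 h1).resolve_left
      (inv_ne_zero (by exact_mod_cast (r + 1).factorial_ne_zero))
    have h3 : ∑ σ : Perm (Fin (r + 1)),
        thomasD Γ r (tractorOf k) y U ((fun s => some (i s)) ∘ σ) = 0 := by
      rw [← h2]
      exact Finset.sum_congr rfl fun σ _ => thomasD_tractorOf_some U (i ∘ σ)
    rw [h3] at hL
    exact (mul_eq_zero.1 hL.symm).resolve_left hr0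

end Killing

/-! ### Recovering the Killing equation -/

section Converse

open Equiv

variable {n r : ℕ}

/-- The indices `none, …, none, g 0, …, g r`, with `m` entries `none` in front. -/
def padNone (g : Fin (r + 1) → TIdx n) : (m : ℕ) → Fin (r + (m + 1)) → TIdx n
  | 0 => g
  | m + 1 => Fin.cons none (padNone g m)

theorem noneCount_padNone (g : Fin (r + 1) → TIdx n) (m : ℕ) : m ≤ noneCount (padNone g m) := by
  induction m with
  | zero => exact Nat.zero_le _
  | succ m ih =>
    have h := noneCount_succ (padNone g (m + 1))
    have h0 : padNone g (m + 1) 0 = none := rfl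
    have ht : Fin.tail (padNone g (m + 1)) = padNone g m := Fin.tail_cons _ _
    rw [h0, ht, if_pos rfl] at h
    change m + 1 ≤ noneCount (padNone g (m + 1))
    omega

theorem padNone_swap (g : Fin (r + 1) → TIdx n) (m : ℕ) (j : Fin r) :
    padNone (g ∘ swap 0 j.succ) m
      = padNone g m ∘ swap (⟨m, by omega⟩ : Fin (r + (m + 1))) ⟨m + 1 + j, by omega⟩ := by
  induction m with
  | zero =>
    have h2 : (⟨0 + 1 + j, by omega⟩ : Fin (r + 1)) = j.succ := by ext; simp [add_comm]
    simp only [Nat.zero_add] at *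
    rw [h2]; rfl
  | succ m ih =>
    have h5 : (⟨m + 1 + 1 + j, by omega⟩ : Fin (r + (m + 1 + 1)))
        = (⟨m + 1 + j, by omega⟩ : Fin (r + (m + 1))).succ := by ext; simp; omega
    have h6 : (⟨m + 1, by omega⟩ : Fin (r + (m + 1 + 1)))
        = (⟨m, by omega⟩ : Fin (r + (m + 1))).succ := rfl
    rw [h5, h6, ← liftPerm_swap]
    funext s
    refine Fin.cases ?_ (fun s => ?_) s
    · rw [Function.comp_apply]
      rw [liftPerm_zero]; rfl
    · rw [Function.comp_apply]
      rw [liftPerm_succ]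
      exact congrFun ih s

/-- Contracting the first `r - 1` indices of `𝔻^r K` with `X` gives a multiple of `𝔻 K`. -/
theorem thomasDPow_padNone {Γ : Coeffs n} (K : TField n 0 r) (m : ℕ) (hm : m + 1 ≤ r) :
    ∃ c : ℝ, c ≠ 0 ∧ ∀ y U g,
      thomasDPow Γ r K (m + 1) y U (padNone g m) = c * thomasD Γ r K y U g := by
  induction m with
  | zero => exact ⟨1, one_ne_zero, fun y U g => by simp [thomasDPow, padNone]⟩
  | succ m ih =>
    obtain ⟨c, hc, h⟩ := ih (by omega)
    refine ⟨((r : ℝ) - (m + 1 : ℕ)) * c, mul_ne_zero ?_ hc, fun y U g => ?_⟩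
    · have : ((m + 1 : ℕ) : ℝ) + 1 ≤ r := by exact_mod_cast hm
      intro h0; linarith
    · have hD : thomasDPow Γ r K (m + 1 + 1) y U (padNone g (m + 1))
          = (r - (m + 1 : ℕ)) * thomasDPow Γ r K (m + 1) y U (padNone g m) :=
        thomasD_none _ y U rfl
      rw [hD, h, mul_assoc]

/-- Skew-symmetrisations in disjoint pairs commute, so that the result of all of them is skew in each
pair. -/
theorem foldr_skewPair_swap {ι : Type*} (T : (Fin (r + r) → ι) → ℝ) (l : List (Fin r)) (i : Fin r)
    (hi : i ∈ l) (L : Fin (r + r) → ι) :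
    l.foldr skewPair T (L ∘ swap (Fin.castAdd r i) (Fin.natAdd r i)) = -l.foldr skewPair T L := by
  induction l generalizing L with
  | nil => simp at hi
  | cons j l ih =>
    rw [List.foldr_cons]
    by_cases hij : i = j
    · subst hij
      simp only [skewPair, Function.comp_assoc, ← Perm.coe_mul, swap_mul_self, Perm.coe_one,
        Function.comp_id]
      ring
    · have hil : i ∈ l := (List.mem_cons.1 hi).resolve_left hij
      have hcomm : swap (Fin.castAdd r i) (Fin.natAdd r i) * swap (Fin.castAdd r j) (Fin.natAdd r j)
          = swap (Fin.castAdd r j) (Fin.natAdd r j)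
            * swap (Fin.castAdd r i) (Fin.natAdd r i) := by
        have h1 : Fin.castAdd r j ≠ Fin.castAdd r i := fun h => hij (by
          rw [Fin.ext_iff] at h ⊢; simpa using h.symm)
        have h2 : Fin.natAdd r j ≠ Fin.natAdd r i := fun h => hij (by
          rw [Fin.ext_iff] at h ⊢; simpa using h.symm)
        have h3 : ∀ i j : Fin r, Fin.castAdd r i ≠ Fin.natAdd r j := fun i j h => by
          rw [Fin.ext_iff] at h; simp at h; omega
        rw [mul_swap_eq_swap_mul, swap_apply_of_ne_of_ne h1 (h3 _ _),
          swap_apply_of_ne_of_ne (h3 _ _).symm h2]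
      simp only [skewPair]
      rw [ih hil, Function.comp_assoc, ← Perm.coe_mul, hcomm, Perm.coe_mul, ← Function.comp_assoc,
        ih hil]
      ring

theorem youngP_eq_sum {ι : Type*} (T : (Fin (r + r) → ι) → ℝ) (L : Fin (r + r) → ι) :
    youngP T L = (r.factorial : ℝ)⁻¹ * ∑ σ : Perm (Fin r), (r.factorial : ℝ)⁻¹ *
      ∑ τ : Perm (Fin r), (List.finRange r).foldr skewPair T
        (L ∘ finSumFinEquiv.permCongr (Perm.sumCongr σ τ)) := by
  rw [youngP, symFirst]
  congr 1
  refine Finset.sum_congr rfl fun σ _ => ?_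
  rw [symLast]
  congr 1
  refine Finset.sum_congr rfl fun τ _ => ?_
  refine congrArg _ (funext fun i => ?_)
  refine Fin.addCases (fun i => ?_) (fun i => ?_) i <;> simp [-Fin.natAdd_eq_addNat]

/-- A tensor in the image of the Young map vanishes on symmetrisation over the second group of
indices together with one index of the first: the skew-symmetrisation in one of the pairs is
absorbed. -/
theorem sum_youngP_padNone {m : ℕ} (T : (Fin (m + 1 + (m + 1)) → TIdx n) → ℝ)
    (g : Fin (m + 1 + 1) → TIdx n) :
    ∑ π : Perm (Fin (m + 1 + 1)), youngP T (padNone (g ∘ π) m) = 0 := by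
  simp only [youngP_eq_sum]
  rw [← Finset.mul_sum, Finset.sum_comm]
  refine mul_eq_zero_of_right _ (Finset.sum_eq_zero fun σ _ => ?_)
  rw [← Finset.mul_sum, Finset.sum_comm]
  refine mul_eq_zero_of_right _ (Finset.sum_eq_zero fun τ _ => ?_)
  set Φ := (List.finRange (m + 1)).foldr skewPair T
  set i : Fin (m + 1) := σ.symm (Fin.last m) with hi
  set j : Fin (m + 1) := τ i with hj
  set h := finSumFinEquiv.permCongr (Perm.sumCongr σ τ) with hh
  have hswap : swap (⟨m, by omega⟩ : Fin (m + 1 + (m + 1))) ⟨m + 1 + j, by omega⟩ * h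
      = h * swap (Fin.castAdd (m + 1) i) (Fin.natAdd (m + 1) i) := by
    rw [mul_swap_eq_swap_mul]
    congr 2
    · rw [hh, permCongr_apply, finSumFinEquiv_symm_apply_castAdd]
      simp [hi, Fin.ext_iff]
    · rw [hh, permCongr_apply, finSumFinEquiv_symm_apply_natAdd]
      simp [hj, Fin.ext_iff, -Fin.natAdd_eq_addNat]
  have hneg : ∀ π : Perm (Fin (m + 1 + 1)),
      Φ (padNone (g ∘ (π * swap 0 j.succ : Perm _)) m ∘ h) = -Φ (padNone (g ∘ π) m ∘ h) := by
    intro π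
    rw [Perm.coe_mul, ← Function.comp_assoc, padNone_swap, Function.comp_assoc, ← Perm.coe_mul,
      hswap, Perm.coe_mul, ← Function.comp_assoc]
    exact foldr_skewPair_swap T _ i (List.mem_finRange i) _
  have hsum := Equiv.sum_comp (Equiv.mulRight (swap (0 : Fin (m + 1 + 1)) j.succ))
    fun π => Φ (padNone (g ∘ π) m ∘ h)
  simp only [Equiv.coe_mulRight, hneg, Finset.sum_neg_distrib] at hsum
  linarith

/-- A curvature formula vanishes on `r - 1` contractions with `X`: it has only `r - 2` Thomas
operators to use up. -/
theorem eval_eq_zero_of_noneCount (F : CurvFormula r) (hn : 2 ≤ n) {Γ : Coeffs n}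
    {Ω : Set (Model n)} (h : IsTorsionFreeOn Γ Ω) {K : TField n 0 r}
    (hK : ∀ y ∈ Ω, ∀ U L, (∃ s, L s = none) → K y U L = 0) {y : Model n} (hy : y ∈ Ω)
    (U : Fin 0 → TIdx n) (L : Fin (r + r) → TIdx n) (hL : r ≤ noneCount L + 1) :
    F.eval Γ K y U L = 0 := by
  rw [CurvFormula.eval]
  refine List.sum_eq_zero fun x hx => ?_
  obtain ⟨t, -, rfl⟩ := List.mem_map.1 hx
  rw [CurvTerm.eval]
  refine mul_eq_zero_of_right _ (Finset.sum_eq_zero fun C _ => ?_)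
  set M : Fin (3 + t.a) ⊕ Fin (r + t.b) → TIdx n := fun x => (t.slot x).elim C L with hM
  have h1 : noneCount L ≤ noneCount M := by
    refine Finset.card_le_card_of_injOn (fun s => t.slot.symm (some s)) ?_ ?_
    · intro s hs
      have : L s = none := by simpa using hs
      simp [hM, this]
    · intro s _ s' _ hss
      simpa using hss
  have h2 : noneCount M = noneCount (fun s => M (Sum.inl s)) + noneCount fun s => M (Sum.inr s) := by
    simp only [noneCount_eq_sum, Fintype.sum_sum_type]
  have h3 := t.order_eq
  by_cases ha : t.a < noneCount fun s => M (Sum.inl s)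
  · have : thomasDPow Γ (-2) (wCurvature Γ) t.a y (fun _ => C) (fun s => M (Sum.inl s)) = 0 :=
      thomasDPow_eq_zero h.isOpen _ (fun y hy U L hL => h.wCurvature_none hn hy U L hL) t.a y hy _ _
        ha
    exact mul_eq_zero_of_left this _
  · have : thomasDPow Γ r K t.b y U (fun s => M (Sum.inr s)) = 0 :=
      thomasDPow_eq_zero h.isOpen _ hK t.b y hy _ _ (by omega)
    exact mul_eq_zero_of_right _ this

end Converse

section Characterisation

variable {n r : ℕ}

/-- The characterisation of Killing tensors in a coordinate domain. -/
theorem killing_iff_splitting {F : CurvFormula r} (hr : 1 ≤ r)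
    (hF : ∀ (e : KillingDatum r) L, youngP (thomasDPow e.Γ r e.K r e.y e.U) L
      = (((r : ℝ) + 1) / 2 ^ r) * thomasDPow e.Γ r e.K r e.y e.U L
        + F.eval e.Γ e.K e.y e.U L)
    (hn : 2 ≤ n) {Γ : Coeffs n} {Ω : Set (Model n)} (h : IsTorsionFreeOn Γ Ω)
    {k : Model n → (Fin r → Fin n) → ℝ} (hks : ∀ i, ContDiffOn ℝ ∞ (fun y => k y i) Ω)
    (hk : ∀ y ∈ Ω, ∀ i (σ : Equiv.Perm (Fin r)), k y (i ∘ σ) = k y i) :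
    (∀ y ∈ Ω, ∀ i, symAll (nablaTensor Γ (2 * r) k y) i = 0) ↔
      ∀ y ∈ Ω, ∀ (U : Fin 0 → TIdx n) (L : Fin (r + r) → TIdx n),
        splitting Γ k y U L
          = (((r : ℝ) + 1) / 2 ^ r) * thomasDPow Γ r (tractorOf k) r y U L
            + F.eval Γ (tractorOf k) y U L := by
  constructor
  · intro hkill y hy U L
    exact hF
      { n := n, two_le := hn, Γ := Γ, Ω := Ω, torsionFree := h, K := tractorOf k
        smooth := smooth_tractorOf hks
        symm := fun y hy U L i j => tractorOf_perm hk hy U L _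
        killing := fun y hy U L => thomasD_tractorOf_killing h hks hk hy (hkill y hy) U L
        y := y, mem := hy, U := U } L
  · intro hs y hy i
    obtain ⟨m, rfl⟩ : ∃ m, r = m + 1 := ⟨r - 1, by omega⟩
    set U : Fin 0 → TIdx n := fun _ => none
    obtain ⟨c, hc, hD⟩ := thomasDPow_padNone (Γ := Γ) (tractorOf k) m le_rfl
    have hsum := sum_youngP_padNone (thomasDPow Γ (m + 1 : ℕ) (tractorOf k) (m + 1) y U)
      fun s => some (i s)
    have hterm : ∀ π : Equiv.Perm (Fin (m + 1 + 1)),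
        youngP (thomasDPow Γ (m + 1 : ℕ) (tractorOf k) (m + 1) y U)
            (padNone ((fun s => some (i s)) ∘ π) m)
          = (((m + 1 : ℕ) : ℝ) + 1) / 2 ^ (m + 1) * c
            * nablaTensor Γ (2 * (m + 1 : ℕ)) k y (i ∘ π) := by
      intro π
      have h1 := hs y hy U (padNone ((fun s => some (i s)) ∘ π) m)
      rw [splitting, hD, eval_eq_zero_of_noneCount F hn h
        (fun y _ U L hL => tractorOf_none y U hL) hy U _
        (Nat.succ_le_succ (noneCount_padNone _ m)), add_zero] at h1
      rw [h1, mul_assoc]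
      congr 2
      exact thomasD_tractorOf_some U (i ∘ π)
    rw [Finset.sum_congr rfl fun π _ => hterm π, ← Finset.mul_sum] at hsum
    have h0 : (((m + 1 : ℕ) : ℝ) + 1) / 2 ^ (m + 1) * c ≠ 0 :=
      mul_ne_zero (by positivity) hc
    rw [symAll, (mul_eq_zero.1 hsum).resolve_left h0, mul_zero]

end Characterisation

/-! ### Change of connection within the projective class -/

section ProjectiveChange

/-- The coefficients `Γ'` and `Γ` of torsion-free connections on `Ω` are related by
`∇'_a v^b = ∇_a v^b + Υ_a v^b + Υ_c v^c δ_a^b`. -/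
structure IsProjectiveChangeOn {n : ℕ} (Γ Γ' : Coeffs n) (Υ : Fin n → Model n → ℝ)
    (Ω : Set (Model n)) : Prop where
  left : IsTorsionFreeOn Γ Ω
  right : IsTorsionFreeOn Γ' Ω
  smooth : ∀ b, ContDiffOn ℝ ∞ (Υ b) Ω
  eq : ∀ c a b, ∀ y ∈ Ω, Γ' c a b y
    = Γ c a b y + (if c = b then Υ a y else 0) + (if c = a then Υ b y else 0)

variable {n : ℕ} {Γ Γ' : Coeffs n} {Υ : Fin n → Model n → ℝ} {Ω : Set (Model n)} {y : Model n}

theorem traceForm_eq_of_projective (h : ∀ c a b, Γ' c a b y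
      = Γ c a b y + (if c = b then Υ a y else 0) + (if c = a then Υ b y else 0)) (a : Fin n) :
    traceForm Γ' a y = traceForm Γ a y + ((n : ℝ) + 1) * Υ a y := by
  simp only [traceForm, h, Finset.sum_add_distrib, if_true, Finset.sum_const,
    Finset.card_univ, Fintype.card_fin, nsmul_eq_mul, Finset.sum_ite_eq', Finset.mem_univ]
  ring

/-- The tensor `∇_a Υ_b - Υ_a Υ_b`. -/
def formDeriv (Γ : Coeffs n) (Υ : Fin n → Model n → ℝ) (a b : Fin n) (y : Model n) : ℝ :=
  pd a (Υ b) y - ∑ e, Γ e a b y * Υ e y - Υ a y * Υ b y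

/-- The projective change of the curvature, written with the full derivative `formDeriv`. -/
theorem IsProjectiveChangeOn.curvature_eq (h : IsProjectiveChangeOn Γ Γ' Υ Ω) (hy : y ∈ Ω)
    (a b c d : Fin n) : curvature Γ' a b c d y = curvature Γ a b c d y
      + (if c = d then pd a (Υ b) y - pd b (Υ a) y else 0)
      + (if c = b then formDeriv Γ Υ a d y else 0) - (if c = a then formDeriv Γ Υ b d y else 0) := by
  have hΓ : ∀ c a b, DifferentiableAt ℝ (Γ c a b) y := fun c a b =>
    differentiableAt_of_contDiffOn h.left.isOpen (h.left.smooth c a b) hy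
  have hΥ : ∀ b, DifferentiableAt ℝ (Υ b) y := fun b =>
    differentiableAt_of_contDiffOn h.left.isOpen (h.smooth b) hy
  have hpd : ∀ e c a b, pd e (Γ' c a b) y = pd e (Γ c a b) y
      + (if c = b then pd e (Υ a) y else 0) + (if c = a then pd e (Υ b) y else 0) := by
    intro e c a b
    rw [pd_congr e h.left.isOpen hy fun z hz => h.eq c a b z hz]
    have hadd : DifferentiableAt ℝ (fun z => Γ c a b z + Υ a z) y := (hΓ c a b).add (hΥ a)
    by_cases h1 : c = b <;> by_cases h2 : c = a
    · simp only [if_pos h1, if_pos h2]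
      rw [pd_add e hadd (hΥ _), pd_add e (hΓ c a b) (hΥ _)]
    · simp only [if_pos h1, if_neg h2, add_zero]
      rw [pd_add e (hΓ _ _ _) (hΥ _)]
    · simp only [if_neg h1, if_pos h2, add_zero]
      rw [pd_add e (hΓ _ _ _) (hΥ _)]
    · simp only [if_neg h1, if_neg h2, add_zero]
  have hq : ∀ a b, ∑ e, Γ' c a e y * Γ' e b d y = ∑ e, Γ c a e y * Γ e b d y
      + Γ c a d y * Υ b y + Γ c a b y * Υ d y + Υ a y * Γ c b d y
      + (if c = d then Υ a y * Υ b y else 0) + (if c = b then Υ a y * Υ d y else 0)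
      + (if c = a then ∑ e, Γ e b d y * Υ e y + 2 * (Υ b y * Υ d y) else 0) := by
    intro a b
    simp only [h.eq _ _ _ y hy, add_mul, mul_add, Finset.sum_add_distrib, mul_ite, ite_mul,
      mul_zero, zero_mul, Finset.sum_ite_eq, Finset.sum_ite_eq', Finset.mem_univ, if_true,
      Finset.sum_ite_irrel, Finset.sum_const_zero]
    have : ∑ e, Υ e y * Γ e b d y = ∑ e, Γ e b d y * Υ e y :=
      Finset.sum_congr rfl fun e _ => mul_comm _ _
    rw [this]
    split_ifs <;> ring
  simp only [curvature, Finset.sum_sub_distrib, hpd, hq, formDeriv, h.left.symm c b a y hy]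
  split_ifs <;> ring

/-- The projective Schouten tensor changes by `-(∇_a Υ_b - Υ_a Υ_b)`. -/
theorem IsProjectiveChangeOn.schouten_eq (h : IsProjectiveChangeOn Γ Γ' Υ Ω) (hn : 2 ≤ n)
    (hy : y ∈ Ω) (a b : Fin n) :
    schouten Γ' a b y = schouten Γ a b y - formDeriv Γ Υ a b y := by
  have hR : ∀ b d, ricci Γ' b d y = ricci Γ b d y + (pd d (Υ b) y - pd b (Υ d) y)
      + (1 - n) * formDeriv Γ Υ b d y := by
    intro b d
    simp only [ricci, h.curvature_eq hy, Finset.sum_add_distrib, Finset.sum_sub_distrib,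
      Finset.sum_ite_eq', Finset.mem_univ, if_true, Finset.sum_const, Finset.card_univ,
      Fintype.card_fin, nsmul_eq_mul]
    ring
  have hQ : formDeriv Γ Υ b a y - formDeriv Γ Υ a b y = pd b (Υ a) y - pd a (Υ b) y := by
    simp only [formDeriv, h.left.symm _ b a y hy]; ring
  have h2 : (2 : ℝ) ≤ n := by exact_mod_cast hn
  have h3 : ((n : ℝ) ^ 2 - 1) ≠ 0 := by nlinarith
  rw [schouten, schouten, hR, hR, div_eq_iff h3]
  linear_combination (1 - (n : ℝ)) * hQ
    - div_mul_cancel₀ ((n : ℝ) * ricci Γ a b y + ricci Γ b a y) h3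

/-- The matrix by which the lower tractor indices change: `(σ, μ_b)` becomes
`(σ, μ_b + Υ_b σ)`. -/
def scaleLow (Υ : Fin n → Model n → ℝ) (y : Model n) : TIdx n → TIdx n → ℝ
  | some b, none => Υ b y
  | B, C => if B = C then 1 else 0

/-- The matrix by which the upper tractor indices change: `(ν^b, ρ)` becomes
`(ν^b, ρ - Υ_b ν^b)`. -/
def scaleUp (Υ : Fin n → Model n → ℝ) (y : Model n) : TIdx n → TIdx n → ℝ
  | none, some b => -Υ b y
  | B, C => if B = C then 1 else 0

section Matrices

@[simp] theorem scaleLow_some_none (b : Fin n) : scaleLow Υ y (some b) none = Υ b y := rfl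
@[simp] theorem scaleLow_none_none : scaleLow Υ y none none = 1 := rfl
@[simp] theorem scaleLow_none_some (b : Fin n) : scaleLow Υ y none (some b) = 0 := rfl
@[simp] theorem scaleLow_some_some (b c : Fin n) :
    scaleLow Υ y (some b) (some c) = if b = c then 1 else 0 := by simp [scaleLow]
@[simp] theorem scaleUp_none_some (b : Fin n) : scaleUp Υ y none (some b) = -Υ b y := rfl
@[simp] theorem scaleUp_none_none : scaleUp Υ y none none = 1 := rfl
@[simp] theorem scaleUp_some_none (b : Fin n) : scaleUp Υ y (some b) none = 0 := rfl
@[simp] theorem scaleUp_some_some (b c : Fin n) :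
    scaleUp Υ y (some b) (some c) = if b = c then 1 else 0 := by simp [scaleUp]

theorem sum_scaleUp_scaleLow (C E : TIdx n) :
    ∑ D, scaleUp Υ y D C * scaleLow Υ y D E = if C = E then 1 else 0 := by
  rcases C with _ | c <;> rcases E with _ | e <;> simp [Fintype.sum_option]
  exact if_congr eq_comm rfl rfl

theorem sum_scaleLow_scaleUp (C E : TIdx n) :
    ∑ D, scaleLow Υ y C D * scaleUp Υ y E D = if C = E then 1 else 0 := by
  rcases C with _ | c <;> rcases E with _ | e <;> simp [Fintype.sum_option]

theorem smooth_scaleLow (hΥ : ∀ b, ContDiffOn ℝ ∞ (Υ b) Ω) (B C : TIdx n) :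
    ContDiffOn ℝ ∞ (fun y => scaleLow Υ y B C) Ω := by
  rcases B with _ | b <;> rcases C with _ | c
  · exact contDiffOn_const
  · exact contDiffOn_const
  · exact hΥ b
  · simp only [scaleLow_some_some]; exact contDiffOn_const

theorem smooth_scaleUp (hΥ : ∀ b, ContDiffOn ℝ ∞ (Υ b) Ω) (B C : TIdx n) :
    ContDiffOn ℝ ∞ (fun y => scaleUp Υ y B C) Ω := by
  rcases B with _ | b <;> rcases C with _ | c
  · exact contDiffOn_const
  · exact (hΥ c).neg
  · exact contDiffOn_const
  · simp only [scaleUp_some_some]; exact contDiffOn_const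

/-- The gauge transformation of the tractor connection on a lower index; the entry `(b, none)` is
the transformation of the Schouten tensor. -/
theorem IsProjectiveChangeOn.gauge_low (h : IsProjectiveChangeOn Γ Γ' Υ Ω) (hn : 2 ≤ n)
    (hy : y ∈ Ω) (a : Fin n) (B E : TIdx n) :
    pd a (fun z => scaleLow Υ z B E) y + Υ a y * scaleLow Υ y B E
        - ∑ C, tractorForm Γ' a C B y * scaleLow Υ y C E
      = -∑ C, scaleLow Υ y B C * tractorForm Γ a E C y := by
  have hP := h.schouten_eq hn hy
  rcases B with _ | b <;> rcases E with _ | e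
  · simp [Fintype.sum_option, tractorForm, pd_const]
  · simp [Fintype.sum_option, tractorForm, pd_const]
  · simp [Fintype.sum_option, tractorForm, h.eq _ _ _ y hy, add_mul, Finset.sum_add_distrib, hP,
      formDeriv]
    ring
  · simp [Fintype.sum_option, tractorForm, pd_const, h.eq _ _ _ y hy, eq_comm]
    split_ifs <;> ring

/-- The gauge transformation of the tractor connection on an upper index. -/
theorem IsProjectiveChangeOn.gauge_up (h : IsProjectiveChangeOn Γ Γ' Υ Ω) (hn : 2 ≤ n)
    (hy : y ∈ Ω) (a : Fin n) (C E : TIdx n) :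
    pd a (fun z => scaleUp Υ z C E) y + ∑ D, tractorForm Γ' a C D y * scaleUp Υ y D E
        - Υ a y * scaleUp Υ y C E
      = ∑ D, scaleUp Υ y C D * tractorForm Γ a D E y := by
  have hP := h.schouten_eq hn hy
  rcases C with _ | c <;> rcases E with _ | e
  · simp [Fintype.sum_option, tractorForm, pd_const]
  · simp [Fintype.sum_option, tractorForm, hP, formDeriv, pd_neg, mul_comm (Υ _ y) (Γ _ _ _ y)]
    ring
  · simp [Fintype.sum_option, tractorForm, pd_const]
  · simp [Fintype.sum_option, tractorForm, pd_const, h.eq _ _ _ y hy]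

end Matrices

/-! ### Equivariance of the Thomas operator -/

section Change

variable {p q : ℕ}

/-- The change of components of a tractor field with lower indices transformed by `scaleLow` and
upper indices transformed by the matrix `G`. -/
def changeAll (G : Model n → (Fin p → TIdx n) → (Fin p → TIdx n) → ℝ) (Υ : Fin n → Model n → ℝ)
    (T : TField n p q) : TField n p q := fun y U L =>
  ∑ U', G y U U' * ∑ L' : Fin q → TIdx n, (∏ s, scaleLow Υ y (L s) (L' s)) * T y U' L'

/-- The matrix `G` for fields without upper indices. -/
def upZero (n : ℕ) : Model n → (Fin 0 → TIdx n) → (Fin 0 → TIdx n) → ℝ := fun _ _ _ => 1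

/-- The matrix `G` for fields with one upper index. -/
def upOne (Υ : Fin n → Model n → ℝ) : Model n → (Fin 1 → TIdx n) → (Fin 1 → TIdx n) → ℝ :=
  fun y U U' => scaleUp Υ y (U 0) (U' 0)

theorem changeAll_upZero (T : TField n 0 q) : changeAll (upZero n) Υ T = changeScale Υ T := by
  funext y U L
  rw [changeAll, Fintype.sum_subsingleton _ U, upZero, one_mul, changeScale]
  refine Finset.sum_congr rfl fun L' _ => ?_
  congr 1

/-- The component of a field at a fixed first lower index. -/
def slice (T : TField n p (q + 1)) (C : TIdx n) : TField n p q := fun y U M =>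
  T y U (Fin.cons C M)

variable {G : Model n → (Fin p → TIdx n) → (Fin p → TIdx n) → ℝ}

/-- The change of components, carried out separately in the first lower index. -/
theorem changeAll_succ (T : TField n p (q + 1)) (y : Model n) (U : Fin p → TIdx n)
    (L : Fin (q + 1) → TIdx n) : changeAll G Υ T y U L
      = ∑ C, scaleLow Υ y (L 0) C * changeAll G Υ (slice T C) y U (Fin.tail L) := by
  simp only [changeAll, Finset.mul_sum]
  symm
  rw [Finset.sum_comm]
  refine Finset.sum_congr rfl fun U' _ => ?_
  symm
  rw [← Equiv.sum_comp (Fin.consEquiv fun _ => TIdx n), Fintype.sum_prod_type]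
  refine Finset.sum_congr rfl fun C _ => Finset.sum_congr rfl fun L' _ => ?_
  rw [Fin.prod_univ_succ]
  have hc : Fin.consEquiv (fun _ => TIdx n) (C, L') = Fin.cons C L' := rfl
  simp only [hc, Fin.cons_zero, Fin.cons_succ, slice, Fin.tail]
  ring

theorem smooth_slice {T : TField n p (q + 1)} (hT : SmoothOn T Ω) (C : TIdx n) :
    SmoothOn (slice T C) Ω := fun U M => hT U (Fin.cons C M)

theorem smooth_changeAll (hG : ∀ U U', ContDiffOn ℝ ∞ (fun y => G y U U') Ω)
    (hΥ : ∀ b, ContDiffOn ℝ ∞ (Υ b) Ω) {T : TField n p q} (hT : SmoothOn T Ω) :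
    SmoothOn (changeAll G Υ T) Ω := fun U L =>
  ContDiffOn.sum fun U' _ => (hG U U').mul (ContDiffOn.sum fun L' _ =>
    (contDiffOn_prod fun s _ => smooth_scaleLow hΥ (L s) (L' s)).mul (hT U' L'))

/-- The coupled derivative in terms of the slices of a field. -/
theorem tractorNabla_slice (w : ℝ) (a : Fin n) (T : TField n p (q + 1)) (y : Model n)
    (U : Fin p → TIdx n) (L : Fin (q + 1) → TIdx n) : tractorNabla Γ w a T y U L
      = tractorNabla Γ (w + 1) a (slice T (L 0)) y U (Fin.tail L)
        - ∑ C, tractorForm Γ a C (L 0) y * slice T C y U (Fin.tail L) := by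
  have hc : ∀ C, Function.update L 0 C = Fin.cons C (Fin.tail L) := fun C => by
    conv_lhs => rw [← Fin.cons_self_tail L]
    rw [Fin.update_cons_zero]
  have hs : ∀ s C, Function.update L (Fin.succ s) C
      = Fin.cons (L 0) (Function.update (Fin.tail L) s C) := fun s C => by
    conv_lhs => rw [← Fin.cons_self_tail L]
    rw [← Fin.cons_update]
  simp only [tractorNabla, slice, Fin.cons_self_tail, Fin.sum_univ_succ (n := q), hc, hs]
  push_cast
  simp only [Fin.tail]
  ring

theorem tractorNabla_sum_smul (hΩ : IsOpen Ω) (hy : y ∈ Ω) (w : ℝ) (a : Fin n) {ι : Type*}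
    [Fintype ι] {f : ι → Model n → ℝ} {S : ι → TField n p q} (hf : ∀ i, ContDiffOn ℝ ∞ (f i) Ω)
    (hS : ∀ i, SmoothOn (S i) Ω) (U : Fin p → TIdx n) (L : Fin q → TIdx n) :
    tractorNabla Γ w a (fun z U L => ∑ i, f i z * S i z U L) y U L
      = ∑ i, (pd a (f i) y * S i y U L + f i y * tractorNabla Γ w a (S i) y U L) := by
  have hfd : ∀ i, DifferentiableAt ℝ (f i) y := fun i =>
    differentiableAt_of_contDiffOn hΩ (hf i) hy
  have hSd : ∀ i, DifferentiableAt ℝ (fun z => S i z U L) y := fun i =>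
    differentiableAt_of_contDiffOn hΩ (hS i U L) hy
  have hp : pd a (fun z => ∑ i, f i z * S i z U L) y
      = ∑ i, (pd a (f i) y * S i y U L + f i y * pd a (fun z => S i z U L) y) := by
    rw [pd_sum a (F := fun i z => f i z * S i z U L) Finset.univ fun i _ => (hfd i).mul (hSd i)]
    exact Finset.sum_congr rfl fun i _ => pd_mul a (hfd i) (hSd i)
  have hU : ∑ s, ∑ C, tractorForm Γ a (U s) C y * ∑ i, f i y * S i y (Function.update U s C) L
      = ∑ i, f i y * ∑ s, ∑ C, tractorForm Γ a (U s) C y * S i y (Function.update U s C) L := by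
    simp only [Finset.mul_sum]
    symm
    rw [Finset.sum_comm]
    refine Finset.sum_congr rfl fun s _ => ?_
    rw [Finset.sum_comm]
    exact Finset.sum_congr rfl fun C _ => Finset.sum_congr rfl fun i _ => by ring
  have hL : ∑ s, ∑ C, tractorForm Γ a C (L s) y * ∑ i, f i y * S i y U (Function.update L s C)
      = ∑ i, f i y * ∑ s, ∑ C, tractorForm Γ a C (L s) y * S i y U (Function.update L s C) := by
    simp only [Finset.mul_sum]
    symm
    rw [Finset.sum_comm]
    refine Finset.sum_congr rfl fun s _ => ?_
    rw [Finset.sum_comm]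
    exact Finset.sum_congr rfl fun C _ => Finset.sum_congr rfl fun i _ => by ring
  simp only [tractorNabla]
  rw [hp, hU, hL, Finset.mul_sum, ← Finset.sum_add_distrib, ← Finset.sum_add_distrib,
    ← Finset.sum_sub_distrib]
  exact Finset.sum_congr rfl fun i _ => by ring

theorem changeAll_sub_sum {ι : Type*} [Fintype ι] (T : TField n p q) (c : ι → ℝ)
    (S : ι → TField n p q) (R : TField n p q) (y : Model n)
    (hR : ∀ U L, R y U L = T y U L - ∑ i, c i * S i y U L) (U : Fin p → TIdx n)
    (L : Fin q → TIdx n) :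
    changeAll G Υ R y U L
      = changeAll G Υ T y U L - ∑ i, c i * changeAll G Υ (S i) y U L := by
  simp only [changeAll, hR, mul_sub, Finset.sum_sub_distrib, Finset.mul_sum]
  congr 1
  symm
  rw [Finset.sum_comm]
  refine Finset.sum_congr rfl fun U' _ => ?_
  rw [Finset.sum_comm]
  exact Finset.sum_congr rfl fun L' _ => Finset.sum_congr rfl fun i _ => by ring

/-- Equivariance of the coupled connection, up to the term from the weight. The induction is on the
number of lower indices; the case without lower indices is a hypothesis. -/
theorem IsProjectiveChangeOn.tractorNabla_changeAll (h : IsProjectiveChangeOn Γ Γ' Υ Ω)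
    (hn : 2 ≤ n) (hG : ∀ U U', ContDiffOn ℝ ∞ (fun y => G y U U') Ω) (a : Fin n)
    (hbase : ∀ (w : ℝ) (T : TField n p 0), SmoothOn T Ω → ∀ y ∈ Ω, ∀ U L,
      tractorNabla Γ' w a (changeAll G Υ T) y U L
        = changeAll G Υ (tractorNabla Γ w a T) y U L + w * Υ a y * changeAll G Υ T y U L) :
    ∀ (w : ℝ) (T : TField n p q), SmoothOn T Ω → ∀ y ∈ Ω, ∀ U L,
      tractorNabla Γ' w a (changeAll G Υ T) y U L
        = changeAll G Υ (tractorNabla Γ w a T) y U L + w * Υ a y * changeAll G Υ T y U L := by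
  induction q with
  | zero => exact hbase
  | succ q ih =>
    intro w T hT y hy U L
    set M := Fin.tail L with hM
    have hsl : ∀ C, slice (changeAll G Υ T) C
        = fun z U M => ∑ E, scaleLow Υ z C E * changeAll G Υ (slice T E) z U M := by
      intro C
      funext z U M
      rw [slice, changeAll_succ]
      simp
    have hsm : ∀ E, SmoothOn (changeAll G Υ (slice T E)) Ω := fun E =>
      smooth_changeAll hG h.smooth (smooth_slice hT E)
    have hR : changeAll G Υ (tractorNabla Γ w a T) y U L
        = ∑ C, scaleLow Υ y (L 0) C * (changeAll G Υ (tractorNabla Γ (w + 1) a (slice T C)) y U M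
          - ∑ E, tractorForm Γ a E C y * changeAll G Υ (slice T E) y U M) := by
      rw [changeAll_succ]
      refine Finset.sum_congr rfl fun C _ => ?_
      congr 1
      refine changeAll_sub_sum _ _ _ _ y (fun U N => ?_) U M
      rw [slice, tractorNabla_slice]
      simp
    rw [tractorNabla_slice, hR, hsl (L 0), tractorNabla_sum_smul h.left.isOpen hy _ a
      (fun E => smooth_scaleLow h.smooth (L 0) E) hsm, changeAll_succ]
    simp only [hsl, ih (w + 1) _ (smooth_slice hT _) y hy, ← hM]
    have hg := h.gauge_low hn hy a (L 0)
    set X := fun E => changeAll G Υ (slice T E) y U M with hX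
    have h1 : ∑ C, tractorForm Γ' a C (L 0) y * ∑ E, scaleLow Υ y C E * X E
        = ∑ E, (∑ C, tractorForm Γ' a C (L 0) y * scaleLow Υ y C E) * X E := by
      simp only [Finset.mul_sum, Finset.sum_mul]
      rw [Finset.sum_comm]
      exact Finset.sum_congr rfl fun E _ => Finset.sum_congr rfl fun C _ => by ring
    have h2 : ∑ C, scaleLow Υ y (L 0) C * ∑ E, tractorForm Γ a E C y * X E
        = ∑ E, (∑ C, scaleLow Υ y (L 0) C * tractorForm Γ a E C y) * X E := by
      simp only [Finset.mul_sum, Finset.sum_mul]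
      rw [Finset.sum_comm]
      exact Finset.sum_congr rfl fun E _ => Finset.sum_congr rfl fun C _ => by ring
    change _ - ∑ C, tractorForm Γ' a C (L 0) y * ∑ E, scaleLow Υ y C E * X E = _
    simp only [mul_sub, Finset.sum_sub_distrib]
    change _ = _ - ∑ C, scaleLow Υ y (L 0) C * ∑ E, tractorForm Γ a E C y * X E + _
    rw [h1, h2, Finset.mul_sum, ← Finset.sum_sub_distrib, ← Finset.sum_sub_distrib,
      ← Finset.sum_add_distrib]
    refine Finset.sum_congr rfl fun E _ => ?_
    linear_combination X E * hg E

theorem IsProjectiveChangeOn.tractorNabla_upZero (h : IsProjectiveChangeOn Γ Γ' Υ Ω)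
    (a : Fin n) (w : ℝ) (T : TField n 0 0) (y : Model n) (hy : y ∈ Ω)
    (U : Fin 0 → TIdx n) (L : Fin 0 → TIdx n) :
    tractorNabla Γ' w a (changeAll (upZero n) Υ T) y U L
      = changeAll (upZero n) Υ (tractorNabla Γ w a T) y U L
        + w * Υ a y * changeAll (upZero n) Υ T y U L := by
  have hT : ∀ S : TField n 0 0, changeAll (upZero n) Υ S = S := by
    intro S
    funext y U L
    rw [changeAll, Fintype.sum_subsingleton _ U, Fintype.sum_subsingleton _ L]
    simp [upZero]
  have hn : ((n : ℝ) + 1) ≠ 0 := by positivity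
  simp only [hT, tractorNabla, traceForm_eq_of_projective (h.eq · · · y hy), Finset.univ_eq_empty, Finset.sum_empty,
    Nat.cast_zero]
  field_simp
  ring

theorem IsProjectiveChangeOn.tractorNabla_upOne (h : IsProjectiveChangeOn Γ Γ' Υ Ω) (hn : 2 ≤ n)
    (a : Fin n) (w : ℝ) (T : TField n 1 0) (hT : SmoothOn T Ω) (y : Model n) (hy : y ∈ Ω)
    (U : Fin 1 → TIdx n) (L : Fin 0 → TIdx n) :
    tractorNabla Γ' w a (changeAll (upOne Υ) Υ T) y U L
      = changeAll (upOne Υ) Υ (tractorNabla Γ w a T) y U L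
        + w * Υ a y * changeAll (upOne Υ) Υ T y U L := by
  have hc : ∀ S : TField n 1 0, changeAll (upOne Υ) Υ S
      = fun z U L => ∑ C, scaleUp Υ z (U 0) C * S z (fun _ => C) L := by
    intro S
    funext z U L
    rw [changeAll, ← Equiv.sum_comp (Equiv.funUnique (Fin 1) (TIdx n)).symm]
    refine Finset.sum_congr rfl fun C _ => ?_
    rw [Fintype.sum_subsingleton _ L, Finset.univ_eq_empty, Finset.prod_empty, one_mul]
    rfl
  have hV : ∀ (V : Fin 1 → TIdx n) (D : TIdx n), Function.update V 0 D = fun _ => D := by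
    intro V D
    funext i
    rw [Subsingleton.elim i 0, Function.update_self]
  have hd : ∀ C, DifferentiableAt ℝ (fun z => scaleUp Υ z (U 0) C) y := fun C =>
    differentiableAt_of_contDiffOn h.left.isOpen (smooth_scaleUp h.smooth _ _) hy
  have hTd : ∀ C : TIdx n, DifferentiableAt ℝ (fun z => T z (fun _ => C) L) y := fun C =>
    differentiableAt_of_contDiffOn h.left.isOpen (hT _ _) hy
  have hp : pd a (fun z => ∑ C, scaleUp Υ z (U 0) C * T z (fun _ => C) L) y
      = ∑ C, (pd a (fun z => scaleUp Υ z (U 0) C) y * T y (fun _ => C) L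
        + scaleUp Υ y (U 0) C * pd a (fun z => T z (fun _ => C) L) y) := by
    rw [pd_sum a (F := fun C z => scaleUp Υ z (U 0) C * T z (fun _ => C) L) Finset.univ
      fun C _ => (hd C).mul (hTd C)]
    exact Finset.sum_congr rfl fun C _ => pd_mul a (hd C) (hTd C)
  have hg := h.gauge_up hn hy a (U 0)
  rw [hc, hc]
  simp only [tractorNabla, hp, traceForm_eq_of_projective (h.eq · · · y hy), Finset.univ_eq_empty, Finset.sum_empty,
    Nat.cast_zero, Nat.cast_one, sub_zero, Fin.sum_univ_one, hV, Function.update_self]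
  have h1 : ∑ C, tractorForm Γ' a (U 0) C y * ∑ E, scaleUp Υ y C E * T y (fun _ => E) L
      = ∑ E, (∑ C, tractorForm Γ' a (U 0) C y * scaleUp Υ y C E) * T y (fun _ => E) L := by
    simp only [Finset.mul_sum, Finset.sum_mul]
    rw [Finset.sum_comm]
    exact Finset.sum_congr rfl fun E _ => Finset.sum_congr rfl fun C _ => by ring
  have h2 : ∑ C, scaleUp Υ y (U 0) C * ∑ E, tractorForm Γ a C E y * T y (fun _ => E) L
      = ∑ E, (∑ C, scaleUp Υ y (U 0) C * tractorForm Γ a C E y) * T y (fun _ => E) L := by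
    simp only [Finset.mul_sum, Finset.sum_mul]
    rw [Finset.sum_comm]
    exact Finset.sum_congr rfl fun E _ => Finset.sum_congr rfl fun C _ => by ring
  simp only [mul_add, Finset.sum_add_distrib]
  rw [h1, h2, Finset.mul_sum, Finset.mul_sum, ← Finset.sum_add_distrib, ← Finset.sum_add_distrib,
    ← Finset.sum_add_distrib, ← Finset.sum_add_distrib, ← Finset.sum_add_distrib,
    ← Finset.sum_add_distrib]
  have hn1 : ((n : ℝ) + 1) ≠ 0 := by positivity
  have hw : ∀ x : ℝ, (w + 0 - 1) / ((n : ℝ) + 1) * (((n : ℝ) + 1) * x) = (w - 1) * x := by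
    intro x; field_simp; ring
  refine Finset.sum_congr rfl fun E _ => ?_
  linear_combination T y (fun _ => E) L * hg E
    + scaleUp Υ y (U 0) E * T y (fun _ => E) L * hw (Υ a y)

end Change

end ProjectiveChange

/-! ### Projective invariance of the formulas -/

section Invariance

variable {n p q : ℕ} {Γ Γ' : Coeffs n} {Υ : Fin n → Model n → ℝ} {Ω : Set (Model n)} {y : Model n}
  {G : Model n → (Fin p → TIdx n) → (Fin p → TIdx n) → ℝ}

theorem changeAll_const_mul (c : ℝ) (T : TField n p q) (y : Model n) (U : Fin p → TIdx n)
    (L : Fin q → TIdx n) :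
    changeAll G Υ (fun y U L => c * T y U L) y U L = c * changeAll G Υ T y U L := by
  simp only [changeAll, Finset.mul_sum]
  exact Finset.sum_congr rfl fun U' _ => Finset.sum_congr rfl fun L' _ => by ring

theorem changeAll_apply_congr {T S : TField n p q} (h : T y = S y) (U : Fin p → TIdx n)
    (L : Fin q → TIdx n) : changeAll G Υ T y U L = changeAll G Υ S y U L := by
  simp only [changeAll, h]

/-- The Thomas operator is equivariant: the terms `w Υ_a` by which the coupled connections differ
are produced by the component `w Y_A` under the change of the new index. -/
theorem IsProjectiveChangeOn.thomasD_changeAll (w : ℝ)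
    (hnabla : ∀ a, ∀ (T : TField n p q), SmoothOn T Ω → ∀ y ∈ Ω, ∀ U L,
      tractorNabla Γ' w a (changeAll G Υ T) y U L
        = changeAll G Υ (tractorNabla Γ w a T) y U L + w * Υ a y * changeAll G Υ T y U L)
    {T : TField n p q} (hT : SmoothOn T Ω) (hy : y ∈ Ω) (U : Fin p → TIdx n)
    (L : Fin (q + 1) → TIdx n) :
    thomasD Γ' w (changeAll G Υ T) y U L = changeAll G Υ (thomasD Γ w T) y U L := by
  have hnone : slice (thomasD Γ w T) none = fun y U M => w * T y U M := by
    funext y U M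
    rw [slice, thomasD_none w _ _ (Fin.cons_zero _ _), Fin.tail_cons]
  have hsome : ∀ a, slice (thomasD Γ w T) (some a) = tractorNabla Γ w a T := by
    intro a
    funext y U M
    rw [slice, thomasD_some w _ _ (Fin.cons_zero _ _), Fin.tail_cons]
  rw [changeAll_succ, Fintype.sum_option, hnone, changeAll_const_mul]
  simp only [hsome]
  rcases hL : L 0 with _ | a
  · rw [thomasD_none w _ _ hL]
    simp
  · rw [thomasD_some w _ _ hL, hnabla a T hT y hy]
    simp only [scaleLow_some_none, scaleLow_some_some, ite_mul, one_mul, zero_mul,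
      Finset.sum_ite_eq, Finset.mem_univ, if_true]
    ring

theorem smooth_upZero (U U' : Fin 0 → TIdx n) :
    ContDiffOn ℝ ∞ (fun y => upZero n y U U') Ω := contDiffOn_const

theorem IsProjectiveChangeOn.smooth_upOne (h : IsProjectiveChangeOn Γ Γ' Υ Ω)
    (U U' : Fin 1 → TIdx n) : ContDiffOn ℝ ∞ (fun y => upOne Υ y U U') Ω :=
  smooth_scaleUp h.smooth _ _

theorem IsProjectiveChangeOn.thomasD_upZero (h : IsProjectiveChangeOn Γ Γ' Υ Ω) (hn : 2 ≤ n)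
    (w : ℝ) {T : TField n 0 q} (hT : SmoothOn T Ω) (hy : y ∈ Ω) (U : Fin 0 → TIdx n)
    (L : Fin (q + 1) → TIdx n) :
    thomasD Γ' w (changeAll (upZero n) Υ T) y U L
      = changeAll (upZero n) Υ (thomasD Γ w T) y U L :=
  thomasD_changeAll w (fun a => h.tractorNabla_changeAll hn smooth_upZero a
    (fun w T _ => h.tractorNabla_upZero a w T) w) hT hy U L

theorem IsProjectiveChangeOn.thomasD_upOne (h : IsProjectiveChangeOn Γ Γ' Υ Ω) (hn : 2 ≤ n)
    (w : ℝ) {T : TField n 1 q} (hT : SmoothOn T Ω) (hy : y ∈ Ω) (U : Fin 1 → TIdx n)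
    (L : Fin (q + 1) → TIdx n) :
    thomasD Γ' w (changeAll (upOne Υ) Υ T) y U L
      = changeAll (upOne Υ) Υ (thomasD Γ w T) y U L :=
  thomasD_changeAll w (fun a => h.tractorNabla_changeAll hn h.smooth_upOne a
    (h.tractorNabla_upOne hn a) w) hT hy U L

theorem IsProjectiveChangeOn.thomasDPow_upZero (h : IsProjectiveChangeOn Γ Γ' Υ Ω) (hn : 2 ≤ n)
    (w : ℝ) {T : TField n 0 q} (hT : SmoothOn T Ω) (m : ℕ) : ∀ y ∈ Ω,
    thomasDPow Γ' w (changeAll (upZero n) Υ T) m y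
      = changeAll (upZero n) Υ (thomasDPow Γ w T m) y := by
  induction m with
  | zero => exact fun y _ => rfl
  | succ m ih =>
    intro y hy
    funext U L
    rw [thomasDPow, thomasD_congr h.left.isOpen _ hy ih,
      h.thomasD_upZero hn _ (h.left.smooth_thomasDPow w hT m) hy, thomasDPow]

theorem IsProjectiveChangeOn.thomasDPow_upOne (h : IsProjectiveChangeOn Γ Γ' Υ Ω) (hn : 2 ≤ n)
    (w : ℝ) {T T' : TField n 1 q} (hT : SmoothOn T Ω)
    (hTT' : ∀ y ∈ Ω, T' y = changeAll (upOne Υ) Υ T y) (m : ℕ) : ∀ y ∈ Ω,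
    thomasDPow Γ' w T' m y = changeAll (upOne Υ) Υ (thomasDPow Γ w T m) y := by
  induction m with
  | zero => exact hTT'
  | succ m ih =>
    intro y hy
    funext U L
    rw [thomasDPow, thomasD_congr h.left.isOpen _ hy ih,
      h.thomasD_upOne hn _ (h.left.smooth_thomasDPow w hT m) hy, thomasDPow]

theorem changeAll_comp_perm (T : TField n 0 q) (σ : Equiv.Perm (Fin q)) (y : Model n)
    (U : Fin 0 → TIdx n) (L : Fin q → TIdx n) :
    changeAll (upZero n) Υ T y U (L ∘ σ)
      = changeAll (upZero n) Υ (fun y U L => T y U (L ∘ σ)) y U L := by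
  simp only [changeAll]
  refine Finset.sum_congr rfl fun U' _ => ?_
  congr 1
  rw [← Equiv.sum_comp (Equiv.arrowCongr σ.symm (Equiv.refl (TIdx n)))]
  refine Finset.sum_congr rfl fun L' _ => ?_
  have hL' : Equiv.arrowCongr σ.symm (Equiv.refl (TIdx n)) L' = L' ∘ σ := rfl
  rw [hL']
  congr 1
  exact Equiv.prod_comp σ fun s => scaleLow Υ y (L s) (L' s)

theorem changeAll_sub (T S : TField n p q) (y : Model n) (U : Fin p → TIdx n)
    (L : Fin q → TIdx n) :
    changeAll G Υ (fun y U L => T y U L - S y U L) y U L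
      = changeAll G Υ T y U L - changeAll G Υ S y U L := by
  simp only [changeAll, mul_sub, Finset.sum_sub_distrib]

/-- The `W`-curvature is a tractor: it is the commutator of Thomas operators on cotractors, and
cotractors with constant components suffice to recover it. -/
theorem IsProjectiveChangeOn.wCurvature_eq (h : IsProjectiveChangeOn Γ Γ' Υ Ω) (hn : 2 ≤ n)
    (hy : y ∈ Ω) : wCurvature Γ' y = changeAll (upOne Υ) Υ (wCurvature Γ) y := by
  have hv : ∀ L : Fin 3 → TIdx n, ![L 0, L 1, L 2] = L := fun L => by
    funext i; fin_cases i <;> rfl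
  let S : TIdx n → TField n 0 1 := fun E _ _ M => if M 0 = E then 1 else 0
  have hS : ∀ E, SmoothOn (S E) Ω := fun E _ _ => contDiffOn_const
  have hcomm : ∀ {Δ : Coeffs n}, IsTorsionFreeOn Δ Ω → ∀ {R : TField n 0 1}, SmoothOn R Ω →
      ∀ {y : Model n}, y ∈ Ω → ∀ (U : Fin 0 → TIdx n) (L : Fin 3 → TIdx n),
      thomasD Δ (0 - 1) (thomasD Δ 0 R) y U L
        - thomasD Δ (0 - 1) (thomasD Δ 0 R) y U (L ∘ Equiv.swap 0 1)
        = -∑ C, wCurvature Δ y (fun _ => C) L * R y U (fun _ => C) := by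
    intro Δ hΔ R hR y hy U L
    rw [hΔ.thomasD_comm hn hy hR 0 U L, Fin.sum_univ_one]
    congr 1
    refine Finset.sum_congr rfl fun C _ => ?_
    have h0 : ![L 0, L 1, L (Fin.succ (Fin.succ (0 : Fin 1)))] = L := hv L
    rw [h0]
    congr 2
    funext i
    rw [Subsingleton.elim i 0, Function.update_self]
  have key : ∀ (E : TIdx n) (L : Fin 3 → TIdx n),
      ∑ C, wCurvature Γ' y (fun _ => C) L * scaleLow Υ y C E
        = ∑ L' : Fin 3 → TIdx n, (∏ s, scaleLow Υ y (L s) (L' s))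
          * wCurvature Γ y (fun _ => E) L' := by
    intro E L
    let U : Fin 0 → TIdx n := Fin.elim0
    have hD : ∀ L : Fin 3 → TIdx n,
        thomasD Γ' (0 - 1) (thomasD Γ' 0 (changeAll (upZero n) Υ (S E))) y U L
          = changeAll (upZero n) Υ (thomasD Γ (0 - 1) (thomasD Γ 0 (S E))) y U L := by
      intro L
      rw [thomasD_congr h.left.isOpen (0 - 1) hy
          (S := changeAll (upZero n) Υ (thomasD Γ 0 (S E)))
          (fun z hz => by funext U L; exact h.thomasD_upZero hn 0 (hS E) hz U L),
        h.thomasD_upZero hn (0 - 1) (h.left.smooth_thomasD 0 (hS E)) hy]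
    have h1 := hcomm h.right
      (smooth_changeAll smooth_upZero h.smooth (hS E) : SmoothOn (changeAll (upZero n) Υ (S E)) Ω)
      hy U L
    rw [hD, hD, changeAll_comp_perm, ← changeAll_sub,
      changeAll_apply_congr (S := fun y U L => (-1) * ∑ C, wCurvature Γ y (fun _ => C) L
        * S E y U (fun _ => C)) (by
          funext U L
          rw [hcomm h.left (hS E) hy U L, neg_one_mul]), changeAll_const_mul, neg_one_mul,
      neg_inj] at h1
    have h2 : ∀ C, changeAll (upZero n) Υ (S E) y U (fun _ => C) = scaleLow Υ y C E := by
      intro C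
      rw [changeAll, Fintype.sum_subsingleton _ U,
        ← Equiv.sum_comp (Equiv.funUnique (Fin 1) (TIdx n)).symm]
      rcases E with _ | e <;> simp [upZero, S, uniqueElim]
    have h3 : ∀ L', ∑ C, wCurvature Γ y (fun _ => C) L' * S E y U (fun _ => C)
        = wCurvature Γ y (fun _ => E) L' := by
      intro L'
      simp [S]
    simp only [h2] at h1
    rw [← h1, changeAll, Fintype.sum_subsingleton _ U, upZero, one_mul]
    simp only [h3]
  funext U L
  obtain ⟨D, rfl⟩ : ∃ D, U = fun _ => D :=
    ⟨U 0, funext fun i => by rw [Subsingleton.elim i 0]⟩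
  have hsum : wCurvature Γ' y (fun _ => D) L
      = ∑ E, scaleUp Υ y D E * ∑ C, wCurvature Γ' y (fun _ => C) L * scaleLow Υ y C E := by
    simp only [Finset.mul_sum]
    rw [Finset.sum_comm]
    have : ∀ C, ∑ E, scaleUp Υ y D E * (wCurvature Γ' y (fun _ => C) L * scaleLow Υ y C E)
        = wCurvature Γ' y (fun _ => C) L * if C = D then 1 else 0 := by
      intro C
      rw [← sum_scaleLow_scaleUp (Υ := Υ) (y := y), Finset.mul_sum]
      exact Finset.sum_congr rfl fun E _ => by ring
    simp [this]
  rw [hsum, changeAll, ← Equiv.sum_comp (Equiv.funUnique (Fin 1) (TIdx n)).symm]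
  refine Finset.sum_congr rfl fun E _ => ?_
  rw [key]
  rfl

/-- Summing over the indices of two factors is summing over the values in the positions to which
`e` sends them. -/
theorem sum_sum_eq_sum_slots {A B Q : ℕ} {ι : Type*} [Fintype ι]
    (e : Fin A ⊕ Fin B ≃ Option (Fin Q)) (f : (Fin A ⊕ Fin B → ι) → ℝ) :
    ∑ X : Fin A → ι, ∑ Y : Fin B → ι, f (Sum.elim X Y)
      = ∑ E : ι, ∑ L : Fin Q → ι, f (fun x => (e x).elim E L) := by
  have h1 := Equiv.sum_comp (Equiv.sumArrowEquivProdArrow (Fin A) (Fin B) ι).symm f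
  have h2 := Equiv.sum_comp (Equiv.arrowCongr e.symm (Equiv.refl ι)) f
  have h3 := Equiv.sum_comp (Equiv.piOptionEquivProd (β := fun _ : Option (Fin Q) => ι)).symm
    fun Z => f (Equiv.arrowCongr e.symm (Equiv.refl ι) Z)
  rw [Fintype.sum_prod_type] at h1 h3
  refine h1.trans (h2.symm.trans (h3.symm.trans ?_))
  refine Finset.sum_congr rfl fun E _ => Finset.sum_congr rfl fun L _ => ?_
  congr 1
  funext x
  simp only [Equiv.arrowCongr_apply, Equiv.coe_refl, Equiv.symm_symm, Function.comp_apply, id]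
  rcases e x with _ | s <;> rfl

/-- Contraction is equivariant, as `scaleUp` is inverse to the transpose of `scaleLow`. -/
theorem contr_changeAll {A B Q : ℕ} (e : Fin A ⊕ Fin B ≃ Option (Fin Q)) (S : TField n 1 A)
    (R : TField n 0 B) (y : Model n) (U : Fin 0 → TIdx n) (L : Fin Q → TIdx n) :
    contr e (changeAll (upOne Υ) Υ S) (changeAll (upZero n) Υ R) y U L
      = changeAll (upZero n) Υ (contr e S R) y U L := by
  have hS : ∀ (C : TIdx n) (N : Fin A → TIdx n), changeAll (upOne Υ) Υ S y (fun _ => C) N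
      = ∑ D, scaleUp Υ y C D * ∑ X : Fin A → TIdx n, (∏ s, scaleLow Υ y (N s) (X s))
        * S y (fun _ => D) X := by
    intro C N
    rw [changeAll, ← Equiv.sum_comp (Equiv.funUnique (Fin 1) (TIdx n)).symm]
    rfl
  have hR : ∀ N : Fin B → TIdx n, changeAll (upZero n) Υ R y U N
      = ∑ Y : Fin B → TIdx n, (∏ s, scaleLow Υ y (N s) (Y s)) * R y U Y := by
    intro N
    rw [changeAll, Fintype.sum_subsingleton _ U, upZero, one_mul]
  have hslot : ∀ C D : TIdx n,
      (∑ X : Fin A → TIdx n,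
          (∏ s, scaleLow Υ y ((e (Sum.inl s)).elim C L) (X s)) * S y (fun _ => D) X)
        * (∑ Y : Fin B → TIdx n,
          (∏ s, scaleLow Υ y ((e (Sum.inr s)).elim C L) (Y s)) * R y U Y)
      = ∑ E, ∑ L' : Fin Q → TIdx n, scaleLow Υ y C E * (∏ s, scaleLow Υ y (L s) (L' s))
        * (S y (fun _ => D) (fun s => (e (Sum.inl s)).elim E L')
          * R y U (fun s => (e (Sum.inr s)).elim E L')) := by
    intro C D
    have h1 := sum_sum_eq_sum_slots e fun X : Fin A ⊕ Fin B → TIdx n =>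
      (∏ x, scaleLow Υ y ((e x).elim C L) (X x))
        * (S y (fun _ => D) (fun s => X (Sum.inl s)) * R y U (fun s => X (Sum.inr s)))
    have h2 : ∀ (E : TIdx n) (L' : Fin Q → TIdx n),
        ∏ x, scaleLow Υ y ((e x).elim C L) ((e x).elim E L')
          = scaleLow Υ y C E * ∏ s, scaleLow Υ y (L s) (L' s) := by
      intro E L'
      rw [Equiv.prod_comp e fun o => scaleLow Υ y (o.elim C L) (o.elim E L'),
        Fintype.prod_option]
      rfl
    simp only [h2] at h1
    rw [← h1, Finset.sum_mul_sum]
    refine Finset.sum_congr rfl fun X _ => Finset.sum_congr rfl fun Y _ => ?_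
    simp only [Fintype.prod_sum_type, Sum.elim_inl, Sum.elim_inr]
    ring
  have hC : ∀ D E : TIdx n, ∀ x : ℝ, ∑ C, scaleUp Υ y C D * (scaleLow Υ y C E * x)
      = if D = E then x else 0 := by
    intro D E x
    simp only [← mul_assoc, ← Finset.sum_mul, sum_scaleUp_scaleLow, ite_mul, one_mul, zero_mul]
  rw [changeAll, Fintype.sum_subsingleton _ U, upZero, one_mul]
  simp only [contr, hS, hR]
  calc _ = ∑ C, ∑ D, ∑ E, ∑ L' : Fin Q → TIdx n, scaleUp Υ y C D * (scaleLow Υ y C E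
        * ((∏ s, scaleLow Υ y (L s) (L' s)) *
        (S y (fun _ => D) (fun s => (e (Sum.inl s)).elim E L')
          * R y U (fun s => (e (Sum.inr s)).elim E L')))) := by
        refine Finset.sum_congr rfl fun C _ => ?_
        rw [Finset.sum_mul]
        refine Finset.sum_congr rfl fun D _ => ?_
        rw [mul_assoc, hslot C D, Finset.mul_sum]
        refine Finset.sum_congr rfl fun E _ => ?_
        rw [Finset.mul_sum]
        exact Finset.sum_congr rfl fun L' _ => by ring
    _ = ∑ D, ∑ E, ∑ L' : Fin Q → TIdx n, ∑ C, scaleUp Υ y C D * (scaleLow Υ y C E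
        * ((∏ s, scaleLow Υ y (L s) (L' s)) *
        (S y (fun _ => D) (fun s => (e (Sum.inl s)).elim E L')
          * R y U (fun s => (e (Sum.inr s)).elim E L')))) := by
        rw [Finset.sum_comm]
        refine Finset.sum_congr rfl fun D _ => ?_
        rw [Finset.sum_comm]
        refine Finset.sum_congr rfl fun E _ => ?_
        rw [Finset.sum_comm]
    _ = _ := by
        simp only [hC, Finset.sum_ite_irrel, Finset.sum_const_zero, Finset.sum_ite_eq,
          Finset.mem_univ, if_true, Finset.mul_sum]
        rw [Finset.sum_comm]

/-- Every formula of the admitted kind is projectively invariant. -/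
theorem IsProjectiveChangeOn.eval_changeScale {r : ℕ} (h : IsProjectiveChangeOn Γ Γ' Υ Ω)
    (hn : 2 ≤ n) (F : CurvFormula r) {K : TField n 0 r} (hK : SmoothOn K Ω) (hy : y ∈ Ω)
    (U : Fin 0 → TIdx n) (L : Fin (r + r) → TIdx n) :
    F.eval Γ' (changeScale Υ K) y U L = changeScale Υ (F.eval Γ K) y U L := by
  have hterm : ∀ t : CurvTerm r, t.eval Γ' (changeScale Υ K) y U L
      = changeScale Υ (t.eval Γ K) y U L := by
    intro t
    have hW := h.thomasDPow_upOne hn (-2) h.left.smooth_wCurvature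
      (fun z hz => h.wCurvature_eq hn hz) t.a y hy
    have hV := h.thomasDPow_upZero hn r hK t.b y hy
    rw [← changeAll_upZero, ← changeAll_upZero]
    have he : t.eval Γ K = fun y U L => (t.coeff : ℝ) * contr t.slot
        (thomasDPow Γ (-2) (wCurvature Γ) t.a) (thomasDPow Γ r K t.b) y U L := rfl
    rw [he, changeAll_const_mul, ← contr_changeAll]
    simp only [CurvTerm.eval, contr, hW, hV]
  simp only [← changeAll_upZero] at hterm ⊢
  induction F with
  | nil => simp [CurvFormula.eval, changeAll]
  | cons t F ih =>
    have hadd : changeAll (upZero n) Υ (CurvFormula.eval (t :: F) Γ K) y U L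
        = changeAll (upZero n) Υ (t.eval Γ K) y U L
          + changeAll (upZero n) Υ (CurvFormula.eval F Γ K) y U L := by
      simp only [changeAll, CurvFormula.eval, List.map_cons, List.sum_cons, mul_add,
        Finset.sum_add_distrib]
    rw [hadd, ← hterm t, ← ih]
    simp [CurvFormula.eval]

end Invariance

/-! ### Charts, coordinate fields and connection coefficients -/

section Charts

variable {n : ℕ} {M : Type*} [TopologicalSpace M] [ChartedSpace (Model n) M]
  {φ : OpenPartialHomeomorph M (Model n)} {x : M} {y : Model n}

theorem coordField_eq_mpullback (φ : OpenPartialHomeomorph M (Model n)) (b : Fin n) :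
    coordField φ b = VectorField.mpullback (𝓡 n) (𝓡 n) φ
      fun _ => (EuclideanSpace.single b 1 : Model n) := rfl

theorem contMDiffAt_chart (hφ : φ ∈ IsManifold.maximalAtlas (𝓡 n) ∞ M) (hx : x ∈ φ.source) :
    ContMDiffAt (𝓡 n) (𝓡 n) ∞ φ x :=
  contMDiffAt_of_mem_maximalAtlas hφ hx

theorem contMDiffAt_chart_symm (hφ : φ ∈ IsManifold.maximalAtlas (𝓡 n) ∞ M)
    (hy : y ∈ φ.target) : ContMDiffAt (𝓡 n) (𝓡 n) ∞ φ.symm y :=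
  contMDiffAt_symm_of_mem_maximalAtlas hφ hy

theorem mdifferentiable_chart (hφ : φ ∈ IsManifold.maximalAtlas (𝓡 n) ∞ M) :
    φ.MDifferentiable (𝓡 n) (𝓡 n) :=
  ⟨(contMDiffOn_of_mem_maximalAtlas hφ).mdifferentiableOn (by simp),
    (contMDiffOn_symm_of_mem_maximalAtlas hφ).mdifferentiableOn (by simp)⟩

theorem isInvertible_mfderiv_chart (hφ : φ ∈ IsManifold.maximalAtlas (𝓡 n) ∞ M)
    (hx : x ∈ φ.source) : (mfderiv (𝓡 n) (𝓡 n) φ x).IsInvertible :=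
  ⟨(mdifferentiable_chart hφ).mfderiv hx, rfl⟩

theorem isInvertible_mfderiv_chart_symm (hφ : φ ∈ IsManifold.maximalAtlas (𝓡 n) ∞ M)
    (hy : y ∈ φ.target) : (mfderiv (𝓡 n) (𝓡 n) φ.symm y).IsInvertible :=
  ⟨(mdifferentiable_chart hφ).symm.mfderiv hy, rfl⟩

theorem chartDeriv_coordField (hφ : φ ∈ IsManifold.maximalAtlas (𝓡 n) ∞ M) (hx : x ∈ φ.source)
    (b : Fin n) : chartDeriv φ x (coordField φ b x) = EuclideanSpace.single b 1 :=
  (isInvertible_mfderiv_chart hφ hx).self_apply_inverse _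

/-- The chart expression of a vector field is its pullback by the inverse of the chart. -/
theorem chartDeriv_symm_eq_inverse (hφ : φ ∈ IsManifold.maximalAtlas (𝓡 n) ∞ M)
    (hy : y ∈ φ.target) (v : TangentSpace (𝓡 n) (φ.symm y)) :
    chartDeriv φ (φ.symm y) v = (mfderiv (𝓡 n) (𝓡 n) φ.symm y).inverse v := by
  obtain ⟨v, rfl⟩ := (isInvertible_mfderiv_chart_symm hφ hy).bijective.2 v
  rw [(isInvertible_mfderiv_chart_symm hφ hy).inverse_apply_self]
  have h := (mdifferentiable_chart hφ).comp_symm_deriv hy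
  exact congrArg (fun f => f v) h

theorem coordVol_ne_zero (hφ : φ ∈ IsManifold.maximalAtlas (𝓡 n) ∞ M) (hx : x ∈ φ.source) :
    coordVol φ x ≠ 0 := by
  intro h
  have h1 : coordVol φ x (fun b => coordField φ b x) = 1 := by
    have : (fun b => chartDeriv φ x (coordField φ b x))
        = (EuclideanSpace.basisFun (Fin n) ℝ).toBasis := by
      funext b
      simp [chartDeriv_coordField hφ hx]
    rw [coordVol, AlternatingMap.compLinearMap_apply]
    exact (congrArg _ this).trans (Module.Basis.det_self _)
  rw [h] at h1
  simp at h1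

theorem SymTensorDensity.comp_perm {r : ℕ} {w : ℝ} (k : SymTensorDensity n M r w)
    (hφ : φ ∈ IsManifold.maximalAtlas (𝓡 n) ∞ M) (hy : y ∈ φ.target) (i : Fin r → Fin n)
    (σ : Equiv.Perm (Fin r)) : k.comp φ y (i ∘ σ) = k.comp φ y i :=
  k.symmetric _ _ (fun s => coordField φ (i s) (φ.symm y)) σ
    (coordVol_ne_zero hφ (φ.map_target hy))

variable [IsManifold (𝓡 n) ∞ M]

theorem contMDiffAt_coordField (hφ : φ ∈ IsManifold.maximalAtlas (𝓡 n) ∞ M)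
    (hx : x ∈ φ.source) (b : Fin n) :
    ContMDiffAt (𝓡 n) ((𝓡 n).prod 𝓘(ℝ, Model n)) ∞
      (fun z => (⟨z, coordField φ b z⟩ : TangentBundle (𝓡 n) M)) x := by
  rw [coordField_eq_mpullback]
  refine ContMDiffAt.mpullback_vectorField_preimage (n := ∞) ?_ (contMDiffAt_chart hφ hx)
    (isInvertible_mfderiv_chart hφ hx) (by simp)
  exact contMDiffAt_vectorSpace_iff_contDiffAt.2 contDiffAt_const

theorem mdifferentiableAt_coordField (hφ : φ ∈ IsManifold.maximalAtlas (𝓡 n) ∞ M)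
    (hx : x ∈ φ.source) (b : Fin n) :
    MDifferentiableAt (𝓡 n) ((𝓡 n).prod 𝓘(ℝ, Model n))
      (fun z => (⟨z, coordField φ b z⟩ : TangentBundle (𝓡 n) M)) x :=
  (contMDiffAt_coordField hφ hx b).mdifferentiableAt (by simp)

theorem contDiffAt_chartDeriv (hφ : φ ∈ IsManifold.maximalAtlas (𝓡 n) ∞ M)
    (hy : y ∈ φ.target) {V : ∀ x : M, TangentSpace (𝓡 n) x}
    (hV : ContMDiffAt (𝓡 n) ((𝓡 n).prod 𝓘(ℝ, Model n)) ∞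
      (fun z => (⟨z, V z⟩ : TangentBundle (𝓡 n) M)) (φ.symm y)) :
    ContDiffAt ℝ ∞ (fun z => chartDeriv φ (φ.symm z) (V (φ.symm z))) y := by
  have h := contMDiffAt_vectorSpace_iff_contDiffAt.1
    (ContMDiffAt.mpullback_vectorField_preimage (n := ∞) hV (contMDiffAt_chart_symm hφ hy)
      (isInvertible_mfderiv_chart_symm hφ hy) (by simp))
  refine h.congr_of_eventuallyEq ?_
  filter_upwards [φ.open_target.mem_nhds hy] with z hz
  exact chartDeriv_symm_eq_inverse hφ hz _

/-- The coordinate fields are cut off by a bump function, since a smooth connection is only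
assumed to map global smooth fields to smooth fields. -/
theorem contDiffOn_christoffel [T2Space M] (cov : AffineConn n M)
    [CovariantDerivative.ContMDiffCovariantDerivative cov ∞]
    (hφ : φ ∈ IsManifold.maximalAtlas (𝓡 n) ∞ M) (c a b : Fin n) :
    ContDiffOn ℝ ∞ (christoffel cov φ c a b) φ.target := by
  intro y hy
  refine ContDiffAt.contDiffWithinAt ?_
  set x := φ.symm y with hxdef
  have hx : x ∈ φ.source := φ.map_target hy
  obtain ⟨ρ, hρ, -⟩ := (SmoothBumpFunction.nhds_basis_support (I := 𝓡 n)
    (φ.open_source.mem_nhds hx)).mem_iff.1 (φ.open_source.mem_nhds hx)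
  let σ : ∀ z : M, TangentSpace (𝓡 n) z := (ρ : M → ℝ) • coordField φ b
  have hσ : ContMDiff (𝓡 n) ((𝓡 n).prod 𝓘(ℝ, Model n)) ∞
      (fun z => (⟨z, σ z⟩ : TangentBundle (𝓡 n) M)) :=
    ContMDiffOn.smul_section_of_tsupport ρ.contMDiff.contMDiffOn φ.open_source hρ
      fun z hz => (contMDiffAt_coordField hφ hz b).contMDiffWithinAt
  have hcov : ContMDiffAt (𝓡 n) ((𝓡 n).prod 𝓘(ℝ, Model n)) ∞
      (fun z => (⟨z, cov σ z (coordField φ a z)⟩ : TangentBundle (𝓡 n) M)) x := by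
    have h := (CovariantDerivative.ContMDiffCovariantDerivative.contMDiff
      (cov := cov) (k := ∞)).contMDiff (σ := σ) (by simpa using hσ.contMDiffOn)
    exact ContMDiffAt.clm_bundle_apply (h.contMDiffAt Filter.univ_mem)
      (contMDiffAt_coordField hφ hx a)
  have h1 : ContDiffAt ℝ ∞
      (fun z => chartDeriv φ (φ.symm z) (cov σ (φ.symm z) (coordField φ a (φ.symm z))) c) y :=
    (EuclideanSpace.proj (𝕜 := ℝ) c).contDiff.contDiffAt.comp y
      (contDiffAt_chartDeriv hφ hy (V := fun z => cov σ z (coordField φ a z)) hcov)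
  refine h1.congr_of_eventuallyEq ?_
  have hnear : ∀ᶠ z in nhds x, cov (coordField φ b) z = cov σ z := by
    filter_upwards [ρ.eventuallyEq_one.eventually_nhds, φ.open_source.mem_nhds hx] with z hz hzs
    refine cov.isCovariantDerivativeOnUniv.congr_of_eventuallyEq
      (mdifferentiableAt_coordField hφ hzs b)
      ((hσ z).mdifferentiableAt (by simp)) Filter.univ_mem ?_
    filter_upwards [hz] with w hw
    simp [σ, hw]
  filter_upwards [(φ.continuousAt_symm hy).eventually hnear] with z hz
  simp only [christoffel, hz]

theorem mlieBracket_coordField (hφ : φ ∈ IsManifold.maximalAtlas (𝓡 n) ∞ M)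
    (hx : x ∈ φ.source) (a b : Fin n) :
    VectorField.mlieBracket (𝓡 n) (coordField φ a) (coordField φ b) x = 0 := by
  have hc : ∀ b : Fin n, MDifferentiableAt (𝓡 n) ((𝓡 n).prod 𝓘(ℝ, Model n))
      (fun z => (⟨z, (EuclideanSpace.single b 1 : Model n)⟩ : TangentBundle (𝓡 n) (Model n)))
      (φ x) := fun b =>
    (contMDiffAt_vectorSpace_iff_contDiffAt.2
      (contDiffAt_const (n := 1))).mdifferentiableAt (by simp)
  have h2 : minSmoothness ℝ 2 ≤ (∞ : ℕ∞ω) := by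
    rw [minSmoothness_of_isRCLikeNormedField]
    exact ENat.LEInfty.out
  have : IsManifold (𝓡 n) (minSmoothness ℝ 2) M := IsManifold.of_le h2
  have hflat : ∀ (V W : ∀ z : Model n, TangentSpace (𝓡 n) z) (z : Model n),
      VectorField.mlieBracket (𝓡 n) V W z
        = VectorField.lieBracketWithin ℝ (E := Model n) V W Set.univ z := by
    intro V W z
    rw [← VectorField.mlieBracketWithin_univ, VectorField.mlieBracketWithin_eq_lieBracketWithin]
  have hconst : ∀ (v w z : Model n), VectorField.mlieBracket (𝓡 n)
      (fun _ => v : ∀ z : Model n, TangentSpace (𝓡 n) z) (fun _ => w) z = 0 := by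
    intro v w z
    have h0 : VectorField.lieBracketWithin ℝ (fun _ : Model n => v) (fun _ => w) Set.univ z = 0 := by
      simp [VectorField.lieBracketWithin]
    exact (hflat (fun _ => v) (fun _ => w) z).trans h0
  rw [coordField_eq_mpullback, coordField_eq_mpullback,
    ← VectorField.mpullback_mlieBracket (hc a) (hc b) (contMDiffAt_chart hφ hx) h2,
    VectorField.mpullback_apply]
  exact (congrArg _ (hconst _ _ _)).trans (map_zero _)

theorem isTorsionFreeOn_christoffel [T2Space M] (cov : AffineConn n M)
    [CovariantDerivative.ContMDiffCovariantDerivative cov ∞] (htor : cov.torsion = 0)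
    (hφ : φ ∈ IsManifold.maximalAtlas (𝓡 n) ∞ M) :
    IsTorsionFreeOn (christoffel cov φ) φ.target where
  isOpen := φ.open_target
  smooth := contDiffOn_christoffel cov hφ
  symm c a b y hy := by
    have hx := φ.map_target hy
    have h := cov.torsion_eq_zero_iff.1 htor (mdifferentiableAt_coordField hφ hx a)
      (mdifferentiableAt_coordField hφ hx b)
    rw [mlieBracket_coordField hφ hx, sub_eq_zero] at h
    simp only [christoffel, h]

theorem christoffel_eq_of_projRelated {cov cov' : AffineConn n M}
    {Υ : ∀ x : M, TangentSpace (𝓡 n) x →L[ℝ] ℝ} (hΥ : ProjRelated cov cov' Υ)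
    (hφ : φ ∈ IsManifold.maximalAtlas (𝓡 n) ∞ M) (c a b : Fin n) (hy : y ∈ φ.target) :
    christoffel cov' φ c a b y = christoffel cov φ c a b y
      + (if c = b then formComp Υ φ a y else 0) + (if c = a then formComp Υ φ b y else 0) := by
  have hx := φ.map_target hy
  rw [christoffel, hΥ _ _ (mdifferentiableAt_coordField hφ hx b), map_add, map_add, map_smul,
    map_smul, chartDeriv_coordField hφ hx, chartDeriv_coordField hφ hx]
  simp [christoffel, formComp, PiLp.single_apply]

/-- The one-form relating two smooth connections is smooth, being a multiple of the difference of
the contracted connection coefficients. -/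
theorem isProjectiveChangeOn_christoffel [T2Space M] (cov cov' : AffineConn n M)
    [CovariantDerivative.ContMDiffCovariantDerivative cov ∞]
    [CovariantDerivative.ContMDiffCovariantDerivative cov' ∞]
    {Υ : ∀ x : M, TangentSpace (𝓡 n) x →L[ℝ] ℝ} (htor : cov.torsion = 0)
    (htor' : cov'.torsion = 0) (hΥ : ProjRelated cov cov' Υ)
    (hφ : φ ∈ IsManifold.maximalAtlas (𝓡 n) ∞ M) :
    IsProjectiveChangeOn (christoffel cov φ) (christoffel cov' φ) (formComp Υ φ) φ.target where
  left := isTorsionFreeOn_christoffel cov htor hφ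
  right := isTorsionFreeOn_christoffel cov' htor' hφ
  eq c a b y hy := christoffel_eq_of_projRelated hΥ hφ c a b hy
  smooth b := by
    have h := (isTorsionFreeOn_christoffel cov htor hφ).smooth_traceForm b
    have h' := (isTorsionFreeOn_christoffel cov' htor' hφ).smooth_traceForm b
    refine ((h'.sub h).div_const ((n : ℝ) + 1)).congr fun y hy => ?_
    have hn : ((n : ℝ) + 1) ≠ 0 := by positivity
    rw [eq_div_iff hn, traceForm_eq_of_projective fun c a b =>
      christoffel_eq_of_projRelated hΥ hφ c a b hy]
    ring

end Charts

end ProjTractor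

end

theorem proposition3p7 (r : ℕ) (hr : 1 ≤ r) :
    ∃ Kurv : CurvFormula r,
      ∀ (n : ℕ), 2 ≤ n →
      ∀ (M : Type*) [TopologicalSpace M] [T2Space M] [ChartedSpace (Model n) M]
        [IsManifold (𝓡 n) ∞ M] (cov : AffineConn n M)
        [CovariantDerivative.ContMDiffCovariantDerivative cov ∞],
      cov.torsion = 0 →
        -- the characterisation of Killing tensors
        (∀ k : SymTensorDensity n M r (2 * r),
          IsKilling cov k ↔
            ∀ φ ∈ IsManifold.maximalAtlas (𝓡 n) ∞ M, ∀ y ∈ φ.target,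
            ∀ (U : Fin 0 → TIdx n) (L : Fin (r + r) → TIdx n),
              splitting (christoffel cov φ) (k.comp φ) y U L
                = (((r : ℝ) + 1) / 2 ^ r)
                    * thomasDPow (christoffel cov φ) r (tractorOf (k.comp φ)) r y U L
                  + Kurv.eval (christoffel cov φ) (tractorOf (k.comp φ)) y U L) ∧
        -- projective invariance of the operator
        (∀ (cov' : AffineConn n M) [CovariantDerivative.ContMDiffCovariantDerivative cov' ∞]
          (Υ : ∀ x : M, TangentSpace (𝓡 n) x →L[ℝ] ℝ),
          cov'.torsion = 0 → ProjRelated cov cov' Υ →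
          ∀ φ ∈ IsManifold.maximalAtlas (𝓡 n) ∞ M,
          ∀ K : TField n 0 r, SmoothOn K φ.target →
          ∀ y ∈ φ.target, ∀ (U : Fin 0 → TIdx n) (L : Fin (r + r) → TIdx n),
            Kurv.eval (christoffel cov' φ) (changeScale (formComp Υ φ) K) y U L
              = changeScale (formComp Υ φ) (Kurv.eval (christoffel cov φ) K) y U L) := by
  obtain ⟨F, hF⟩ := exists_formula_young hr
  refine ⟨F, fun n hn M _ _ _ _ cov _ htor => ⟨fun k => ?_, ?_⟩⟩
  · have hiff := fun φ (hφ : φ ∈ IsManifold.maximalAtlas (𝓡 n) ∞ M) =>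
      killing_iff_splitting hr hF hn (isTorsionFreeOn_christoffel cov htor hφ) (k.smooth φ hφ)
        fun y hy i σ => k.comp_perm hφ hy i σ
    exact forall₂_congr hiff
  · intro cov' _ Υ htor' hΥ φ hφ K hK y hy U L
    exact (isProjectiveChangeOn_christoffel cov cov' htor htor' hΥ hφ).eval_changeScale hn F hK hy
      U L
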